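/- Conventions. A polyhedral surface $S\subset\mathbb R^n$ is the underlying space of a finite geometric simplicial complex which is a connected compact surface, with or without boundary (every simplex lies in a triangle, and the link of every vertex is a path or a cycle); its vertices and edges are those of the complex, and its boundary $\partial S$ is the union of its boundary edges, i.e. of the edges lying in exactly one triangle. A subset $X\subset\mathbb R^n$ is $p$-tight if for every open affine half-space $E$ the map $H_p(X\cap E;\mathbb Z/2)\to H_p(X;\mathbb Z/2)$ induced by the inclusion is injective, and tight if it is $p$-tight for all $p$. Proposition. Let $S\subset\mathbb R^n$ be a polyhedral surface and let $[ab]$ and $[cd]$ be two boundary edges of $S$ such that $a,b,c,d$ are affinely independent and the interior (relative to its affine span) of the tetrahedron $abcd$ does not meet $S$. Let $S'$ be the surface obtained from $S$ by attaching a handle between $[ab]$ and $[cd]$, that is, by gluing the band $[0,1]\times[0,1]$ to $S$ along $\{0\}\times[0,1]$ by a homeomorphism $\gamma_0$ onto $[ab]$ with $\gamma_0(0)=a$, $\gamma_0(1)=b$, and along $\{1\}\times[0,1]$ by a homeomorphism $\gamma_1$ onto $[cd]$ with $\gamma_1(0)=c$, $\gamma_1(1)=d$. (The other way of gluing the handle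 is covered by exchanging the names $c$ and $d$.) Then $S'$ has a polyhedral embedding in the same space $\mathbb R^n$ that extends the inclusion of $S$. More precisely, there are a polyhedral surface $\widehat S\subset\mathbb R^n$ and a homeomorphism $S'\to\widehat S$ which is the identity on $S$, such that: the complex of $\widehat S$ contains that of $S$; the vertices of $\widehat S$ are those of $S$ together with the two points $$e=\tfrac16(2a+b+2c+d),\qquad f=\tfrac16(a+2b+c+2d)$$ (barycentric weights $(2,1,2,1)$ and $(1,2,1,2)$ in $(a,b,c,d)$); $\widehat S$ is contained in the union of $S$ and the tetrahedron $abcd$; if $S$ is $0$-tight, then $\widehat S$ is $0$-tight; if $S$ is tight, then $\widehat S$ is tight; and if all vertices of $S$ lie on $\partial S$, then all vertices of $\widehat S$ lie on $\partial\widehat S$. -/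

import Mathlib

open Geometry CategoryTheory

/-! ### Tight subsets of Euclidean space -/

/-- The `p`-th singular homology group of a subset `X` of `ℝⁿ`, with coefficients in `ℤ/2`. -/
noncomputable abbrev homologyMod2 {n : ℕ} (p : ℕ) (X : Set (EuclideanSpace ℝ (Fin n))) :
    ModuleCat.{0} (ZMod 2) :=
  ((AlgebraicTopology.singularHomologyFunctor (ModuleCat.{0} (ZMod 2)) p).obj
    (ModuleCat.of (ZMod 2) (ZMod 2))).obj (TopCat.of X)

/-- The map `H_p(Y; ℤ/2) → H_p(X; ℤ/2)` induced by an inclusion `Y ⊆ X`. -/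
noncomputable def homologyMod2Inclusion {n : ℕ} (p : ℕ) {Y X : Set (EuclideanSpace ℝ (Fin n))}
    (h : Y ⊆ X) : homologyMod2 p Y ⟶ homologyMod2 p X :=
  ((AlgebraicTopology.singularHomologyFunctor (ModuleCat.{0} (ZMod 2)) p).obj
    (ModuleCat.of (ZMod 2) (ZMod 2))).map
      (TopCat.ofHom ⟨Set.inclusion h, continuous_inclusion h⟩)

/-- `X` is `p`-tight: for every open affine half-space `{x | r < l x}` (`l ≠ 0`), the map
`H_p(X ∩ {r < l}) → H_p(X)` induced by the inclusion is injective (coefficients in `ℤ/2`). -/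
def IsPTight {n : ℕ} (p : ℕ) (X : Set (EuclideanSpace ℝ (Fin n))) : Prop :=
  ∀ l : EuclideanSpace ℝ (Fin n) →ₗ[ℝ] ℝ, l ≠ 0 → ∀ r : ℝ,
    Function.Injective
      (homologyMod2Inclusion p (Set.inter_subset_left : X ∩ {x | r < l x} ⊆ X)).hom

/-- `X` is tight if it is `p`-tight for all `p`. -/
def IsTight {n : ℕ} (X : Set (EuclideanSpace ℝ (Fin n))) : Prop :=
  ∀ p : ℕ, IsPTight p X

/-! ### Polyhedral surfaces -/

/-- The triangles (2-dimensional simplices) of `K` that contain the simplex `s`. -/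
def trianglesContaining {n : ℕ} (K : SimplicialComplex ℝ (EuclideanSpace ℝ (Fin n)))
    (s : Finset (EuclideanSpace ℝ (Fin n))) : Set (Finset (EuclideanSpace ℝ (Fin n))) :=
  {t | t ∈ K.faces ∧ t.card = 3 ∧ s ⊆ t}

open Classical in
/-- The link of a vertex `v` of a complex of dimension at most 2, as a graph: its vertices are
the neighbours of `v`, and `w`, `w'` are joined if `v`, `w`, `w'` span a triangle. -/
def linkGraph {n : ℕ} (K : SimplicialComplex ℝ (EuclideanSpace ℝ (Fin n)))
    (v : EuclideanSpace ℝ (Fin n)) :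
    SimpleGraph {w : EuclideanSpace ℝ (Fin n) // w ≠ v ∧ {v, w} ∈ K.faces} where
  Adj w w' := w ≠ w' ∧ {v, w.1, w'.1} ∈ K.faces
  symm := ⟨fun w w' h => ⟨h.1.symm, by rw [Finset.pair_comm]; exact h.2⟩⟩
  loopless := ⟨fun _ h => h.1 rfl⟩

/-- `K` is a (compact, connected) polyhedral surface, with or without boundary: a finite
simplicial complex in `ℝⁿ` with connected underlying space, in which every simplex lies in a
triangle and no simplex has dimension more than 2, every edge lies in at most two triangles, and
all vertex links are connected (with the other conditions, this says that the link of every vertex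
is a path or a cycle, i.e. that the underlying space is a surface). -/
structure IsPolyhedralSurface {n : ℕ} (K : SimplicialComplex ℝ (EuclideanSpace ℝ (Fin n))) :
    Prop where
  finite : K.faces.Finite
  connected : IsConnected K.space
  pure : ∀ s ∈ K.faces, ∃ t ∈ K.faces, t.card = 3 ∧ s ⊆ t
  edge : ∀ s ∈ K.faces, s.card = 2 → (trianglesContaining K s).ncard ≤ 2
  link : ∀ v ∈ K.vertices, (linkGraph K v).Connected

/-- A boundary edge: an edge of `K` that lies in exactly one triangle. -/
def IsBoundaryEdge {n : ℕ} (K : SimplicialComplex ℝ (EuclideanSpace ℝ (Fin n)))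
    (s : Finset (EuclideanSpace ℝ (Fin n))) : Prop :=
  s ∈ K.faces ∧ s.card = 2 ∧ ∃! t, t ∈ trianglesContaining K s

/-- The boundary of a polyhedral surface: the union of its boundary edges. -/
def surfaceBoundary {n : ℕ} (K : SimplicialComplex ℝ (EuclideanSpace ℝ (Fin n))) :
    Set (EuclideanSpace ℝ (Fin n)) :=
  ⋃ s ∈ {s | IsBoundaryEdge K s}, convexHull ℝ (s : Set (EuclideanSpace ℝ (Fin n)))

/-! ### Attaching a handle -/

/-- `γ` is a homeomorphism of `[0, 1]` onto the segment `[x y]`, going from `x` to `y`. -/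
structure IsSegmentParam {n : ℕ} (γ : unitInterval → EuclideanSpace ℝ (Fin n))
    (x y : EuclideanSpace ℝ (Fin n)) : Prop where
  continuous : Continuous γ
  injective : Function.Injective γ
  range_eq : Set.range γ = segment ℝ x y
  source : γ 0 = x
  target : γ 1 = y

/-- The identifications that glue the band `[0, 1] × [0, 1]` to `X` along its two sides
`{0} × [0, 1]` (by `γ₀`) and `{1} × [0, 1]` (by `γ₁`). -/
def HandleRel {n : ℕ} (X : Set (EuclideanSpace ℝ (Fin n)))
    (γ₀ γ₁ : unitInterval → EuclideanSpace ℝ (Fin n)) :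
    X ⊕ (unitInterval × unitInterval) → X ⊕ (unitInterval × unitInterval) → Prop
  | .inl x, .inr p =>
      (p.1 = 0 ∧ (x : EuclideanSpace ℝ (Fin n)) = γ₀ p.2) ∨
        (p.1 = 1 ∧ (x : EuclideanSpace ℝ (Fin n)) = γ₁ p.2)
  | _, _ => False

/-- The topological space obtained from `X` by attaching a handle (the band `[0, 1] × [0, 1]`)
along `γ₀` and `γ₁`: the quotient of the disjoint union by the identifications `HandleRel`. -/
abbrev HandleAttachment {n : ℕ} (X : Set (EuclideanSpace ℝ (Fin n)))
    (γ₀ γ₁ : unitInterval → EuclideanSpace ℝ (Fin n)) : Type :=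
  Quot (HandleRel X γ₀ γ₁)

/-!
# Attaching a handle to a polyhedral surface inside an empty tetrahedron

The band is embedded in the tetrahedron `abcd` as the union of the triangles `abe`, `bef`, `def`,
`cde`. If `α, β, γ, δ` are the barycentric coordinates of a point of the band with respect to
`a, b, c, d`, then its weights at `a` and `c` are the positive and negative parts of `α - γ`, and
its weights at `b` and `d` are those of `β - δ`, since no triangle contains both `a` and `c` or both
`b` and `d`, and `e` and `f` contribute equally to `α, γ` and to `β, δ`. So a point has only one
system of weights on the band (`bandWeight_unique`), the triangles meet in common faces, and
all points of the band outside `ab` and `cd` are in the open tetrahedron, away from `K`. This gives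
the complex `HandleSite.complex`; its links and boundary edges are a finite verification. The
homeomorphism with the abstract handle attachment (`HandleSite.exists_homeomorph`) comes from an
explicit parametrization of the band, which interpolates between the two given parametrizations of
the edges.

For tightness, the part of a finite complex in an open half-space deforms to the full subcomplex
spanned by the vertices in the half-space (`homologyInjective_halfSpace_iff`), so that full
subcomplexes may be compared. Let `W` be the set of points of the half-space, `A₀` and `A₁` the full
subcomplexes of `K` and of the new complex spanned by the vertices in `W`.

In degree zero, `A₀` is path connected if `K` is `0`-tight. As `e` is a mean of `a, b, c, d`, which
are its neighbours, and `f` is a mean of its neighbours `b, d, e`, each of `e`, `f` in the half-space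
is joined in `A₁` to a vertex of `A₀`. Hence `A₁` is path connected
(`HandleSite.homologyInjective_zero_complex`).

In positive degrees, a Mayer-Vietoris argument (`SingularChain.homologyInjective_of_band`) is used.
The new complex is covered by the points with total weight less than `1` on `e` and `f`, which
deform to `K` compatibly with the subcomplexes, and the points with positive weight on `e` or `f`;
the intersection consists of two ends of the band. In `A₁`, the second set and the two ends are
empty or star-shaped about points that depend on which of the vertices belong to `W`. A cycle of
`A₁` is cut along the two ends into a chain of the first set and a chain of the second one. If the
cycle bounds in the new complex, then its cut at each end bounds there: in degree one, where this
is not automatic, the cut has an even number of points, because a bounding chain subordinate to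
the cover bounds it in the end. So the cycle is homologous in `A₁` to a sum of a cycle of the
second set, which bounds, and a cycle of the first set, which deforms into `A₀`.
Finally, `K` is a retract of the new complex
(`HandleSite.homologyInjective_space_complex`), because the two edge parametrizations are homotopic
in the path connected space of `K`; so a cycle of `A₀` that bounds in the new complex bounds in `K`,
and by tightness in `A₀`.

The homological arguments use concrete singular chains modulo 2, in a fixed ambient space, so
that all subsets are compared on the level of chains; `homologyMod2Inclusion_injective_iff` is the
translation. Small chains are obtained by iterated barycentric subdivision.
-/

/-! ### Homology of complexes of modules in terms of cycles -/

section HomologyOfModules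

variable {k : Type} [Ring k]

lemma ChainComplex.exists_d_eq_iff_pOpcycles_eq_zero (K : ChainComplex (ModuleCat.{0} k) ℕ) (p : ℕ)
    (x : K.X p) :
    (K.pOpcycles p).hom x = 0 ↔ ∃ y : K.X (p + 1), (K.d (p + 1) p).hom y = x := by
  have h := ShortComplex.moduleCat_pOpcycles_eq_zero_iff (S := K.sc p) x
  have hp : (ComplexShape.down ℕ).prev p = p + 1 := by simp
  refine h.trans ?_
  change (∃ y : K.X ((ComplexShape.down ℕ).prev p), (K.d _ p).hom y = x) ↔ _
  rw [hp]

/-- A chain map is injective on homology iff every cycle of the source whose image bounds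
is itself a boundary. -/
lemma ChainComplex.homologyMap_injective_iff {K L : ChainComplex (ModuleCat.{0} k) ℕ}
    (F : K ⟶ L) (p : ℕ) :
    Function.Injective (HomologicalComplex.homologyMap F p).hom ↔
      ∀ x : K.X p, (K.d p (p - 1)).hom x = 0 →
        (∃ y : L.X (p + 1), (L.d (p + 1) p).hom y = (F.f p).hom x) →
        ∃ y : K.X (p + 1), (K.d (p + 1) p).hom y = x := by
  have hπι : ∀ (M : ChainComplex (ModuleCat.{0} k) ℕ) (z : M.cycles p),
      (M.homologyι p).hom ((M.homologyπ p).hom z) = (M.pOpcycles p).hom ((M.iCycles p).hom z) := by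
    intro M z
    have := M.homology_π_ι p
    rw [← ModuleCat.comp_apply, this, ModuleCat.comp_apply]
  have hι : ∀ M : ChainComplex (ModuleCat.{0} k) ℕ,
      Function.Injective (M.homologyι p).hom := fun M =>
    (ModuleCat.mono_iff_injective _).1 inferInstance
  have hπ : Function.Surjective (K.homologyπ p).hom :=
    (ModuleCat.epi_iff_surjective _).1 inferInstance
  have hnext : (ComplexShape.down ℕ).next p = p - 1 := by
    cases p with
    | zero => simp
    | succ q => simp
  have hzero : ∀ z : K.cycles p, (HomologicalComplex.homologyMap F p).hom
      ((K.homologyπ p).hom z) = 0 ↔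
      ∃ y : L.X (p + 1), (L.d (p + 1) p).hom y = (F.f p).hom ((K.iCycles p).hom z) := by
    intro z
    have h1 : (HomologicalComplex.homologyMap F p).hom ((K.homologyπ p).hom z) =
        (L.homologyπ p).hom ((HomologicalComplex.cyclesMap F p).hom z) := by
      rw [← ModuleCat.comp_apply, HomologicalComplex.homologyπ_naturality, ModuleCat.comp_apply]
    have h2 : (L.iCycles p).hom ((HomologicalComplex.cyclesMap F p).hom z) =
        (F.f p).hom ((K.iCycles p).hom z) := by
      rw [← ModuleCat.comp_apply, HomologicalComplex.cyclesMap_i, ModuleCat.comp_apply]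
    rw [h1, ← L.exists_d_eq_iff_pOpcycles_eq_zero, ← h2, ← hπι, map_eq_zero_iff _ (hι L)]
  have hzero' : ∀ z : K.cycles p, (K.homologyπ p).hom z = 0 ↔
      ∃ y : K.X (p + 1), (K.d (p + 1) p).hom y = (K.iCycles p).hom z := by
    intro z
    rw [← K.exists_d_eq_iff_pOpcycles_eq_zero, ← hπι, map_eq_zero_iff _ (hι K)]
  rw [injective_iff_map_eq_zero]
  constructor
  · intro h x hx hy
    obtain ⟨z, rfl⟩ : ∃ z : K.cycles p, (K.iCycles p).hom z = x := by
      refine ⟨K.cyclesMk x (p - 1) hnext hx, ?_⟩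
      exact K.i_cyclesMk x (p - 1) hnext hx
    exact (hzero' z).1 (h _ ((hzero z).2 hy))
  · intro h x hx
    obtain ⟨z, rfl⟩ := hπ x
    refine (hzero' z).2 (h _ ?_ ((hzero z).1 hx))
    rw [← ModuleCat.comp_apply, K.iCycles_d]
    rfl

end HomologyOfModules

/-! ### Singular chains modulo 2 -/

/-- Singular `n`-simplices of `X`. -/
abbrev SingularSimplex (n : ℕ) (X : Type) [TopologicalSpace X] : Type :=
  C(stdSimplex ℝ (Fin (n + 1)), X)

/-- Singular `n`-chains of `X` with coefficients in `ℤ/2`. -/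
abbrev SingularChain (n : ℕ) (X : Type) [TopologicalSpace X] : Type :=
  SingularSimplex n X →₀ ZMod 2

namespace SingularChain

variable {X Y Z : Type} [TopologicalSpace X] [TopologicalSpace Y] [TopologicalSpace Z]

/-- The inclusion of the `i`-th face of the standard simplex. -/
noncomputable def face {n : ℕ} (i : Fin (n + 2)) :
    C(stdSimplex ℝ (Fin (n + 1)), stdSimplex ℝ (Fin (n + 2))) :=
  ⟨stdSimplex.map i.succAbove, stdSimplex.continuous_map _⟩

/-- The boundary operator; no signs are needed modulo 2. -/
noncomputable def d (n : ℕ) : SingularChain (n + 1) X →ₗ[ZMod 2] SingularChain n X :=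
  Finsupp.linearCombination (ZMod 2) fun σ => ∑ i, Finsupp.single (σ.comp (face i)) 1

/-- The map of chains induced by a continuous map. -/
noncomputable def map (n : ℕ) (f : C(X, Y)) : SingularChain n X →ₗ[ZMod 2] SingularChain n Y :=
  Finsupp.lmapDomain _ _ fun σ => f.comp σ

@[simp] lemma d_single (n : ℕ) (σ : SingularSimplex (n + 1) X) :
    d n (Finsupp.single σ 1) = ∑ i, Finsupp.single (σ.comp (face i)) 1 := by
  simp [d]

@[simp] lemma map_single (n : ℕ) (f : C(X, Y)) (σ : SingularSimplex n X) (r : ZMod 2) :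
    map n f (Finsupp.single σ r) = Finsupp.single (f.comp σ) r := by
  simp [map, Finsupp.mapDomain_single]

lemma d_map (n : ℕ) (f : C(X, Y)) (c : SingularChain (n + 1) X) :
    d n (map (n + 1) f c) = map n f (d n c) := by
  suffices h : d n ∘ₗ map (n + 1) f = map n f ∘ₗ d n from LinearMap.congr_fun h c
  ext1 σ
  ext1
  simp [map_sum, ContinuousMap.comp_assoc]

lemma map_comp (n : ℕ) (g : C(Y, Z)) (f : C(X, Y)) (c : SingularChain n X) :
    map n (g.comp f) c = map n g (map n f c) := by
  suffices h : map n (g.comp f) = map n g ∘ₗ map n f from LinearMap.congr_fun h c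
  ext1 σ
  ext1
  simp [ContinuousMap.comp_assoc]

lemma map_injective (n : ℕ) {f : C(X, Y)} (hf : Function.Injective f) :
    Function.Injective (map n f) :=
  Finsupp.mapDomain_injective fun σ τ h => by
    ext x
    exact hf (DFunLike.congr_fun h x)

/-- Cycles; in degree `0` every chain is a cycle. -/
def IsCycle : ∀ {n : ℕ}, SingularChain n X → Prop
  | 0, _ => True
  | n + 1, c => d n c = 0

/-! ### Comparison with the singular chain complex of Mathlib -/

open Limits

/-- The coefficient module. -/
abbrev coeffMod2 : ModuleCat.{0} (ZMod 2) := ModuleCat.of (ZMod 2) (ZMod 2)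

/-- The singular chain complex of `X` with coefficients in `ℤ/2`. -/
noncomputable abbrev singularComplex (X : TopCat.{0}) : ChainComplex (ModuleCat.{0} (ZMod 2)) ℕ :=
  (TopCat.toSSet.obj X).chainComplex coeffMod2

/-- The map of singular chain complexes induced by a continuous map. -/
noncomputable abbrev singularComplexMap {X Y : TopCat.{0}} (f : X ⟶ Y) :
    singularComplex X ⟶ singularComplex Y :=
  SSet.chainComplexMap (TopCat.toSSet.map f) coeffMod2

/-- The generator of the singular chain complex that belongs to a singular simplex. -/
noncomputable def generator (X : TopCat.{0}) (n : ℕ) (σ : SingularSimplex n X) :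
    coeffMod2 ⟶ (singularComplex X).X n :=
  (TopCat.toSSet.obj X).ιChainComplex ((X.toSSetObjEquiv (.op (.mk n))).symm σ)

/-- Concrete chains as elements of the singular chain complex. -/
noncomputable def toComplex (X : TopCat.{0}) (n : ℕ) :
    SingularChain n X →ₗ[ZMod 2] (singularComplex X).X n :=
  Finsupp.lsum (ZMod 2) fun σ => (generator X n σ).hom

lemma toComplex_single (X : TopCat.{0}) (n : ℕ) (σ : SingularSimplex n X) (r : ZMod 2) :
    toComplex X n (Finsupp.single σ r) = (generator X n σ).hom r := by
  simp [toComplex]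

lemma toComplex_bijective (X : TopCat.{0}) (n : ℕ) : Function.Bijective (toComplex X n) := by
  let e := X.toSSetObjEquiv (.op (.mk n))
  let F : Cofan (fun _ : (TopCat.toSSet.obj X).obj (.op (.mk n)) => coeffMod2) :=
    Cofan.mk (ModuleCat.of (ZMod 2) (SingularChain n X))
      fun x => ModuleCat.ofHom (Finsupp.lsingle (e x))
  let h := (TopCat.toSSet.obj X).isColimitChainComplexXCofan coeffMod2 n
  let inv : (singularComplex X).X n ⟶ ModuleCat.of (ZMod 2) (SingularChain n X) := h.desc F
  have hinv : ∀ x, (TopCat.toSSet.obj X).ιChainComplex x ≫ inv =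
      ModuleCat.ofHom (Finsupp.lsingle (e x)) := fun x => h.fac F ⟨x⟩
  have h1 : inv ≫ ModuleCat.ofHom (toComplex X n) = 𝟙 _ := by
    refine SSet.chainComplex_hom_ext fun x => ?_
    rw [← Category.assoc, hinv]
    ext
    simp [toComplex, generator, e]
  have h2 : ModuleCat.ofHom (toComplex X n) ≫ inv = 𝟙 _ := by
    ext1
    ext1 σ
    ext1
    have := hinv (e.symm σ)
    have := ConcreteCategory.congr_hom this (1 : ZMod 2)
    simp [toComplex, generator, e] at this ⊢
    exact this
  refine Function.bijective_iff_has_inverse.2 ⟨inv.hom, fun x => ?_, fun x => ?_⟩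
  · exact ConcreteCategory.congr_hom h2 x
  · exact ConcreteCategory.congr_hom h1 x

lemma generator_d (X : TopCat.{0}) (n : ℕ) (σ : SingularSimplex (n + 1) X) :
    generator X (n + 1) σ ≫ (singularComplex X).d (n + 1) n =
      ∑ i, generator X n (σ.comp (face i)) := by
  have := SSet.ιChainComplex_d (R := coeffMod2) (TopCat.toSSet.obj X)
    ((X.toSSetObjEquiv (.op (.mk (n + 1)))).symm σ)
  refine this.trans (Finset.sum_congr rfl fun i _ => ?_)
  have h2 : ∀ m : coeffMod2 ⟶ (singularComplex X).X n, (-1 : ℤ) ^ (i : ℕ) • m = m := by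
    intro m
    rcases neg_one_pow_eq_or ℤ (i : ℕ) with h | h
    · rw [h, one_smul]
    · rw [h, neg_smul, one_smul]
      ext
      simp only [ModuleCat.hom_neg, LinearMap.neg_apply]
      exact ZModModule.neg_eq_self _
  exact h2 _

lemma generator_map {X Y : TopCat.{0}} (f : X ⟶ Y) (n : ℕ) (σ : SingularSimplex n X) :
    generator X n σ ≫ (singularComplexMap f).f n = generator Y n (f.hom.comp σ) :=
  SSet.ι_chainComplexMap_f _ _ (TopCat.toSSet.map f) coeffMod2 _

lemma toComplex_d (X : TopCat.{0}) (n : ℕ) (c : SingularChain (n + 1) X) :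
    ((singularComplex X).d (n + 1) n).hom (toComplex X (n + 1) c) = toComplex X n (d n c) := by
  suffices h : ((singularComplex X).d (n + 1) n).hom ∘ₗ toComplex X (n + 1) =
      toComplex X n ∘ₗ d n from LinearMap.congr_fun h c
  ext1 σ
  ext1
  have := ConcreteCategory.congr_hom (generator_d X n σ) (1 : ZMod 2)
  simp only [LinearMap.comp_apply, Finsupp.lsingle_apply, d_single, map_sum, toComplex_single]
  refine this.trans ?_
  simp

lemma toComplex_map {X Y : TopCat.{0}} (f : X ⟶ Y) (n : ℕ) (c : SingularChain n X) :
    ((singularComplexMap f).f n).hom (toComplex X n c) =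
      toComplex Y n (map n f.hom c) := by
  suffices h : ((singularComplexMap f).f n).hom ∘ₗ toComplex X n =
      toComplex Y n ∘ₗ map n f.hom from LinearMap.congr_fun h c
  ext1 σ
  ext1
  have := ConcreteCategory.congr_hom (generator_map f n σ) (1 : ZMod 2)
  simp only [LinearMap.comp_apply, Finsupp.lsingle_apply, map_single, toComplex_single]
  exact this

lemma toComplex_eq_zero_iff (X : TopCat.{0}) (n : ℕ) (c : SingularChain n X) :
    toComplex X n c = 0 ↔ c = 0 :=
  map_eq_zero_iff _ (toComplex_bijective X n).1

lemma isCycle_iff (X : TopCat.{0}) (n : ℕ) (c : SingularChain n X) :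
    ((singularComplex X).d n (n - 1)).hom (toComplex X n c) = 0 ↔ IsCycle c := by
  cases n with
  | zero =>
    simp only [IsCycle, iff_true]
    rw [(singularComplex X).shape _ _ (by simp)]
    rfl
  | succ n =>
    rw [Nat.add_sub_cancel, toComplex_d, toComplex_eq_zero_iff]
    rfl

/-- Injectivity of an induced map in homology, in terms of singular chains. -/
lemma homology_map_injective_iff {X Y : TopCat.{0}} (f : X ⟶ Y) (n : ℕ) :
    Function.Injective (((AlgebraicTopology.singularHomologyFunctor
      (ModuleCat.{0} (ZMod 2)) n).obj coeffMod2).map f).hom ↔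
      ∀ c : SingularChain n X, IsCycle c → (∃ b, d n b = map n f.hom c) → ∃ b, d n b = c := by
  refine (ChainComplex.homologyMap_injective_iff (singularComplexMap f) n).trans ?_
  refine (toComplex_bijective X n).2.forall.trans (forall_congr' fun c => ?_)
  rw [isCycle_iff]
  refine imp_congr_right fun _ => imp_congr ?_ ?_
  · rw [(toComplex_bijective Y (n + 1)).2.exists]
    refine exists_congr fun b => ?_
    rw [toComplex_d, toComplex_map]
    exact (toComplex_bijective Y n).1.eq_iff
  · rw [(toComplex_bijective X (n + 1)).2.exists]
    refine exists_congr fun b => ?_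
    rw [toComplex_d]
    exact (toComplex_bijective X n).1.eq_iff

/-- Homotopic maps send a cycle to homologous cycles. -/
lemma exists_d_eq_map_add_map_of_homotopic {X Y : Type} [TopologicalSpace X] [TopologicalSpace Y]
    {f g : C(X, Y)} (H : f.Homotopic g) {n : ℕ} {c : SingularChain n X} (hc : IsCycle c) :
    ∃ b, d n b = map n f c + map n g c := by
  obtain ⟨H⟩ := H
  let X' := TopCat.of X
  let Y' := TopCat.of Y
  let f' : X' ⟶ Y' := TopCat.ofHom f
  let g' : X' ⟶ Y' := TopCat.ofHom g
  have h : Homotopy (singularComplexMap f') (singularComplexMap g') :=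
    TopCat.Homotopy.singularChainComplexFunctorObjMap (f := f') (g := g') H coeffMod2
  obtain ⟨b, hb⟩ := (toComplex_bijective Y' (n + 1)).2 ((h.hom n (n + 1)).hom (toComplex X' n c))
  refine ⟨b, (toComplex_bijective Y' n).1 ?_⟩
  have hcomm := h.comm n
  have hcyc := (isCycle_iff X' n c).2 hc
  have hnext : (ComplexShape.down ℕ).next n = n - 1 := by
    cases n with
    | zero => simp
    | succ q => simp
  have e := ConcreteCategory.congr_hom hcomm (toComplex X' n c)
  have e1 : (dNext n h.hom).hom (toComplex X' n c) = 0 := by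
    rw [dNext]
    change (h.hom ((ComplexShape.down ℕ).next n) n).hom
      (((singularComplex X').d n ((ComplexShape.down ℕ).next n)).hom (toComplex X' n c)) = 0
    have : ((singularComplex X').d n ((ComplexShape.down ℕ).next n)).hom
        (toComplex X' n c) = 0 := by
      rw [hnext]; exact hcyc
    rw [this, map_zero]
  have e2 : (prevD n h.hom).hom (toComplex X' n c) = toComplex Y' n (d n b) := by
    rw [← toComplex_d, hb, prevD_eq h.hom (j' := n + 1) (by simp)]
    rfl
  have e3 : toComplex Y' n (map n f c) = toComplex Y' n (d n b) + toComplex Y' n (map n g c) := by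
    refine (toComplex_map f' n c).symm.trans (e.trans ?_)
    refine Eq.trans (congrArg₂ (· + ·) (congrArg₂ (· + ·) e1 e2) (toComplex_map g' n c)) ?_
    rw [zero_add]
    rfl
  rw [map_add, e3, add_assoc, ZModModule.add_self, add_zero]

lemma d_d {X : Type} [TopologicalSpace X] (n : ℕ) (c : SingularChain (n + 2) X) :
    d n (d (n + 1) c) = 0 := by
  let X' := TopCat.of X
  rw [← toComplex_eq_zero_iff X', ← toComplex_d, ← toComplex_d, ← ModuleCat.comp_apply,
    HomologicalComplex.d_comp_d]
  rfl

end SingularChain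

/-! ### Chains of tuples and their subdivision -/

/-- Formal sums modulo 2 of `q`-tuples of elements of `P`. Tuples stand for affine simplices of
dimension `q - 1`; the empty tuple is included, so that the complex is augmented. -/
abbrev TupleChain (q : ℕ) (P : Type) : Type := (Fin q → P) →₀ ZMod 2

namespace TupleChain

variable {P Q : Type}

/-- The boundary of a tuple: the sum of the tuples obtained by leaving out one entry. -/
noncomputable def d (q : ℕ) : TupleChain (q + 1) P →ₗ[ZMod 2] TupleChain q P :=
  Finsupp.linearCombination (ZMod 2) fun v => ∑ i, Finsupp.single (v ∘ Fin.succAbove i) 1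

/-- The cone with apex `x`. -/
noncomputable def cone (q : ℕ) (x : P) : TupleChain q P →ₗ[ZMod 2] TupleChain (q + 1) P :=
  Finsupp.lmapDomain _ _ fun v => (Fin.cons x v : Fin (q + 1) → P)

/-- The map induced by a map of the entries. -/
noncomputable def map (q : ℕ) (f : P → Q) : TupleChain q P →ₗ[ZMod 2] TupleChain q Q :=
  Finsupp.lmapDomain _ _ (f ∘ ·)

@[simp] lemma d_single (q : ℕ) (v : Fin (q + 1) → P) :
    d q (Finsupp.single v 1) = ∑ i, Finsupp.single (v ∘ Fin.succAbove i) 1 := by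
  simp [d]

@[simp] lemma cone_single (q : ℕ) (x : P) (v : Fin q → P) (r : ZMod 2) :
    cone q x (Finsupp.single v r) = Finsupp.single (Fin.cons x v : Fin (q + 1) → P) r := by
  simp [cone, Finsupp.mapDomain_single]

@[simp] lemma map_single (q : ℕ) (f : P → Q) (v : Fin q → P) (r : ZMod 2) :
    map q f (Finsupp.single v r) = Finsupp.single (f ∘ v) r := by
  simp [map, Finsupp.mapDomain_single]

lemma d_cone_zero (x : P) (c : TupleChain 0 P) : d 0 (cone 0 x c) = c := by
  suffices h : d 0 ∘ₗ cone 0 x = LinearMap.id from LinearMap.congr_fun h c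
  ext1 v
  ext1
  simp only [LinearMap.comp_apply, Finsupp.lsingle_apply, cone_single, d_single, LinearMap.id_apply]
  rw [Fin.sum_univ_succ]
  simp only [Finset.univ_eq_empty, Finset.sum_empty, add_zero]
  congr 1

lemma d_cone_succ (q : ℕ) (x : P) (c : TupleChain (q + 1) P) :
    d (q + 1) (cone (q + 1) x c) = c + cone q x (d q c) := by
  suffices h : d (q + 1) ∘ₗ cone (q + 1) x = LinearMap.id + cone q x ∘ₗ d q from
    LinearMap.congr_fun h c
  ext1 v
  ext1
  simp only [LinearMap.comp_apply, Finsupp.lsingle_apply, cone_single, d_single, LinearMap.id_apply,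
    LinearMap.add_apply, map_sum]
  rw [Fin.sum_univ_succ]
  refine congrArg₂ (· + ·) (congrArg (Finsupp.single · 1) rfl) (Finset.sum_congr rfl fun i _ => ?_)
  congr 1
  ext j
  refine Fin.cases ?_ (fun j => ?_) j
  · simp
  · simp

lemma d_d (q : ℕ) (c : TupleChain (q + 2) P) : d q (d (q + 1) c) = 0 := by
  induction q with
  | zero =>
    suffices h : d 0 ∘ₗ d (P := P) 1 = 0 from LinearMap.congr_fun h c
    ext1 v
    ext1
    have hv : (Finsupp.single v 1 : TupleChain 2 P) =
        cone 1 (v 0) (Finsupp.single (Fin.tail v) 1) := by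
      rw [cone_single, Fin.cons_self_tail]
    simp only [LinearMap.comp_apply, Finsupp.lsingle_apply, LinearMap.zero_apply]
    rw [hv, d_cone_succ, map_add, d_cone_zero, ZModModule.add_self]
  | succ q ih =>
    suffices h : d (q + 1) ∘ₗ d (P := P) (q + 2) = 0 from LinearMap.congr_fun h c
    ext1 v
    ext1
    have hv : (Finsupp.single v 1 : TupleChain (q + 3) P) =
        cone (q + 2) (v 0) (Finsupp.single (Fin.tail v) 1) := by
      rw [cone_single, Fin.cons_self_tail]
    simp only [LinearMap.comp_apply, Finsupp.lsingle_apply, LinearMap.zero_apply]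
    rw [hv, d_cone_succ, map_add, d_cone_succ, ih, map_zero, add_zero, ZModModule.add_self]

lemma d_map (q : ℕ) (f : P → Q) (c : TupleChain (q + 1) P) :
    d q (map (q + 1) f c) = map q f (d q c) := by
  suffices h : d q ∘ₗ map (q + 1) f = map q f ∘ₗ d q from LinearMap.congr_fun h c
  ext1 v
  ext1
  simp [map_sum, Function.comp_assoc]

lemma map_cone (q : ℕ) (f : P → Q) (x : P) (c : TupleChain q P) :
    map (q + 1) f (cone q x c) = cone q (f x) (map q f c) := by
  suffices h : map (q + 1) f ∘ₗ cone q x = cone q (f x) ∘ₗ map q f from LinearMap.congr_fun h c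
  ext1 v
  ext1
  simp only [LinearMap.comp_apply, Finsupp.lsingle_apply, cone_single, map_single]
  congr 1
  exact Fin.comp_cons f x v

section Subdivision

variable (b : ∀ q : ℕ, (Fin (q + 1) → P) → P)

/-- Barycentric subdivision, relative to a choice `b` of a barycentre for every tuple: a tuple is
replaced by the cone from its barycentre over the subdivision of its boundary. -/
noncomputable def sd : ∀ q : ℕ, TupleChain q P →ₗ[ZMod 2] TupleChain q P
  | 0 => LinearMap.id
  | q + 1 => Finsupp.linearCombination (ZMod 2) fun v =>
      cone q (b q v) (sd q (d q (Finsupp.single v 1)))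

/-- The chain homotopy between barycentric subdivision and the identity. -/
noncomputable def sdHomotopy : ∀ q : ℕ, TupleChain q P →ₗ[ZMod 2] TupleChain (q + 1) P
  | 0 => 0
  | q + 1 => Finsupp.linearCombination (ZMod 2) fun v =>
      cone (q + 1) (b q v) (Finsupp.single v 1 + sdHomotopy q (d q (Finsupp.single v 1)))

lemma sd_succ_single (q : ℕ) (v : Fin (q + 1) → P) :
    sd b (q + 1) (Finsupp.single v 1) = cone q (b q v) (sd b q (d q (Finsupp.single v 1))) := by
  simp [sd]

lemma sdHomotopy_succ_single (q : ℕ) (v : Fin (q + 1) → P) :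
    sdHomotopy b (q + 1) (Finsupp.single v 1) =
      cone (q + 1) (b q v) (Finsupp.single v 1 + sdHomotopy b q (d q (Finsupp.single v 1))) := by
  simp [sdHomotopy]

lemma d_sd (q : ℕ) (c : TupleChain (q + 1) P) : d q (sd b (q + 1) c) = sd b q (d q c) := by
  induction q with
  | zero =>
    suffices h : d 0 ∘ₗ sd b 1 = sd b 0 ∘ₗ d 0 from LinearMap.congr_fun h c
    ext1 v
    ext1
    simp only [LinearMap.comp_apply, Finsupp.lsingle_apply]
    rw [sd_succ_single, d_cone_zero]
  | succ q ih =>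
    suffices h : d (q + 1) ∘ₗ sd b (q + 2) = sd b (q + 1) ∘ₗ d (q + 1) from LinearMap.congr_fun h c
    ext1 v
    ext1
    simp only [LinearMap.comp_apply, Finsupp.lsingle_apply]
    rw [sd_succ_single, d_cone_succ, ih, d_d, map_zero, map_zero, add_zero]

lemma d_sdHomotopy (q : ℕ) (c : TupleChain (q + 1) P) :
    d (q + 1) (sdHomotopy b (q + 1) c) = c + sd b (q + 1) c + sdHomotopy b q (d q c) := by
  induction q with
  | zero =>
    suffices h : d 1 ∘ₗ sdHomotopy b 1 = LinearMap.id + sd b 1 + sdHomotopy b 0 ∘ₗ d 0 from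
      LinearMap.congr_fun h c
    ext1 v
    ext1
    simp only [LinearMap.comp_apply, Finsupp.lsingle_apply, LinearMap.add_apply,
      LinearMap.id_apply]
    rw [sdHomotopy_succ_single, d_cone_succ, sd_succ_single]
    simp [sdHomotopy, sd]
  | succ q ih =>
    suffices h : d (q + 2) ∘ₗ sdHomotopy b (q + 2) =
        LinearMap.id + sd b (q + 2) + sdHomotopy b (q + 1) ∘ₗ d (q + 1) from
      LinearMap.congr_fun h c
    ext1 v
    ext1
    simp only [LinearMap.comp_apply, Finsupp.lsingle_apply, LinearMap.add_apply,
      LinearMap.id_apply]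
    rw [sdHomotopy_succ_single, d_cone_succ, sd_succ_single, map_add, ih, d_d, map_zero, add_zero,
      ← add_assoc (d _ _), ZModModule.add_self, zero_add]
    abel

/-- The chain homotopy between the `k`-fold subdivision and the identity. -/
noncomputable def sdIterHomotopy (k q : ℕ) : TupleChain q P →ₗ[ZMod 2] TupleChain (q + 1) P :=
  ∑ j ∈ Finset.range k, sdHomotopy b q ∘ₗ (sd b q) ^ j

lemma d_sd_pow (k q : ℕ) (c : TupleChain (q + 1) P) :
    d q (((sd b (q + 1)) ^ k) c) = ((sd b q) ^ k) (d q c) := by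
  induction k with
  | zero => simp
  | succ k ih => rw [pow_succ', pow_succ', Module.End.mul_apply, d_sd, ih, Module.End.mul_apply]

lemma d_sdIterHomotopy (k q : ℕ) (c : TupleChain (q + 1) P) :
    d (q + 1) (sdIterHomotopy b k (q + 1) c) =
      c + ((sd b (q + 1)) ^ k) c + sdIterHomotopy b k q (d q c) := by
  induction k with
  | zero => simp [sdIterHomotopy, ZModModule.add_self]
  | succ k ih =>
    have h : ∀ q, sdIterHomotopy b (k + 1) q =
        sdIterHomotopy b k q + sdHomotopy b q ∘ₗ (sd b q) ^ k := fun q => by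
      simp [sdIterHomotopy, Finset.sum_range_succ]
    rw [h, h, LinearMap.add_apply, map_add, ih, LinearMap.comp_apply, d_sdHomotopy, d_sd_pow,
      LinearMap.add_apply, LinearMap.comp_apply, pow_succ', Module.End.mul_apply]
    have : ∀ x y z t u : TupleChain (q + 1) P,
        x + y + z + (y + t + u) = x + t + (z + u) + (y + y) := fun x y z t u => by abel
    rw [this, ZModModule.add_self, add_zero]

variable {b} {b' : ∀ q : ℕ, (Fin (q + 1) → Q) → Q} {f : P → Q}

lemma map_sd (hf : ∀ q v, f (b q v) = b' q (f ∘ v)) (q : ℕ) (c : TupleChain q P) :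
    map q f (sd b q c) = sd b' q (map q f c) := by
  induction q with
  | zero => rfl
  | succ q ih =>
    suffices h : map (q + 1) f ∘ₗ sd b (q + 1) = sd b' (q + 1) ∘ₗ map (q + 1) f from
      LinearMap.congr_fun h c
    ext1 v
    ext1
    simp only [LinearMap.comp_apply, Finsupp.lsingle_apply]
    rw [sd_succ_single, map_cone, ih, ← d_map, map_single, sd_succ_single, hf]

lemma map_sdHomotopy (hf : ∀ q v, f (b q v) = b' q (f ∘ v)) (q : ℕ) (c : TupleChain q P) :
    map (q + 1) f (sdHomotopy b q c) = sdHomotopy b' q (map q f c) := by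
  induction q with
  | zero => simp [sdHomotopy]
  | succ q ih =>
    suffices h : map (q + 2) f ∘ₗ sdHomotopy b (q + 1) =
      sdHomotopy b' (q + 1) ∘ₗ map (q + 1) f from LinearMap.congr_fun h c
    ext1 v
    ext1
    simp only [LinearMap.comp_apply, Finsupp.lsingle_apply]
    rw [sdHomotopy_succ_single, map_cone, map_add, ih, ← d_map, map_single, sdHomotopy_succ_single,
      hf]

lemma map_sdIterHomotopy (hf : ∀ q v, f (b q v) = b' q (f ∘ v)) (k q : ℕ) (c : TupleChain q P) :
    map (q + 1) f (sdIterHomotopy b k q c) = sdIterHomotopy b' k q (map q f c) := by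
  have h : ∀ j, map q f (((sd b q) ^ j) c) = ((sd b' q) ^ j) (map q f c) := by
    intro j
    induction j with
    | zero => simp
    | succ j ih => rw [pow_succ', pow_succ', Module.End.mul_apply, map_sd hf, ih,
        Module.End.mul_apply]
  simp only [sdIterHomotopy, LinearMap.sum_apply, LinearMap.comp_apply, map_sum]
  exact Finset.sum_congr rfl fun j _ => by rw [map_sdHomotopy hf, h]

end Subdivision

end TupleChain

/-! ### Subdivision of singular chains -/

lemma Finsupp.apply_mem_of_mem_supported {α R M : Type*} [Semiring R] [AddCommMonoid M] [Module R M]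
    {s : Set α} {N : Submodule R M} (F : (α →₀ R) →ₗ[R] M)
    (hF : ∀ a ∈ s, F (Finsupp.single a 1) ∈ N) {c : α →₀ R} (hc : c ∈ Finsupp.supported R R s) :
    F c ∈ N := by
  rw [Finsupp.supported_eq_span_single] at hc
  refine (Submodule.map_span_le F _ N).2 ?_ (Submodule.mem_map_of_mem hc)
  rintro _ ⟨a, ha, rfl⟩
  exact hF a ha

namespace SingularChain

variable {X Y : Type} [TopologicalSpace X] [TopologicalSpace Y]

/-- The affine combination of points of a standard simplex, with coefficients `t`. -/
noncomputable def affComb {p q : ℕ} (v : Fin q → stdSimplex ℝ (Fin p)) (t : stdSimplex ℝ (Fin q)) :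
    stdSimplex ℝ (Fin p) :=
  ⟨∑ i, t.1 i • (v i).1, (convex_stdSimplex ℝ (Fin p)).sum_mem (fun i _ => t.2.1 i) t.2.2
    fun i _ => (v i).2⟩

/-- The affine map of standard simplices that sends the vertices to the points `v i`. -/
noncomputable def affMap {p q : ℕ} (v : Fin q → stdSimplex ℝ (Fin p)) :
    C(stdSimplex ℝ (Fin q), stdSimplex ℝ (Fin p)) :=
  ⟨affComb v, by
    refine Continuous.subtype_mk ?_ _
    refine continuous_finsetSum _ fun i _ => ?_
    have h : Continuous fun t : stdSimplex ℝ (Fin q) => t.1 i :=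
      (continuous_apply i).comp continuous_subtype_val
    exact h.smul continuous_const⟩

/-- The barycentre of a tuple of points of a standard simplex. -/
noncomputable def bary {p : ℕ} (q : ℕ) (v : Fin (q + 1) → stdSimplex ℝ (Fin p)) :
    stdSimplex ℝ (Fin p) :=
  affComb v stdSimplex.barycenter

/-- The affine chain of a standard simplex that consists of the simplex itself. -/
noncomputable def fundamental (n : ℕ) : TupleChain (n + 1) (stdSimplex ℝ (Fin (n + 1))) :=
  Finsupp.single (fun i => stdSimplex.vertex i) 1

/-- The singular chain given by a singular simplex and an affine chain in its domain. -/
noncomputable def push {p : ℕ} (q : ℕ) (σ : C(stdSimplex ℝ (Fin p), X)) :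
    TupleChain (q + 1) (stdSimplex ℝ (Fin p)) →ₗ[ZMod 2] SingularChain q X :=
  Finsupp.lmapDomain _ _ fun v => σ.comp (affMap v)

@[simp] lemma push_single {p : ℕ} (q : ℕ) (σ : C(stdSimplex ℝ (Fin p), X))
    (v : Fin (q + 1) → stdSimplex ℝ (Fin p)) (r : ZMod 2) :
    push q σ (Finsupp.single v r) = Finsupp.single (σ.comp (affMap v)) r := by
  simp [push, Finsupp.mapDomain_single]

lemma coe_affMap {p q : ℕ} (v : Fin q → stdSimplex ℝ (Fin p)) (t : stdSimplex ℝ (Fin q)) :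
    (affMap v t).1 = ∑ i, t.1 i • (v i).1 := rfl

lemma sum_map_smul {q r : ℕ} {V : Type*} [AddCommGroup V] [Module ℝ V] (f : Fin q → Fin r)
    (t : stdSimplex ℝ (Fin q)) (v : Fin r → V) :
    ∑ j, (stdSimplex.map f t) j • v j = ∑ i, t i • v (f i) := by
  rw [← Finset.sum_fiberwise Finset.univ f]
  refine Finset.sum_congr rfl fun j _ => ?_
  rw [stdSimplex.map_coe, FunOnFinite.linearMap_apply_apply, Finset.sum_smul]
  refine Finset.sum_congr rfl fun i hi => ?_
  rw [(Finset.mem_filter.1 hi).2]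

lemma affMap_comp_face {p q : ℕ} (v : Fin (q + 2) → stdSimplex ℝ (Fin p)) (i : Fin (q + 2)) :
    (affMap v).comp (face i) = affMap (v ∘ i.succAbove) := by
  ext1 t
  refine Subtype.ext ?_
  exact sum_map_smul i.succAbove t fun j => (v j).1

lemma affMap_vertex (n : ℕ) :
    affMap (fun i : Fin (n + 1) => stdSimplex.vertex (S := ℝ) i) = ContinuousMap.id _ := by
  ext1 t
  refine Subtype.ext ?_
  rw [coe_affMap]
  ext j
  simp [Finset.sum_apply, Pi.single_apply]

lemma push_fundamental (n : ℕ) (σ : SingularSimplex n X) :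
    push n σ (fundamental n) = Finsupp.single σ 1 := by
  rw [fundamental, push_single, affMap_vertex, ContinuousMap.comp_id]

lemma d_push {p : ℕ} (q : ℕ) (σ : C(stdSimplex ℝ (Fin p), X))
    (c : TupleChain (q + 2) (stdSimplex ℝ (Fin p))) :
    d q (push (q + 1) σ c) = push q σ (TupleChain.d (q + 1) c) := by
  suffices h : d q ∘ₗ push (q + 1) σ = push q σ ∘ₗ TupleChain.d (q + 1) from LinearMap.congr_fun h c
  ext1 v
  ext1
  simp [map_sum, ContinuousMap.comp_assoc, affMap_comp_face]

lemma face_affComb {n q : ℕ} (i : Fin (n + 2)) (v : Fin q → stdSimplex ℝ (Fin (n + 1)))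
    (t : stdSimplex ℝ (Fin q)) : face i (affComb v t) = affComb (face i ∘ v) t := by
  refine Subtype.ext ?_
  change FunOnFinite.linearMap ℝ ℝ i.succAbove (∑ j, t.1 j • (v j).1) = _
  rw [map_sum]
  exact Finset.sum_congr rfl fun j _ => map_smul _ _ _

lemma push_comp_face {n : ℕ} (q : ℕ) (σ : SingularSimplex (n + 1) X) (i : Fin (n + 2))
    (c : TupleChain (q + 1) (stdSimplex ℝ (Fin (n + 1)))) :
    push q (σ.comp (face i)) c = push q σ (TupleChain.map (q + 1) (face i) c) := by
  suffices h : push q (σ.comp (face i)) = push q σ ∘ₗ TupleChain.map (q + 1) (face i) from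
    LinearMap.congr_fun h c
  ext1 v
  ext1
  simp only [LinearMap.comp_apply, Finsupp.lsingle_apply, push_single, TupleChain.map_single,
    ContinuousMap.comp_assoc]
  congr 2
  ext1 t
  exact face_affComb i v t

lemma map_face_fundamental (n : ℕ) (i : Fin (n + 2)) :
    TupleChain.map (n + 1) (face i) (fundamental n) =
      Finsupp.single ((fun j => stdSimplex.vertex j) ∘ i.succAbove) 1 := by
  rw [fundamental, TupleChain.map_single]
  congr 1
  ext1 j
  exact stdSimplex.map_vertex _ _

/-- The `k`-fold barycentric subdivision of singular chains. -/
noncomputable def sdIter (k n : ℕ) : SingularChain n X →ₗ[ZMod 2] SingularChain n X :=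
  Finsupp.linearCombination (ZMod 2) fun σ =>
    push n σ (((TupleChain.sd bary (n + 1)) ^ k) (fundamental n))

/-- The chain homotopy between the `k`-fold subdivision and the identity. -/
noncomputable def sdIterHomotopy (k n : ℕ) : SingularChain n X →ₗ[ZMod 2] SingularChain (n + 1) X :=
  Finsupp.linearCombination (ZMod 2) fun σ =>
    push (n + 1) σ (TupleChain.sdIterHomotopy bary k (n + 1) (fundamental n))

lemma sdIter_single (k n : ℕ) (σ : SingularSimplex n X) :
    sdIter k n (Finsupp.single σ 1) =
      push n σ (((TupleChain.sd bary (n + 1)) ^ k) (fundamental n)) := by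
  simp [sdIter]

lemma sdIterHomotopy_single (k n : ℕ) (σ : SingularSimplex n X) :
    sdIterHomotopy k n (Finsupp.single σ 1) =
      push (n + 1) σ (TupleChain.sdIterHomotopy bary k (n + 1) (fundamental n)) := by
  simp [sdIterHomotopy]

lemma d_sdIterHomotopy_zero (k : ℕ) (c : SingularChain 0 X) :
    d 0 (sdIterHomotopy k 0 c) = c + sdIter k 0 c := by
  suffices h : d 0 ∘ₗ sdIterHomotopy (X := X) k 0 = LinearMap.id + sdIter k 0 from
    LinearMap.congr_fun h c
  ext1 σ
  ext1
  simp only [LinearMap.comp_apply, Finsupp.lsingle_apply, LinearMap.add_apply, LinearMap.id_apply]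
  have h0 : ∀ x : TupleChain 0 (stdSimplex ℝ (Fin 1)),
      TupleChain.sdIterHomotopy bary k 0 x = 0 := fun x => by
    simp [TupleChain.sdIterHomotopy, TupleChain.sdHomotopy]
  rw [sdIterHomotopy_single, d_push, TupleChain.d_sdIterHomotopy, h0, add_zero, map_add,
    push_fundamental, sdIter_single]

lemma d_sdIterHomotopy_succ (k n : ℕ) (c : SingularChain (n + 1) X) :
    d (n + 1) (sdIterHomotopy k (n + 1) c) =
      c + sdIter k (n + 1) c + sdIterHomotopy k n (d n c) := by
  suffices h : d (n + 1) ∘ₗ sdIterHomotopy (X := X) k (n + 1) =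
      LinearMap.id + sdIter k (n + 1) + sdIterHomotopy k n ∘ₗ d n from
    LinearMap.congr_fun h c
  ext1 σ
  ext1
  simp only [LinearMap.comp_apply, Finsupp.lsingle_apply, LinearMap.add_apply, LinearMap.id_apply]
  rw [sdIterHomotopy_single, d_push, TupleChain.d_sdIterHomotopy, map_add, map_add,
    push_fundamental, sdIter_single]
  congr 1
  rw [d_single, map_sum, fundamental, TupleChain.d_single, map_sum, map_sum]
  refine Finset.sum_congr rfl fun i _ => ?_
  rw [sdIterHomotopy_single, push_comp_face,
    TupleChain.map_sdIterHomotopy (b' := bary) (f := face i) (b := bary)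
      (fun q v => face_affComb i v _),
    map_face_fundamental]

/-! ### The mesh of iterated subdivisions -/

/-- Affine chains whose simplices have vertices in `K` at mutual distance at most `δ`. -/
noncomputable def fineChains {p : ℕ} (q : ℕ) (K : Set (Fin p → ℝ)) (δ : ℝ) :
    Submodule (ZMod 2) (TupleChain q (stdSimplex ℝ (Fin p))) :=
  Finsupp.supported (ZMod 2) (ZMod 2)
    {v | (∀ i, (v i).1 ∈ K) ∧ ∀ i j, dist (v i) (v j) ≤ δ}

lemma dist_bary_le {p q : ℕ} {v : Fin (q + 1) → stdSimplex ℝ (Fin p)} {δ : ℝ}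
    (hv : ∀ i j, dist (v i) (v j) ≤ δ) (i : Fin (q + 1)) :
    dist (bary q v) (v i) ≤ q / (q + 1) * δ := by
  have h1 : (bary q v).1 - (v i).1 =
      ((q : ℝ) + 1)⁻¹ • ∑ j ∈ Finset.univ.erase i, ((v j).1 - (v i).1) := by
    have h2 : (bary q v).1 =
        ((q : ℝ) + 1)⁻¹ • ∑ j, (v j).1 := by
      rw [Finset.smul_sum]
      change ∑ j, stdSimplex.barycenter.1 j • (v j).1 = _
      refine Finset.sum_congr rfl fun j _ => ?_
      rw [show (stdSimplex.barycenter (𝕜 := ℝ) (X := Fin (q + 1))).1 j = ((q : ℝ) + 1)⁻¹ from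
        (stdSimplex.barycenter_apply j).trans (by simp)]
    have h3 : ∑ j ∈ Finset.univ.erase i, ((v j).1 - (v i).1) =
        ∑ j, ((v j).1 - (v i).1) := by
      rw [← Finset.add_sum_erase _ _ (Finset.mem_univ i), sub_self, zero_add]
    rw [h3, h2, Finset.sum_sub_distrib, smul_sub]
    congr 1
    rw [Finset.sum_const, Finset.card_univ, Fintype.card_fin, ← Nat.cast_smul_eq_nsmul ℝ,
      smul_smul, Nat.cast_add, Nat.cast_one, inv_mul_cancel₀ (by positivity), one_smul]
  rw [Subtype.dist_eq, dist_eq_norm, h1, norm_smul, Real.norm_of_nonneg (by positivity),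
    div_eq_inv_mul, mul_assoc]
  refine mul_le_mul_of_nonneg_left ?_ (by positivity)
  refine (norm_sum_le_of_le _ (fun j _ => ?_)).trans (b := ∑ j ∈ Finset.univ.erase i, δ) ?_
  · rw [← dist_eq_norm]
    exact hv j i
  · simp

/-- Subdivision of a simplex of dimension `q` reduces the mesh by the factor `q / (q + 1)`. The
convex set `K` is needed for the induction over the faces. -/
lemma sd_single_mem_fineChains {p : ℕ} (q : ℕ) {v : Fin (q + 1) → stdSimplex ℝ (Fin p)}
    {K : Set (Fin p → ℝ)} (hK : Convex ℝ K) (hvK : ∀ i, (v i).1 ∈ K)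
    {δ : ℝ} (hv : ∀ i j, dist (v i) (v j) ≤ δ) :
    TupleChain.sd bary (q + 1) (Finsupp.single v 1) ∈ fineChains (q + 1) K (q / (q + 1) * δ) := by
  have hδ : 0 ≤ δ := dist_nonneg.trans (hv 0 0)
  induction q generalizing K with
  | zero =>
    rw [TupleChain.sd_succ_single]
    simp only [TupleChain.sd, LinearMap.id_apply, TupleChain.d_single, map_sum,
      TupleChain.cone_single]
    refine Submodule.sum_mem _ fun i _ =>
      Finsupp.single_mem_supported _ _ ⟨fun j => ?_, fun j l => ?_⟩
    · rw [Fin.eq_zero j, Fin.cons_zero]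
      exact hK.sum_mem (fun i _ => stdSimplex.barycenter.2.1 i) stdSimplex.barycenter.2.2
        fun i _ => hvK i
    · rw [Fin.eq_zero j, Fin.eq_zero l]
      simp
  | succ q ih =>
    -- The subdivided boundary stays in the ball of radius `r` about the barycentre, which bounds
    -- the distances from the apex of the cone.
    have hb : (bary (q + 1) v).1 ∈ K :=
      hK.sum_mem (fun i _ => stdSimplex.barycenter.2.1 i) stdSimplex.barycenter.2.2 fun i _ => hvK i
    set r : ℝ := ((q + 1 : ℕ) : ℝ) / ((q + 1 : ℕ) + 1) * δ with hr
    rw [TupleChain.sd_succ_single]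
    let K' : Set (Fin p → ℝ) := K ∩ Metric.closedBall (bary (q + 1) v).1 r
    have hK' : Convex ℝ K' := hK.inter (convex_closedBall _ _)
    have hmem : TupleChain.sd bary (q + 1) (TupleChain.d (q + 1) (Finsupp.single v 1)) ∈
        fineChains (q + 1) K' r := by
      rw [TupleChain.d_single, map_sum]
      refine Submodule.sum_mem _ fun i _ => ?_
      have := ih hK' (v := v ∘ i.succAbove) (fun j => ⟨hvK _, ?_⟩) (fun j l => hv _ _)
      · refine Finsupp.supported_mono ?_ this
        rintro w ⟨hw1, hw2⟩
        refine ⟨hw1, fun j l => (hw2 j l).trans ?_⟩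
        refine mul_le_mul_of_nonneg_right ?_ hδ
        rw [div_le_div_iff₀ (by positivity) (by positivity)]
        push_cast
        nlinarith
      · rw [Metric.mem_closedBall, dist_comm]
        exact dist_bary_le hv _
    refine Finsupp.apply_mem_of_mem_supported (TupleChain.cone _ _) ?_ hmem
    rintro w ⟨hw1, hw2⟩
    rw [TupleChain.cone_single]
    refine Finsupp.single_mem_supported _ _ ⟨fun j => ?_, fun j l => ?_⟩
    · refine Fin.cases ?_ (fun j => ?_) j
      · exact hb
      · exact (hw1 j).1
    · refine Fin.cases ?_ (fun j => ?_) j <;> refine Fin.cases ?_ (fun l => ?_) l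
      · simpa using mul_nonneg (by positivity) hδ
      · rw [dist_comm]
        exact (hw1 l).2
      · exact (hw1 j).2
      · exact hw2 j l

lemma sd_pow_fundamental_mem_fineChains (k n : ℕ) :
    ((TupleChain.sd bary (n + 1)) ^ k) (fundamental n) ∈
      fineChains (n + 1) Set.univ ((n / (n + 1) : ℝ) ^ k) := by
  induction k with
  | zero =>
    rw [pow_zero, pow_zero]
    refine Finsupp.single_mem_supported _ _ ⟨fun _ => Set.mem_univ _, fun i j => ?_⟩
    exact (Metric.dist_le_diam_of_mem (bounded_stdSimplex _) (stdSimplex.vertex i).2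
      (stdSimplex.vertex j).2).trans diam_stdSimplex_le
  | succ k ih =>
    rw [pow_succ', pow_succ', Module.End.mul_apply]
    refine Finsupp.apply_mem_of_mem_supported _ ?_ ih
    rintro v ⟨-, hv⟩
    exact sd_single_mem_fineChains n convex_univ (fun _ => Set.mem_univ _) hv

/-! ### Small chains -/

/-- Chains all of whose simplices lie in `Y`. -/
noncomputable def chainsIn (n : ℕ) (Y : Set X) : Submodule (ZMod 2) (SingularChain n X) :=
  Finsupp.supported (ZMod 2) (ZMod 2) {σ | ∀ t, σ t ∈ Y}

lemma chainsIn_mono (n : ℕ) {Y Z : Set X} (h : Y ⊆ Z) : chainsIn n Y ≤ chainsIn n Z :=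
  Finsupp.supported_mono fun _ hσ t => h (hσ t)

lemma push_mem_chainsIn {p : ℕ} (q : ℕ) {σ : C(stdSimplex ℝ (Fin p), X)} {Y : Set X}
    (hσ : ∀ t, σ t ∈ Y) (c : TupleChain (q + 1) (stdSimplex ℝ (Fin p))) :
    push q σ c ∈ chainsIn q Y := by
  refine Finsupp.apply_mem_of_mem_supported (s := Set.univ) _ (fun v _ => ?_) (by simp)
  rw [push_single]
  exact Finsupp.single_mem_supported _ _ fun t => hσ _

lemma sdIterHomotopy_mem_chainsIn (k n : ℕ) {Y : Set X} {c : SingularChain n X}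
    (hc : c ∈ chainsIn n Y) : sdIterHomotopy k n c ∈ chainsIn (n + 1) Y := by
  refine Finsupp.apply_mem_of_mem_supported _ (fun σ hσ => ?_) hc
  rw [sdIterHomotopy_single]
  exact push_mem_chainsIn _ hσ _

lemma d_mem_chainsIn (n : ℕ) {Y : Set X} {c : SingularChain (n + 1) X}
    (hc : c ∈ chainsIn (n + 1) Y) : d n c ∈ chainsIn n Y := by
  refine Finsupp.apply_mem_of_mem_supported _ (fun σ hσ => ?_) hc
  rw [d_single]
  exact Submodule.sum_mem _ fun i _ => Finsupp.single_mem_supported _ _ fun t => hσ _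

/-- Sufficiently fine subdivisions are small with respect to a relatively open cover. -/
lemma eventually_sdIter_mem {n : ℕ} {Z U V : Set X} (hU : ∃ O, IsOpen O ∧ U = Z ∩ O)
    (hV : ∃ O, IsOpen O ∧ V = Z ∩ O) (hZ : Z ⊆ U ∪ V) {c : SingularChain n X}
    (hc : c ∈ chainsIn n Z) :
    ∀ᶠ k in Filter.atTop, sdIter k n c ∈ chainsIn n U ⊔ chainsIn n V := by
  obtain ⟨O₁, hO₁, rfl⟩ := hU
  obtain ⟨O₂, hO₂, rfl⟩ := hV
  rw [chainsIn, Finsupp.supported_eq_span_single] at hc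
  induction hc using Submodule.span_induction with
  | zero => simp
  | add x y _ _ hx hy =>
    filter_upwards [hx, hy] with k hxk hyk
    rw [map_add]
    exact Submodule.add_mem _ hxk hyk
  | smul a x _ hx =>
    filter_upwards [hx] with k hxk
    rw [map_smul]
    exact Submodule.smul_mem _ _ hxk
  | mem x hx =>
    obtain ⟨σ, hσ, rfl⟩ := hx
    obtain ⟨ε, hε, hball⟩ := lebesgue_number_lemma_of_metric (s := Set.univ) isCompact_univ
      (c := fun i : Bool => σ ⁻¹' (bif i then O₁ else O₂))
      (fun i => by cases i <;> simp only [cond_true, cond_false] <;>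
        exact IsOpen.preimage σ.continuous ‹_›)
      (fun t _ => by
        rcases hZ (hσ t) with h | h
        · exact Set.mem_iUnion.2 ⟨true, h.2⟩
        · exact Set.mem_iUnion.2 ⟨false, h.2⟩)
    have hlim : Filter.Tendsto (fun k : ℕ => (n / (n + 1) : ℝ) ^ k) Filter.atTop (nhds 0) :=
      tendsto_pow_atTop_nhds_zero_of_lt_one (by positivity)
        (by rw [div_lt_one (by positivity)]; linarith)
    filter_upwards [hlim.eventually (gt_mem_nhds hε)] with k hk
    simp only [sdIter_single]
    refine Finsupp.apply_mem_of_mem_supported _ ?_ (sd_pow_fundamental_mem_fineChains k n)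
    rintro v ⟨-, hv⟩
    rw [push_single]
    have hmem : ∀ t, affMap v t ∈ Metric.ball (v 0) ε := by
      intro t
      have : (affMap v t).1 ∈ Metric.ball (v 0).1 ε :=
        (convex_ball _ _).sum_mem (fun i _ => t.2.1 i) t.2.2 fun i _ => (hv i 0).trans_lt hk
      exact this
    obtain ⟨i, hi⟩ := hball (v 0) (Set.mem_univ _)
    cases i with
    | true =>
      refine Submodule.mem_sup_left (Finsupp.single_mem_supported _ _ fun t => ⟨hσ _, ?_⟩)
      exact hi (hmem t)
    | false =>
      refine Submodule.mem_sup_right (Finsupp.single_mem_supported _ _ fun t => ⟨hσ _, ?_⟩)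
      exact hi (hmem t)

/-- Every cycle is homologous to a sum of chains in the two sets of an open cover. -/
lemma exists_small_cycle {n : ℕ} {Z U V : Set X} (hU : ∃ O, IsOpen O ∧ U = Z ∩ O)
    (hV : ∃ O, IsOpen O ∧ V = Z ∩ O) (hZ : Z ⊆ U ∪ V) {c : SingularChain n X}
    (hc : c ∈ chainsIn n Z) (hcyc : IsCycle c) :
    ∃ u ∈ chainsIn n U, ∃ v ∈ chainsIn n V, ∃ b ∈ chainsIn (n + 1) Z, d n b = c + (u + v) := by
  obtain ⟨k, hk⟩ := (eventually_sdIter_mem hU hV hZ hc).exists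
  obtain ⟨u, hu, v, hv, huv⟩ := Submodule.mem_sup.1 hk
  refine ⟨u, hu, v, hv, sdIterHomotopy k n c, sdIterHomotopy_mem_chainsIn k n hc, ?_⟩
  cases n with
  | zero => rw [d_sdIterHomotopy_zero, huv]
  | succ n => rw [d_sdIterHomotopy_succ, huv, show d n c = 0 from hcyc, map_zero, add_zero]

/-- A small cycle that bounds is the boundary of a small chain. -/
lemma exists_small_of_d_eq {n : ℕ} {Z U V : Set X} (hU : ∃ O, IsOpen O ∧ U = Z ∩ O)
    (hV : ∃ O, IsOpen O ∧ V = Z ∩ O) (hZ : Z ⊆ U ∪ V) {u v : SingularChain n X}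
    (hu : u ∈ chainsIn n U) (hv : v ∈ chainsIn n V) {y : SingularChain (n + 1) X}
    (hy : y ∈ chainsIn (n + 1) Z) (hyuv : d n y = u + v) :
    ∃ u' ∈ chainsIn (n + 1) U, ∃ v' ∈ chainsIn (n + 1) V, d n (u' + v') = u + v := by
  obtain ⟨k, hk⟩ := (eventually_sdIter_mem hU hV hZ hy).exists
  obtain ⟨u', hu', v', hv', huv'⟩ := Submodule.mem_sup.1 hk
  refine ⟨u' + sdIterHomotopy k n u, Submodule.add_mem _ hu' (sdIterHomotopy_mem_chainsIn k n hu),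
    v' + sdIterHomotopy k n v, Submodule.add_mem _ hv' (sdIterHomotopy_mem_chainsIn k n hv), ?_⟩
  have h := congrArg (d n) (d_sdIterHomotopy_succ k n y)
  rw [d_d, map_add, map_add, hyuv, ← huv', map_add] at h
  have h2 : ∀ x : SingularChain n X, x + x = 0 := ZModModule.add_self
  have e : u' + sdIterHomotopy k n u + (v' + sdIterHomotopy k n v) =
      u' + v' + sdIterHomotopy k n (u + v) := by
    rw [map_add]
    abel
  rw [e, map_add, map_add, ← sub_eq_zero, ZModModule.sub_eq_add, h]
  abel

end SingularChain

/-! ### Homology of subsets in terms of chains of the ambient space -/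

namespace SingularChain

variable {X Y : Type} [TopologicalSpace X] [TopologicalSpace Y]

lemma add_self (n : ℕ) (c : SingularChain n X) : c + c = 0 := ZModModule.add_self c

lemma IsCycle.map {n : ℕ} {c : SingularChain n X} (hc : IsCycle c) (f : C(X, Y)) :
    IsCycle (map n f c) := by
  cases n with
  | zero => trivial
  | succ n => exact (d_map n f c).trans (by rw [show d n c = 0 from hc, map_zero])

lemma IsCycle.of_map {n : ℕ} {c : SingularChain n X} {f : C(X, Y)} (hf : Function.Injective f)
    (hc : IsCycle (SingularChain.map n f c)) : IsCycle c := by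
  cases n with
  | zero => trivial
  | succ n =>
    exact (map_eq_zero_iff _ (map_injective n hf)).1 ((d_map n f c).symm.trans hc)

/-- The inclusion of a subset. -/
def incl (Y : Set X) : C(Y, X) := ⟨Subtype.val, continuous_subtype_val⟩

lemma incl_injective (Y : Set X) : Function.Injective (incl Y) := Subtype.val_injective

lemma map_mem_chainsIn {n : ℕ} (f : C(X, Y)) {Z : Set Y} (hf : ∀ x, f x ∈ Z)
    (c : SingularChain n X) : map n f c ∈ chainsIn n Z := by
  refine Finsupp.apply_mem_of_mem_supported (s := Set.univ) _ (fun σ _ => ?_) (by simp)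
  rw [map_single]
  exact Finsupp.single_mem_supported _ _ fun t => hf _

lemma map_incl_mem {n : ℕ} {Y : Set X} (c : SingularChain n Y) :
    map n (incl Y) c ∈ chainsIn n Y :=
  map_mem_chainsIn _ (fun x => x.2) c

lemma exists_map_incl_eq {n : ℕ} {Y : Set X} {c : SingularChain n X} (hc : c ∈ chainsIn n Y) :
    ∃ c', map n (incl Y) c' = c := by
  suffices h : c ∈ LinearMap.range (map n (incl Y)) from h
  refine Finsupp.apply_mem_of_mem_supported LinearMap.id (fun σ hσ => ?_) hc
  refine ⟨Finsupp.single ⟨fun t => ⟨σ t, hσ t⟩, by fun_prop⟩ 1, ?_⟩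
  rw [map_single]
  rfl

/-- For `Y ⊆ Z`, the inclusion is injective on the `n`-th homology modulo 2: a cycle of `Y` that
bounds in `Z` bounds in `Y`. Both sets are subsets of an ambient space `X`, and their chains are
regarded as chains of `X`. -/
def HomologyInjective (n : ℕ) (Y Z : Set X) : Prop :=
  ∀ c ∈ chainsIn n Y, IsCycle c → (∃ b ∈ chainsIn (n + 1) Z, d n b = c) →
    ∃ b ∈ chainsIn (n + 1) Y, d n b = c

lemma HomologyInjective.trans {n : ℕ} {A B C : Set X} (hAB : A ⊆ B)
    (h₁ : HomologyInjective n A B) (h₂ : HomologyInjective n B C) : HomologyInjective n A C :=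
  fun c hc hcyc hb => h₁ c hc hcyc (h₂ c (chainsIn_mono n hAB hc) hcyc hb)

/-- A retract injects in homology. -/
lemma homologyInjective_of_retraction (n : ℕ) {Y Z : Set X} (r : C(Z, Y))
    (hr : ∀ x ∈ Y, ∀ hZ : x ∈ Z, (r ⟨x, hZ⟩ : X) = x) (hYZ : Y ⊆ Z) :
    HomologyInjective n Y Z := by
  rintro c hc - ⟨b, hb, rfl⟩
  obtain ⟨b, rfl⟩ := exists_map_incl_eq hb
  refine ⟨map (n + 1) (incl Y) (map (n + 1) r b), map_incl_mem _, ?_⟩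
  rw [d_map] at hc
  obtain ⟨c', hc'⟩ := exists_map_incl_eq hc
  rw [d_map, d_map, d_map, ← hc']
  let j : C(Y, Z) := ⟨Set.inclusion hYZ, continuous_inclusion hYZ⟩
  have hj : d n b = map n j c' := by
    refine map_injective n (incl_injective Z) ?_
    rw [← hc', ← map_comp]
    rfl
  rw [hj, ← map_comp, ← map_comp]
  congr 2
  ext x
  exact hr x x.2 (hYZ x.2)

end SingularChain

open SingularChain in
lemma homologyMod2Inclusion_injective_iff {n p : ℕ} {Y X : Set (EuclideanSpace ℝ (Fin n))}
    (h : Y ⊆ X) :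
    Function.Injective (homologyMod2Inclusion p h).hom ↔ HomologyInjective p Y X := by
  refine (homology_map_injective_iff _ p).trans ?_
  let j : C(Y, X) := ⟨Set.inclusion h, continuous_inclusion h⟩
  have hj : ∀ m (c : SingularChain m Y), map m (incl X) (map m j c) = map m (incl Y) c := by
    intro m c
    rw [← map_comp]
    rfl
  constructor
  · rintro H c hc hcyc ⟨b, hb, hbc⟩
    obtain ⟨c, rfl⟩ := exists_map_incl_eq hc
    obtain ⟨b, rfl⟩ := exists_map_incl_eq hb
    obtain ⟨b', hb'⟩ := H c (hcyc.of_map (incl_injective Y)) ⟨b, by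
      refine map_injective p (incl_injective X) ?_
      rw [← d_map, hbc]
      exact (hj p c).symm⟩
    exact ⟨map (p + 1) (incl Y) b', map_incl_mem _, by rw [d_map, hb']⟩
  · rintro H c hcyc ⟨b, hb⟩
    obtain ⟨b', hb', hbc⟩ := H (map p (incl Y) c) (map_incl_mem _) (hcyc.map _)
      ⟨map (p + 1) (incl X) b, map_incl_mem _, by rw [d_map, hb]; exact hj p c⟩
    obtain ⟨b', rfl⟩ := exists_map_incl_eq hb'
    exact ⟨b', map_injective p (incl_injective Y) (by rw [← d_map, hbc])⟩

namespace SingularChain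

variable {X : Type} [TopologicalSpace X]

section Affine

variable {E : Type} [NormedAddCommGroup E] [NormedSpace ℝ E]

/-- If a subset `Y` can be moved into `A` along straight segments in `Z`, then every cycle of `Y`
is homologous in `Z` to a cycle of `A`. -/
lemma exists_homologous_of_segment_subset {n : ℕ} {Y Z A : Set E} {f : E → E}
    (hf : ContinuousOn f Y) (hfA : ∀ y ∈ Y, f y ∈ A) (hseg : ∀ y ∈ Y, segment ℝ y (f y) ⊆ Z)
    {c : SingularChain n E} (hc : c ∈ chainsIn n Y) (hcyc : IsCycle c) :
    ∃ c' ∈ chainsIn n A, IsCycle c' ∧ ∃ b ∈ chainsIn (n + 1) Z, d n b = c + c' := by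
  obtain ⟨c, rfl⟩ := exists_map_incl_eq hc
  have hcyc' := hcyc.of_map (incl_injective Y)
  have hfY : Continuous fun y : Y => f y := hf.domRestrict
  let f₀ : C(Y, Z) := ⟨fun y => ⟨y, hseg y y.2 (left_mem_segment ℝ _ _)⟩, by fun_prop⟩
  let f₁ : C(Y, Z) := ⟨fun y => ⟨f y, hseg y y.2 (right_mem_segment ℝ _ _)⟩, hfY.subtype_mk _⟩
  have H : f₀.Homotopic f₁ := by
    refine ⟨{
      toFun := fun p => ⟨AffineMap.lineMap (p.2 : E) (f p.2) (p.1 : ℝ), hseg p.2 p.2.2 ?_⟩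
      continuous_toFun := ?_
      map_zero_left := fun y => ?_
      map_one_left := fun y => ?_ }⟩
    · rw [segment_eq_image_lineMap]
      exact ⟨p.1, p.1.2, rfl⟩
    · refine Continuous.subtype_mk ?_ _
      simp only [AffineMap.lineMap_apply_module]
      have h1 : Continuous fun p : unitInterval × Y => f p.2 := hfY.comp continuous_snd
      have h2 : Continuous fun p : unitInterval × Y => (p.1 : ℝ) :=
        continuous_subtype_val.comp continuous_fst
      have h3 : Continuous fun p : unitInterval × Y => (p.2 : E) :=
        continuous_subtype_val.comp continuous_snd
      exact ((continuous_const.sub h2).smul h3).add (h2.smul h1)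
    · exact Subtype.ext (by simp [f₀])
    · exact Subtype.ext (by simp [f₁])
  obtain ⟨b, hb⟩ := exists_d_eq_map_add_map_of_homotopic H hcyc'
  refine ⟨map n (incl Z) (map n f₁ c), ?_, (hcyc'.map _).map _, map (n + 1) (incl Z) b,
    map_incl_mem _, ?_⟩
  · rw [← map_comp]
    exact map_mem_chainsIn ((incl Z).comp f₁) (fun y => hfA y.1 y.2) c
  · rw [d_map, hb, map_add]
    congr 1
    rw [← map_comp]
    rfl

end Affine

/-! ### Chains of degree zero -/

/-- The sum of the coefficients of a `0`-chain. -/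
noncomputable def degree : SingularChain 0 X →ₗ[ZMod 2] ZMod 2 :=
  Finsupp.linearCombination (ZMod 2) fun _ => 1

@[simp] lemma degree_single (σ : SingularSimplex 0 X) (r : ZMod 2) :
    degree (Finsupp.single σ r) = r := by
  simp [degree]

lemma degree_d (c : SingularChain 1 X) : degree (d 0 c) = 0 := by
  suffices h : degree ∘ₗ d (X := X) 0 = 0 from LinearMap.congr_fun h c
  ext1 σ
  ext1
  simp only [LinearMap.comp_apply, Finsupp.lsingle_apply, d_single, map_sum, degree_single,
    LinearMap.zero_apply]
  decide

/-- The constant singular simplex. -/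
def constSimplex (n : ℕ) (x : X) : SingularSimplex n X := ContinuousMap.const _ x

lemma eq_constSimplex (σ : SingularSimplex 0 X) : σ = constSimplex 0 (σ default) := by
  ext t
  rw [Subsingleton.elim t default]
  rfl

lemma comp_face_eq_constSimplex (τ : SingularSimplex 1 X) (i : Fin 2) :
    τ.comp (face i) = constSimplex 0 (τ (stdSimplex.vertex (i.succAbove 0))) := by
  rw [eq_constSimplex (τ.comp (face i))]
  congr 1
  change τ (stdSimplex.map i.succAbove default) = _
  rw [Subsingleton.elim (default : stdSimplex ℝ (Fin 1)) (stdSimplex.vertex 0),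
    stdSimplex.map_vertex]

lemma exists_d_eq_of_joinedIn {Y : Set X} {x y : X} (h : JoinedIn Y x y) :
    ∃ b ∈ chainsIn 1 Y, d 0 b =
      Finsupp.single (constSimplex 0 x) 1 + Finsupp.single (constSimplex 0 y) 1 := by
  let γ := h.somePath
  let τ : SingularSimplex 1 X := γ.toContinuousMap.comp
    ⟨stdSimplexHomeomorphUnitInterval, stdSimplexHomeomorphUnitInterval.continuous⟩
  refine ⟨Finsupp.single τ 1, Finsupp.single_mem_supported _ _ fun t => h.somePath_mem _, ?_⟩
  rw [d_single, Fin.sum_univ_two, comp_face_eq_constSimplex, comp_face_eq_constSimplex, add_comm]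
  have h0 : τ (stdSimplex.vertex ((1 : Fin 2).succAbove 0)) = x := by
    change γ (stdSimplexHomeomorphUnitInterval (stdSimplex.vertex 0)) = x
    rw [stdSimplexHomeomorphUnitInterval_zero, γ.source]
  have h1 : τ (stdSimplex.vertex ((0 : Fin 2).succAbove 0)) = y := by
    change γ (stdSimplexHomeomorphUnitInterval (stdSimplex.vertex 1)) = y
    rw [stdSimplexHomeomorphUnitInterval_one, γ.target]
  rw [h0, h1]

lemma exists_d_eq_add_degree {Y : Set X} {z : X} (h : ∀ x ∈ Y, JoinedIn Y x z)
    {c : SingularChain 0 X} (hc : c ∈ chainsIn 0 Y) :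
    ∃ b ∈ chainsIn 1 Y, d 0 b = c + Finsupp.single (constSimplex 0 z) (degree c) := by
  let F : SingularChain 0 X →ₗ[ZMod 2] SingularChain 0 X :=
    LinearMap.id + (Finsupp.lsingle (constSimplex 0 z)) ∘ₗ degree
  suffices hF : F c ∈ (chainsIn 1 Y).map (d 0) by
    obtain ⟨b, hb, hbc⟩ := hF
    exact ⟨b, hb, hbc⟩
  refine Finsupp.apply_mem_of_mem_supported F (fun σ hσ => ?_) hc
  obtain ⟨b, hb, hbc⟩ := exists_d_eq_of_joinedIn (h _ (hσ default))
  refine ⟨b, hb, ?_⟩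
  rw [hbc, ← eq_constSimplex]
  simp [F]

lemma homologyInjective_zero_of_joinedIn {Y Z : Set X} (h : ∀ x ∈ Y, ∀ y ∈ Y, JoinedIn Y x y) :
    HomologyInjective 0 Y Z := by
  rintro c hc - ⟨b, -, rfl⟩
  rcases Y.eq_empty_or_nonempty with rfl | ⟨z, hz⟩
  · have h0 : d 0 b = 0 := by
      refine (Submodule.mem_bot (ZMod 2)).1 ?_
      refine Finsupp.apply_mem_of_mem_supported LinearMap.id (fun σ hσ => ?_) hc
      exact (hσ default).elim
    exact ⟨0, Submodule.zero_mem _, by rw [h0, map_zero]⟩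
  · obtain ⟨b', hb', h'⟩ := exists_d_eq_add_degree (fun x hx => h x hx z hz) hc
    exact ⟨b', hb', by rw [h', degree_d, Finsupp.single_zero, add_zero]⟩

lemma joinedIn_of_homologyInjective_zero {Y Z : Set X} (hYZ : Y ⊆ Z) (hZ : IsPathConnected Z)
    (h : HomologyInjective 0 Y Z) {x y : X} (hx : x ∈ Y) (hy : y ∈ Y) : JoinedIn Y x y := by
  classical
  obtain ⟨b, hb, hbc⟩ := h
    (Finsupp.single (constSimplex 0 x) 1 + Finsupp.single (constSimplex 0 y) 1)
    (Submodule.add_mem _ (Finsupp.single_mem_supported _ _ fun _ => hx)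
      (Finsupp.single_mem_supported _ _ fun _ => hy)) trivial
    (exists_d_eq_of_joinedIn (hZ.joinedIn x (hYZ hx) y (hYZ hy)))
  -- The number of points in the path component of `x`, modulo 2, vanishes on boundaries in `Y`.
  let φ : SingularChain 0 X →ₗ[ZMod 2] ZMod 2 :=
    Finsupp.linearCombination (ZMod 2) fun σ => if JoinedIn Y x (σ default) then 1 else 0
  have hφ : φ (d 0 b) = 0 := by
    refine (Submodule.mem_bot (ZMod 2)).1 ?_
    refine Finsupp.apply_mem_of_mem_supported (φ ∘ₗ d 0) (fun τ hτ => ?_) hb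
    have hj : ∀ s t, JoinedIn Y (τ s) (τ t) := fun s t =>
      ⟨(PathConnectedSpace.joined s t).somePath.map τ.continuous, fun _ => hτ _⟩
    have hiff : JoinedIn Y x (τ (stdSimplex.vertex ((0 : Fin 2).succAbove 0))) ↔
        JoinedIn Y x (τ (stdSimplex.vertex ((1 : Fin 2).succAbove 0))) :=
      ⟨fun h => h.trans (hj _ _), fun h => h.trans (hj _ _)⟩
    rw [LinearMap.comp_apply, d_single, Fin.sum_univ_two, comp_face_eq_constSimplex,
      comp_face_eq_constSimplex, map_add]
    simp only [φ, Finsupp.linearCombination_single, constSimplex, ContinuousMap.const_apply, hiff]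
    exact (Submodule.mem_bot (ZMod 2)).2 (ZModModule.add_self _)
  by_contra hxy
  rw [hbc, map_add] at hφ
  simp [φ, constSimplex, hxy, JoinedIn.refl hx] at hφ

/-! ### Acyclic subsets -/

/-- The reduced homology modulo 2 of `Y` vanishes in all nonnegative degrees. -/
def Acyclic (Y : Set X) : Prop :=
  (∀ n, ∀ c ∈ chainsIn (n + 1) Y, d n c = 0 → ∃ b ∈ chainsIn (n + 2) Y, d (n + 1) b = c) ∧
    ∀ c ∈ chainsIn 0 Y, degree c = 0 → ∃ b ∈ chainsIn 1 Y, d 0 b = c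

lemma eq_zero_of_mem_chainsIn_empty {n : ℕ} {c : SingularChain n X} (hc : c ∈ chainsIn n ∅) :
    c = 0 := by
  refine (Submodule.mem_bot (ZMod 2)).1 ?_
  exact Finsupp.apply_mem_of_mem_supported LinearMap.id
    (fun σ hσ => (hσ (stdSimplex.vertex 0)).elim) hc

lemma acyclic_empty : Acyclic (∅ : Set X) :=
  ⟨fun _ _ hc _ => ⟨0, Submodule.zero_mem _, by
    rw [map_zero, eq_zero_of_mem_chainsIn_empty hc]⟩,
  fun _ hc _ => ⟨0, Submodule.zero_mem _, by rw [map_zero, eq_zero_of_mem_chainsIn_empty hc]⟩⟩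

lemma exists_eq_single_of_mem_chainsIn_singleton {n : ℕ} {z : X} {c : SingularChain n X}
    (hc : c ∈ chainsIn n {z}) : ∃ r, c = Finsupp.single (constSimplex n z) r := by
  suffices h : c ∈ LinearMap.range
      (Finsupp.lsingle (R := ZMod 2) (M := ZMod 2) (constSimplex n z)) by
    obtain ⟨r, hr⟩ := h
    exact ⟨r, hr.symm⟩
  refine Finsupp.apply_mem_of_mem_supported
    (N := LinearMap.range (Finsupp.lsingle (R := ZMod 2) (M := ZMod 2) (constSimplex n z)))
    LinearMap.id (fun σ hσ => ⟨1, ?_⟩) hc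
  have : σ = constSimplex n z := by
    ext t
    exact hσ t
  rw [this]
  rfl

lemma d_single_constSimplex (n : ℕ) (z : X) (r : ZMod 2) :
    d n (Finsupp.single (constSimplex (n + 1) z) r) =
      Finsupp.single (constSimplex n z) (r * (n + 2 : ℕ)) := by
  have h : ∀ i : Fin (n + 2), (constSimplex (n + 1) z).comp (face i) = constSimplex n z :=
    fun _ => rfl
  rw [← mul_one r, ← smul_eq_mul r 1, ← Finsupp.smul_single, map_smul, d_single]
  simp only [h, Finset.sum_const, Finset.card_univ, Fintype.card_fin, Finsupp.smul_single,
    smul_eq_mul, mul_one, nsmul_eq_mul]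

/-- A cycle of a star-shaped set is homologous to a multiple of a constant simplex. -/
lemma acyclic_of_starConvex {E : Type} [NormedAddCommGroup E] [NormedSpace ℝ E] {Y : Set E} {z : E}
    (hz : z ∈ Y) (hY : StarConvex ℝ z Y) : Acyclic Y := by
  have key : ∀ n, ∀ c ∈ chainsIn n Y, IsCycle c →
      ∃ r, IsCycle (Finsupp.single (constSimplex n z) r) ∧
      ∃ b ∈ chainsIn (n + 1) Y, d n b = c + Finsupp.single (constSimplex n z) r := by
    intro n c hc hcyc
    obtain ⟨c', hc', hcyc', b, hb, hbc⟩ := exists_homologous_of_segment_subset (A := {z}) (Z := Y)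
      (f := fun _ => z) continuousOn_const (fun _ _ => rfl)
      (fun y hy => by rw [segment_symm]; exact hY.segment_subset hy) hc hcyc
    obtain ⟨r, rfl⟩ := exists_eq_single_of_mem_chainsIn_singleton hc'
    exact ⟨r, hcyc', b, hb, hbc⟩
  constructor
  · intro n c hc hcyc
    obtain ⟨r, hr, b, hb, hbc⟩ := key (n + 1) c hc hcyc
    have hr' : Finsupp.single (constSimplex n z) (r * (n + 2 : ℕ)) = 0 :=
      (d_single_constSimplex n z r).symm.trans hr
    rcases Nat.even_or_odd n with hn | hn
    · -- In odd degrees the constant simplex is the boundary of a constant simplex.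
      refine ⟨b + Finsupp.single (constSimplex (n + 2) z) r, Submodule.add_mem _ hb
        (Finsupp.single_mem_supported _ _ fun _ => hz), ?_⟩
      have h1 : ((n + 1 + 2 : ℕ) : ZMod 2) = 1 :=
        (ZMod.natCast_eq_one_iff_odd).2 (by simpa [Nat.odd_add] using hn)
      rw [map_add, hbc, d_single_constSimplex, h1, mul_one, add_assoc, add_self, add_zero]
    · have h1 : ((n + 2 : ℕ) : ZMod 2) = 1 :=
        (ZMod.natCast_eq_one_iff_odd).2 (by simpa [Nat.odd_add] using hn)
      rw [h1, mul_one, Finsupp.single_eq_zero] at hr'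
      exact ⟨b, hb, by rw [hbc, hr', Finsupp.single_zero, add_zero]⟩
  · intro c hc hdeg
    obtain ⟨r, hr, b, hb, hbc⟩ := key 0 c hc trivial
    have : degree (d 0 b) = 0 := degree_d b
    rw [hbc, map_add, hdeg, degree_single, zero_add] at this
    exact ⟨b, hb, by rw [hbc, this, Finsupp.single_zero, add_zero]⟩

/-! ### Attaching a band -/

/-- A chain in the union of two separated relatively open sets is a sum of chains in these sets. -/
lemma exists_add_of_mem_chainsIn_union {n : ℕ} {Z L R : Set X}
    (hL : ∃ O, IsOpen O ∧ Z ∩ L = Z ∩ O) (hR : ∃ O, IsOpen O ∧ Z ∩ R = Z ∩ O)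
    (hLR : Disjoint L R) {c : SingularChain n X} (hc : c ∈ chainsIn n (Z ∩ (L ∪ R))) :
    ∃ l ∈ chainsIn n (Z ∩ L), ∃ r ∈ chainsIn n (Z ∩ R), c = l + r := by
  suffices h : c ∈ chainsIn n (Z ∩ L) ⊔ chainsIn n (Z ∩ R) by
    obtain ⟨l, hl, r, hr, h⟩ := Submodule.mem_sup.1 h
    exact ⟨l, hl, r, hr, h.symm⟩
  obtain ⟨O₁, hO₁, h₁⟩ := hL
  obtain ⟨O₂, hO₂, h₂⟩ := hR
  refine Finsupp.apply_mem_of_mem_supported LinearMap.id (fun σ hσ => ?_) hc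
  have hcov : Set.univ ⊆ σ ⁻¹' O₁ ∪ σ ⁻¹' O₂ := fun t _ => by
    rcases (hσ t).2 with h | h
    · exact Or.inl ((h₁.le ⟨(hσ t).1, h⟩).2)
    · exact Or.inr ((h₂.le ⟨(hσ t).1, h⟩).2)
  have hdis : Set.univ ∩ (σ ⁻¹' O₁ ∩ σ ⁻¹' O₂) = ∅ := by
    refine Set.eq_empty_of_forall_notMem fun t ht => ?_
    exact Set.disjoint_left.1 hLR (h₁.ge ⟨(hσ t).1, ht.2.1⟩).2 (h₂.ge ⟨(hσ t).1, ht.2.2⟩).2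
  rcases (isPreconnected_iff_subset_of_disjoint.1 isPreconnected_univ) _ _
    (hO₁.preimage σ.continuous) (hO₂.preimage σ.continuous) hcov hdis with h | h
  · exact Submodule.mem_sup_left (Finsupp.single_mem_supported _ _ fun t =>
      h₁.ge ⟨(hσ t).1, h (Set.mem_univ t)⟩)
  · exact Submodule.mem_sup_right (Finsupp.single_mem_supported _ _ fun t =>
      h₂.ge ⟨(hσ t).1, h (Set.mem_univ t)⟩)

lemma mem_chainsIn_inter {n : ℕ} {Y Z : Set X} {c : SingularChain n X} (hY : c ∈ chainsIn n Y)
    (hZ : c ∈ chainsIn n Z) : c ∈ chainsIn n (Y ∩ Z) :=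
  fun _ hσ t => ⟨hY hσ t, hZ hσ t⟩

/-- If `l + r = l' + r'` where `l`, `l'` lie in `L` and `r`, `r'` lie in `R`, then `l = l'`. -/
lemma eq_of_add_eq_add {n : ℕ} {L R : Set X} (hLR : Disjoint L R) {l l' r r' : SingularChain n X}
    (hl : l ∈ chainsIn n L) (hl' : l' ∈ chainsIn n L) (hr : r ∈ chainsIn n R)
    (hr' : r' ∈ chainsIn n R) (h : l + r = l' + r') : l = l' ∧ r = r' := by
  have h1 : l - l' = r' - r := by
    rw [sub_eq_sub_iff_add_eq_add, h, add_comm]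
  have h0 : l - l' = 0 := by
    refine eq_zero_of_mem_chainsIn_empty ?_
    rw [← Set.disjoint_iff_inter_eq_empty.1 hLR]
    exact mem_chainsIn_inter (Submodule.sub_mem _ hl hl') (h1 ▸ Submodule.sub_mem _ hr' hr)
  exact ⟨sub_eq_zero.1 h0, (sub_eq_zero.1 (h1.symm.trans h0)).symm⟩

/-- The Mayer-Vietoris argument for attaching a band to `X₀`, compatibly with subsets.

`X₁` is `X₀` with a band and `A₁ ⊆ X₁`, `A₀ ⊆ X₀` are corresponding subsets. The space `X₁` is
covered by the relatively open sets `U`, which deforms to `X₀`, and `V`, the interior of the band;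
their intersection is the disjoint union of the two ends `L` and `R` of the band. -/
lemma homologyInjective_of_band {X₀ X₁ A₀ A₁ U V L R : Set X} (hA₀ : A₀ ⊆ A₁)
    (hA₁ : A₁ ⊆ X₁) (hU : ∃ O, IsOpen O ∧ X₁ ∩ U = X₁ ∩ O)
    (hV : ∃ O, IsOpen O ∧ X₁ ∩ V = X₁ ∩ O) (hUV : X₁ ⊆ U ∪ V)
    (hL : ∃ O, IsOpen O ∧ X₁ ∩ L = X₁ ∩ O) (hR : ∃ O, IsOpen O ∧ X₁ ∩ R = X₁ ∩ O)
    (hLR : Disjoint L R) (hULR : X₁ ∩ U ∩ V = X₁ ∩ (L ∪ R))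
    (hAL : Acyclic (A₁ ∩ L)) (hAR : Acyclic (A₁ ∩ R)) (hAV : Acyclic (A₁ ∩ V)) (n : ℕ)
    (hAU : ∀ c ∈ chainsIn (n + 1) (A₁ ∩ U), IsCycle c →
      ∃ c' ∈ chainsIn (n + 1) A₀, IsCycle c' ∧ ∃ b ∈ chainsIn (n + 2) A₁, d (n + 1) b = c + c')
    (hX : HomologyInjective (n + 1) X₀ X₁) (hX₀ : A₀ ⊆ X₀)
    (hA : HomologyInjective (n + 1) A₀ X₀) : HomologyInjective (n + 1) A₁ X₁ := by
  have hopen : ∀ {T : Set X}, (∃ O, IsOpen O ∧ X₁ ∩ T = X₁ ∩ O) →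
      ∃ O, IsOpen O ∧ A₁ ∩ T = A₁ ∩ O := by
    rintro T ⟨O, hO, h⟩
    refine ⟨O, hO, ?_⟩
    rw [← Set.inter_eq_left.2 hA₁, Set.inter_assoc, h, ← Set.inter_assoc]
  have hcov : X₁ ⊆ X₁ ∩ U ∪ X₁ ∩ V := fun x hx => (hUV hx).imp (⟨hx, ·⟩) (⟨hx, ·⟩)
  have hULR' : A₁ ∩ U ∩ V = A₁ ∩ (L ∪ R) := by
    rw [← Set.inter_eq_left.2 hA₁, Set.inter_assoc, Set.inter_assoc, ← Set.inter_assoc X₁, hULR,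
      Set.inter_assoc]
  have hLR' : Disjoint (A₁ ∩ L) (A₁ ∩ R) := hLR.mono Set.inter_subset_right Set.inter_subset_right
  have hLR'' : Disjoint (X₁ ∩ L) (X₁ ∩ R) := hLR.mono Set.inter_subset_right Set.inter_subset_right
  rintro c hc hcyc ⟨y, hy, hyc⟩
  obtain ⟨u, hu, v, hv, b, hb, hbc⟩ := exists_small_cycle (Z := A₁) (hopen hU) (hopen hV)
    (fun x hx => (hUV (hA₁ hx)).imp (⟨hx, ·⟩) (⟨hx, ·⟩)) hc hcyc
  have hduv : d n u = d n v := by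
    have h := congrArg (d n) hbc
    rw [d_d, map_add, map_add, show d n c = 0 from hcyc, zero_add] at h
    rw [← sub_eq_zero, ZModModule.sub_eq_add]
    exact h.symm
  have hdv : d n v ∈ chainsIn n (A₁ ∩ (L ∪ R)) := by
    rw [← hULR']
    have hsub : (A₁ ∩ U) ∩ (A₁ ∩ V) ⊆ A₁ ∩ U ∩ V := fun x hx => ⟨hx.1, hx.2.2⟩
    exact chainsIn_mono _ hsub (mem_chainsIn_inter (hduv ▸ d_mem_chainsIn n hu)
      (d_mem_chainsIn n hv))
  obtain ⟨l, hl, r, hr, hlr⟩ := exists_add_of_mem_chainsIn_union (hopen hL) (hopen hR) hLR hdv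
  -- The part of `d v` in one end of the band bounds in that end.
  obtain ⟨w₁, hw₁, hdw₁, w₂, hw₂, hdw₂⟩ : ∃ w₁ ∈ chainsIn (n + 1) (A₁ ∩ L), d n w₁ = l ∧
      ∃ w₂ ∈ chainsIn (n + 1) (A₁ ∩ R), d n w₂ = r := by
    cases n with
    | zero =>
      have hsum : d 1 (y + b) = u + v := by
        rw [map_add, hyc, hbc, ← add_assoc, add_self, zero_add]
      obtain ⟨u', hu', v', hv', huv'⟩ := exists_small_of_d_eq (Z := X₁) hU hV hcov
        (chainsIn_mono _ (Set.inter_subset_inter_left _ hA₁) hu)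
        (chainsIn_mono _ (Set.inter_subset_inter_left _ hA₁) hv)
        (Submodule.add_mem _ hy (chainsIn_mono _ hA₁ hb)) hsum
      have hw : v + d 1 v' = u + d 1 u' := by
        rw [← sub_eq_zero, ZModModule.sub_eq_add, ← add_self _ (u + v)]
        nth_rewrite 2 [← huv']
        rw [map_add]
        abel
      have hwLR : v + d 1 v' ∈ chainsIn 1 (X₁ ∩ (L ∪ R)) := by
        rw [← hULR]
        have h1 : v + d 1 v' ∈ chainsIn 1 (X₁ ∩ V) := Submodule.add_mem _
          (chainsIn_mono _ (Set.inter_subset_inter_left _ hA₁) hv) (d_mem_chainsIn 1 hv')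
        have h2 : u + d 1 u' ∈ chainsIn 1 (X₁ ∩ U) := Submodule.add_mem _
          (chainsIn_mono _ (Set.inter_subset_inter_left _ hA₁) hu) (d_mem_chainsIn 1 hu')
        have hsub : (X₁ ∩ V) ∩ (X₁ ∩ U) ⊆ X₁ ∩ U ∩ V := fun x hx => ⟨hx.2, hx.1.2⟩
        exact chainsIn_mono _ hsub (mem_chainsIn_inter h1 (hw ▸ h2))
      obtain ⟨wl, hwl, wr, hwr, hwlr⟩ := exists_add_of_mem_chainsIn_union hL hR hLR hwLR
      have hd : d 0 wl + d 0 wr = l + r := by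
        rw [← map_add, ← hwlr, map_add, d_d, add_zero, hlr]
      obtain ⟨h1, h2⟩ := eq_of_add_eq_add hLR'' (d_mem_chainsIn 0 hwl)
        (chainsIn_mono _ (Set.inter_subset_inter_left _ hA₁) hl) (d_mem_chainsIn 0 hwr)
        (chainsIn_mono _ (Set.inter_subset_inter_left _ hA₁) hr) hd
      obtain ⟨w₁, hw₁, hdw₁⟩ := hAL.2 l hl (by rw [← h1, degree_d])
      obtain ⟨w₂, hw₂, hdw₂⟩ := hAR.2 r hr (by rw [← h2, degree_d])
      exact ⟨w₁, hw₁, hdw₁, w₂, hw₂, hdw₂⟩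
    | succ n =>
      have hd : d n l + d n r = 0 + 0 := by
        rw [← map_add, ← hlr, d_d, add_zero]
      obtain ⟨h1, h2⟩ := eq_of_add_eq_add hLR' (d_mem_chainsIn n hl) (Submodule.zero_mem _)
        (d_mem_chainsIn n hr) (Submodule.zero_mem _) hd
      obtain ⟨w₁, hw₁, hdw₁⟩ := hAL.1 n l hl h1
      obtain ⟨w₂, hw₂, hdw₂⟩ := hAR.1 n r hr h2
      exact ⟨w₁, hw₁, hdw₁, w₂, hw₂, hdw₂⟩
  have hw : w₁ + w₂ ∈ chainsIn (n + 1) (A₁ ∩ U ∩ V) := by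
    rw [hULR', Set.inter_union_distrib_left]
    exact Submodule.add_mem _ (chainsIn_mono _ Set.subset_union_left hw₁)
      (chainsIn_mono _ Set.subset_union_right hw₂)
  have hdw : d n (w₁ + w₂) = d n v := by rw [map_add, hdw₁, hdw₂, hlr]
  obtain ⟨b₂, hb₂, hdb₂⟩ := hAV.1 n (v + (w₁ + w₂)) (Submodule.add_mem _ hv
    (chainsIn_mono _ (Set.inter_subset_inter_left _ Set.inter_subset_left) hw))
    (by rw [map_add, hdw, add_self])
  have hu' : u + (w₁ + w₂) ∈ chainsIn (n + 1) (A₁ ∩ U) :=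
    Submodule.add_mem _ hu (chainsIn_mono _ Set.inter_subset_left hw)
  obtain ⟨c', hc', hcyc', b₃, hb₃, hdb₃⟩ := hAU _ hu'
    ((map_add _ _ _).trans (by rw [hduv, hdw, add_self]))
  have hsum : c + c' = d (n + 1) (b + b₂ + b₃) := by
    rw [map_add, map_add, hbc, hdb₂, hdb₃]
    have h (x y : SingularChain (n + 1) X) :
        c + (u + v) + (v + x) + (u + x + y) = c + y + (u + u) + (v + v) + (x + x) := by abel
    rw [h, add_self, add_self, add_self, add_zero, add_zero, add_zero]
  have hbA : b + b₂ + b₃ ∈ chainsIn (n + 2) A₁ := Submodule.add_mem _ (Submodule.add_mem _ hb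
    (chainsIn_mono _ Set.inter_subset_left hb₂)) hb₃
  have hc'X : c' = d (n + 1) (y + (b + b₂ + b₃)) := by
    rw [map_add, hyc, ← hsum, ← add_assoc, add_self, zero_add]
  obtain ⟨b₄, hb₄, hdb₄⟩ := hA c' hc' hcyc' (hX c' (chainsIn_mono _ hX₀ hc') hcyc'
    ⟨_, Submodule.add_mem _ hy (chainsIn_mono _ hA₁ hbA), hc'X.symm⟩)
  refine ⟨b + b₂ + b₃ + b₄, Submodule.add_mem _ hbA (chainsIn_mono _ hA₀ hb₄), ?_⟩
  rw [map_add, ← hsum, hdb₄, add_assoc, add_self, add_zero]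

end SingularChain

/-! ### Barycentric coordinates of a finite simplicial complex -/

namespace Geometry.SimplicialComplex

variable {E : Type} [NormedAddCommGroup E] [NormedSpace ℝ E]

/-- `w` is a system of barycentric weights on the finite set `s` for the point `x`. -/
structure IsWeight (s : Finset E) (w : E → ℝ) (x : E) : Prop where
  nonneg : ∀ v, 0 ≤ w v
  eq_zero : ∀ v, v ∉ s → w v = 0
  sum_eq : ∑ v ∈ s, w v = 1
  sum_smul : ∑ v ∈ s, w v • v = x

lemma IsWeight.mono {s t : Finset E} {w : E → ℝ} {x : E} (h : IsWeight s w x) (hst : s ⊆ t) :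
    IsWeight t w x where
  nonneg := h.nonneg
  eq_zero v hv := h.eq_zero v fun hs => hv (hst hs)
  sum_eq := by
    rw [← h.sum_eq]
    exact (Finset.sum_subset hst fun v _ hv => h.eq_zero v hv).symm
  sum_smul := by
    rw [← h.sum_smul]
    exact (Finset.sum_subset hst fun v _ hv => by rw [h.eq_zero v hv, zero_smul]).symm

lemma IsWeight.of_subset {s t : Finset E} {w : E → ℝ} {x : E} (h : IsWeight t w x) (hst : s ⊆ t)
    (h0 : ∀ v, v ∉ s → w v = 0) : IsWeight s w x where
  nonneg := h.nonneg
  eq_zero := h0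
  sum_eq := by
    rw [← h.sum_eq]
    exact Finset.sum_subset hst fun v _ hv => h0 v hv
  sum_smul := by
    rw [← h.sum_smul]
    exact Finset.sum_subset hst fun v _ hv => by rw [h0 v hv, zero_smul]

lemma IsWeight.mem_convexHull {s : Finset E} {w : E → ℝ} {x : E} (h : IsWeight s w x) :
    x ∈ convexHull ℝ (s : Set E) :=
  Finset.mem_convexHull'.2 ⟨w, fun v _ => h.nonneg v, h.sum_eq, h.sum_smul⟩

lemma IsWeight.lineMap {s : Finset E} {w w' : E → ℝ} {x x' : E} (h : IsWeight s w x)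
    (h' : IsWeight s w' x') {t : ℝ} (ht : t ∈ Set.Icc (0 : ℝ) 1) :
    IsWeight s (fun v => (1 - t) * w v + t * w' v) ((1 - t) • x + t • x') where
  nonneg v := add_nonneg (mul_nonneg (by linarith [ht.2]) (h.nonneg v))
    (mul_nonneg ht.1 (h'.nonneg v))
  eq_zero v hv := by rw [h.eq_zero v hv, h'.eq_zero v hv, mul_zero, mul_zero, add_zero]
  sum_eq := by
    rw [Finset.sum_add_distrib, ← Finset.mul_sum, ← Finset.mul_sum, h.sum_eq, h'.sum_eq]
    ring
  sum_smul := by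
    simp only [add_smul, mul_smul]
    rw [Finset.sum_add_distrib, ← Finset.smul_sum, ← Finset.smul_sum, h.sum_smul, h'.sum_smul]

lemma isWeight_singleton [DecidableEq E] (v : E) : IsWeight {v} (Pi.single v 1) v where
  nonneg u := by
    rcases eq_or_ne u v with rfl | h
    · simp
    · simp [h]
  eq_zero u hu := Pi.single_eq_of_ne (by simpa using hu) _
  sum_eq := by simp
  sum_smul := by simp

lemma exists_isWeight {s : Finset E} {x : E} (hx : x ∈ convexHull ℝ (s : Set E)) :
    ∃ w, IsWeight s w x := by
  classical
  obtain ⟨w, h0, h1, h2⟩ := Finset.mem_convexHull'.1 hx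
  refine ⟨fun v => if v ∈ s then w v else 0, fun v => ?_, fun v hv => if_neg hv, ?_, ?_⟩
  · split_ifs with h
    exacts [h0 v h, le_rfl]
  · rw [← h1]
    exact Finset.sum_congr rfl fun v hv => if_pos hv
  · rw [← h2]
    exact Finset.sum_congr rfl fun v hv => by rw [if_pos hv]

lemma IsWeight.unique_of_affineIndependent {s : Finset E} {w w' : E → ℝ} {x : E}
    (hs : AffineIndependent ℝ ((↑) : s → E)) (h : IsWeight s w x) (h' : IsWeight s w' x) :
    w = w' := by
  funext v
  by_cases hv : v ∈ s
  · have := affineIndependent_iff.1 hs Finset.univ (fun u => w u - w' u) ?_ ?_ ⟨v, hv⟩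
      (Finset.mem_univ _)
    · exact sub_eq_zero.1 this
    · rw [Finset.sum_sub_distrib, Finset.sum_coe_sort s w, Finset.sum_coe_sort s w', h.sum_eq,
        h'.sum_eq, sub_self]
    · simp only [sub_smul]
      rw [Finset.sum_sub_distrib, Finset.sum_coe_sort s (fun u => w u • u),
        Finset.sum_coe_sort s (fun u => w' u • u), h.sum_smul, h'.sum_smul, sub_self]
  · rw [h.eq_zero v hv, h'.eq_zero v hv]

variable (K : SimplicialComplex ℝ E)

variable {K} in
/-- Weights on two faces agree, because both agree with weights on the common face. -/
lemma isWeight_unique {s t : Finset E} (hs : s ∈ K.faces) (ht : t ∈ K.faces) {w w' : E → ℝ} {x : E}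
    (h : IsWeight s w x) (h' : IsWeight t w' x) : w = w' := by
  classical
  have hx := K.inter_subset_convexHull hs ht ⟨h.mem_convexHull, h'.mem_convexHull⟩
  rw [← Finset.coe_inter] at hx
  obtain ⟨u, hu⟩ := exists_isWeight hx
  exact (h.unique_of_affineIndependent (K.indep hs) (hu.mono Finset.inter_subset_left)).trans
    (h'.unique_of_affineIndependent (K.indep ht) (hu.mono Finset.inter_subset_right)).symm

open Classical in
/-- The barycentric coordinates of a point of the underlying space of `K`, as a function on all
points of the ambient space that vanishes outside the simplex which carries the point. -/
noncomputable def baryCoord (x : E) : E → ℝ :=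
  if h : ∃ w, ∃ s ∈ K.faces, IsWeight s w x then h.choose else 0

variable {K}

lemma IsWeight.baryCoord_eq {s : Finset E} (hs : s ∈ K.faces) {w : E → ℝ} {x : E}
    (h : IsWeight s w x) : K.baryCoord x = w := by
  have hex : ∃ w, ∃ s ∈ K.faces, IsWeight s w x := ⟨w, s, hs, h⟩
  rw [baryCoord, dif_pos hex]
  obtain ⟨t, ht, h'⟩ := hex.choose_spec
  exact isWeight_unique ht hs h' h

lemma isWeight_baryCoord {s : Finset E} (hs : s ∈ K.faces) {x : E}
    (hx : x ∈ convexHull ℝ (s : Set E)) : IsWeight s (K.baryCoord x) x := by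
  obtain ⟨w, hw⟩ := exists_isWeight hx
  rwa [hw.baryCoord_eq hs]

/-- Every point lies on a face whose vertices are exactly the points where its weight is
positive. -/
lemma exists_carrier {x : E} (hx : x ∈ K.space) :
    ∃ s ∈ K.faces, IsWeight s (K.baryCoord x) x ∧ ∀ v, v ∈ s ↔ 0 < K.baryCoord x v := by
  classical
  obtain ⟨s, hs, hxs⟩ := mem_space_iff.1 hx
  have h := isWeight_baryCoord hs hxs
  have h0 : ∀ v, v ∉ s.filter (fun v => 0 < K.baryCoord x v) → K.baryCoord x v = 0 := by
    intro v hv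
    by_contra hne
    exact hv (Finset.mem_filter.2 ⟨by_contra fun hvs => hne (h.eq_zero v hvs),
      lt_of_le_of_ne (h.nonneg v) (Ne.symm hne)⟩)
  have h' := h.of_subset (Finset.filter_subset _ s) h0
  refine ⟨_, K.down_closed hs (Finset.filter_subset _ s) ?_, h', fun v => ?_⟩
  · rw [Finset.nonempty_iff_ne_empty]
    intro he
    have := h'.sum_eq
    rw [he, Finset.sum_empty] at this
    exact zero_ne_one this
  · refine ⟨fun hv => (Finset.mem_filter.1 hv).2, fun hv => ?_⟩
    by_contra hvs
    exact hv.ne' (h0 v hvs)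

lemma baryCoord_nonneg {x : E} (hx : x ∈ K.space) (v : E) : 0 ≤ K.baryCoord x v := by
  obtain ⟨s, -, h, -⟩ := exists_carrier hx
  exact h.nonneg v

lemma baryCoord_vertex [DecidableEq E] {v : E} (hv : v ∈ K.vertices) :
    K.baryCoord v = Pi.single v 1 :=
  (isWeight_singleton v).baryCoord_eq hv

lemma baryCoord_lineMap {s : Finset E} (hs : s ∈ K.faces) {x y : E}
    (hx : x ∈ convexHull ℝ (s : Set E)) (hy : y ∈ convexHull ℝ (s : Set E)) {t : ℝ}
    (ht : t ∈ Set.Icc (0 : ℝ) 1) (v : E) :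
    K.baryCoord ((1 - t) • x + t • y) v = (1 - t) * K.baryCoord x v + t * K.baryCoord y v := by
  rw [((isWeight_baryCoord hs hx).lineMap (isWeight_baryCoord hs hy) ht).baryCoord_eq hs]

lemma baryCoord_eq_of_le {K' : SimplicialComplex ℝ E} (h : K ≤ K') {x : E} (hx : x ∈ K.space) :
    K'.baryCoord x = K.baryCoord x := by
  obtain ⟨s, hs, hw, -⟩ := exists_carrier hx
  exact hw.baryCoord_eq (h hs)

lemma space_mono {K' : SimplicialComplex ℝ E} (h : K ≤ K') : K.space ⊆ K'.space :=
  Set.biUnion_subset_biUnion_left fun _ hs => h hs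

/-- On a single simplex, a barycentric coordinate is the restriction of an affine map of the whole
space; this gives its continuity. -/
lemma exists_affineMap_eq_weight {s : Finset E} (hs : AffineIndependent ℝ ((↑) : s → E)) {v : E}
    (hv : v ∈ s) : ∃ f : E →ᵃ[ℝ] ℝ, ∀ w x, IsWeight s w x → f x = w v := by
  classical
  obtain ⟨t, hst, ht, htop⟩ :=
    exists_subset_affineIndependent_affineSpan_eq_top (s := (s : Set E)) hs
  let b : AffineBasis t ℝ E := ⟨(↑), ht, by simpa using htop⟩
  refine ⟨b.coord ⟨v, hst hv⟩, fun w x h => ?_⟩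
  have hval : ∀ u ∈ s, b.coord ⟨v, hst hv⟩ u = if u = v then 1 else 0 := by
    intro u hu
    split_ifs with huv
    · subst huv
      exact b.coord_apply_eq ⟨u, hst hu⟩
    · exact b.coord_apply_ne (j := ⟨u, hst hu⟩) fun h => huv (Subtype.ext_iff.1 h).symm
  have hdec : ∀ y, b.coord ⟨v, hst hv⟩ y =
      (b.coord ⟨v, hst hv⟩).linear y + b.coord ⟨v, hst hv⟩ 0 :=
    fun y => congrFun (AffineMap.decomp _) y
  rw [hdec, ← h.sum_smul, map_sum]
  have h1 : b.coord ⟨v, hst hv⟩ 0 = ∑ u ∈ s, w u * b.coord ⟨v, hst hv⟩ 0 := by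
    rw [← Finset.sum_mul, h.sum_eq, one_mul]
  rw [h1, ← Finset.sum_add_distrib]
  have h2 : ∀ u ∈ s, (b.coord ⟨v, hst hv⟩).linear (w u • u) + w u * b.coord ⟨v, hst hv⟩ 0 =
      if u = v then w u else 0 := by
    intro u hu
    rw [map_smul, smul_eq_mul, ← mul_add, ← hdec, hval u hu, mul_ite, mul_one, mul_zero]
  rw [Finset.sum_congr rfl h2, Finset.sum_ite_eq_of_mem' s v w hv]

lemma continuousOn_baryCoord [FiniteDimensional ℝ E] (hK : K.faces.Finite) (v : E) :
    ContinuousOn (fun x => K.baryCoord x v) K.space := by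
  have : Finite K.faces := hK
  have hsp : K.space = ⋃ s : K.faces, convexHull ℝ (s.1 : Set E) := by
    rw [space, Set.biUnion_eq_iUnion]
  rw [hsp]
  refine (locallyFinite_of_finite _).continuousOn_iUnion (fun s => ?_) fun s => ?_
  · exact (s.1.finite_toSet.isCompact_convexHull ℝ).isClosed
  · by_cases hv : v ∈ s.1
    · obtain ⟨f, hf⟩ := exists_affineMap_eq_weight (K.indep s.2) hv
      refine f.continuous_of_finiteDimensional.continuousOn.congr fun x hx => ?_
      exact (hf _ _ (isWeight_baryCoord s.2 hx)).symm
    · refine (continuousOn_const (c := (0 : ℝ))).congr fun x hx => ?_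
      exact (isWeight_baryCoord s.2 hx).eq_zero v hv

lemma isCompact_space (hK : K.faces.Finite) : IsCompact K.space :=
  hK.isCompact_biUnion fun s _ => s.finite_toSet.isCompact_convexHull ℝ

/-! ### Full subcomplexes -/

/-- The underlying space of the full subcomplex of `K` spanned by the vertices in `P`. -/
def fullSpace (K : SimplicialComplex ℝ E) (P : Set E) : Set E :=
  {x | x ∈ K.space ∧ ∀ v, v ∉ P → K.baryCoord x v = 0}

lemma fullSpace_subset_space (P : Set E) : K.fullSpace P ⊆ K.space := fun _ hx => hx.1

open Classical in
/-- The finite set of vertices of a finite complex. -/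
noncomputable def vertexFinset (hK : K.faces.Finite) : Finset E := hK.toFinset.sup id

open Classical in
lemma subset_vertexFinset (hK : K.faces.Finite) {s : Finset E} (hs : s ∈ K.faces) :
    s ⊆ vertexFinset hK :=
  Finset.le_sup (f := id) (hK.mem_toFinset.2 hs)

lemma isWeight_vertexFinset (hK : K.faces.Finite) {x : E} (hx : x ∈ K.space) :
    IsWeight (vertexFinset hK) (K.baryCoord x) x := by
  obtain ⟨s, hs, h, -⟩ := exists_carrier hx
  exact h.mono (subset_vertexFinset hK hs)

open Classical in
/-- The total weight of a point on the vertices in `P`. -/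
noncomputable def mass (hK : K.faces.Finite) (P : Set E) (x : E) : ℝ :=
  ∑ v ∈ vertexFinset hK with v ∈ P, K.baryCoord x v

open Classical in
/-- The radial projection of the points with positive total weight on `P` to the full subcomplex
spanned by `P`: the weights outside `P` are dropped and the other ones are normalized. -/
noncomputable def proj (hK : K.faces.Finite) (P : Set E) (x : E) : E :=
  (mass hK P x)⁻¹ • ∑ v ∈ vertexFinset hK with v ∈ P, K.baryCoord x v • v

open Classical in
lemma isWeight_proj (hK : K.faces.Finite) (P : Set E) {x : E} (hx : 0 < mass hK P x)
    {s : Finset E} (hs : s ∈ K.faces) (hxs : x ∈ convexHull ℝ (s : Set E)) :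
    IsWeight s (fun v => if v ∈ P then (mass hK P x)⁻¹ * K.baryCoord x v else 0)
      (proj hK P x) := by
  have h := isWeight_baryCoord hs hxs
  have hW : IsWeight (vertexFinset hK)
      (fun v => if v ∈ P then (mass hK P x)⁻¹ * K.baryCoord x v else 0) (proj hK P x) := by
    refine ⟨fun v => ?_, fun v hv => ?_, ?_, ?_⟩
    · split_ifs
      exacts [mul_nonneg (inv_nonneg.2 hx.le) (h.nonneg v), le_rfl]
    · have := h.eq_zero v fun hvs => hv (subset_vertexFinset hK hs hvs)
      simp [this]
    · rw [← Finset.sum_filter, ← Finset.mul_sum]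
      exact inv_mul_cancel₀ hx.ne'
    · simp only [ite_smul, zero_smul, mul_smul]
      rw [← Finset.sum_filter, ← Finset.smul_sum, proj]
  refine hW.of_subset (subset_vertexFinset hK hs) fun v hv => ?_
  simp [h.eq_zero v hv]

lemma mass_nonneg (hK : K.faces.Finite) (P : Set E) {x : E} (hx : x ∈ K.space) :
    0 ≤ mass hK P x :=
  Finset.sum_nonneg fun v _ => baryCoord_nonneg hx v

lemma baryCoord_le_mass (hK : K.faces.Finite) {P : Set E} {x : E} (hx : x ∈ K.space) {v : E}
    (hv : v ∈ P) : K.baryCoord x v ≤ mass hK P x := by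
  classical
  by_cases h : v ∈ vertexFinset hK
  · exact Finset.single_le_sum (f := fun v => K.baryCoord x v) (fun v _ => baryCoord_nonneg hx v)
      (Finset.mem_filter.2 ⟨h, hv⟩)
  · rw [(isWeight_vertexFinset hK hx).eq_zero v h]
    exact mass_nonneg hK P hx

lemma mass_eq_one (hK : K.faces.Finite) {P : Set E} {x : E} (hx : x ∈ K.fullSpace P) :
    mass hK P x = 1 := by
  classical
  rw [← (isWeight_vertexFinset hK hx.1).sum_eq, mass, Finset.sum_filter]
  refine Finset.sum_congr rfl fun v _ => ?_
  split_ifs with h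
  exacts [rfl, (hx.2 v h).symm]

lemma proj_eq_self (hK : K.faces.Finite) {P : Set E} {x : E} (hx : x ∈ K.fullSpace P) :
    proj hK P x = x := by
  classical
  obtain ⟨s, hs, hxs⟩ := mem_space_iff.1 hx.1
  have h1 := mass_eq_one hK hx
  have h := isWeight_proj hK P (by rw [h1]; exact one_pos) hs hxs
  refine h.sum_smul.symm.trans (Eq.trans ?_ (isWeight_baryCoord hs hxs).sum_smul)
  refine Finset.sum_congr rfl fun v _ => ?_
  split_ifs with hv
  · rw [h1, inv_one, one_mul]
  · rw [hx.2 v hv]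

lemma proj_mem_fullSpace (hK : K.faces.Finite) {P : Set E} {x : E} (hx : x ∈ K.space)
    (hm : 0 < mass hK P x) : proj hK P x ∈ K.fullSpace P := by
  classical
  obtain ⟨s, hs, hxs⟩ := mem_space_iff.1 hx
  have h := isWeight_proj hK P hm hs hxs
  refine ⟨convexHull_subset_space hs h.mem_convexHull, fun v hv => ?_⟩
  rw [h.baryCoord_eq hs]
  exact if_neg hv

lemma baryCoord_proj_eq_zero (hK : K.faces.Finite) {P : Set E} {x : E} (hx : x ∈ K.space)
    (hm : 0 < mass hK P x) {v : E} (hv : K.baryCoord x v = 0) :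
    K.baryCoord (proj hK P x) v = 0 := by
  classical
  obtain ⟨s, hs, hxs⟩ := mem_space_iff.1 hx
  rw [(isWeight_proj hK P hm hs hxs).baryCoord_eq hs]
  simp [hv]

/-- Coordinates that vanish at `x` vanish on the segment from `x` to its projection. -/
lemma segment_proj_subset (hK : K.faces.Finite) {P Q : Set E} {x : E} (hx : x ∈ K.fullSpace Q)
    (hm : 0 < mass hK P x) : segment ℝ x (proj hK P x) ⊆ K.fullSpace Q := by
  classical
  obtain ⟨s, hs, hxs⟩ := mem_space_iff.1 hx.1
  have h := isWeight_proj hK P hm hs hxs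
  rw [segment_eq_image]
  rintro _ ⟨t, ht, rfl⟩
  refine ⟨convexHull_subset_space hs ((isWeight_baryCoord hs hxs).lineMap h ht).mem_convexHull,
    fun v hv => ?_⟩
  rw [baryCoord_lineMap hs hxs h.mem_convexHull ht, hx.2 v hv,
    baryCoord_proj_eq_zero hK hx.1 hm (hx.2 v hv), mul_zero, mul_zero, add_zero]

lemma fullSpace_univ : K.fullSpace Set.univ = K.space :=
  Set.Subset.antisymm (fullSpace_subset_space _) fun _ hx => ⟨hx, fun _ hv => (hv trivial).elim⟩

lemma continuousOn_proj [FiniteDimensional ℝ E] (hK : K.faces.Finite) (P : Set E) :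
    ContinuousOn (proj hK P) {x | x ∈ K.space ∧ 0 < mass hK P x} := by
  classical
  have h : ∀ v, ContinuousOn (fun x => K.baryCoord x v) {x | x ∈ K.space ∧ 0 < mass hK P x} :=
    fun v => (continuousOn_baryCoord hK v).mono fun x hx => hx.1
  refine ContinuousOn.smul (ContinuousOn.inv₀ ?_ fun x hx => hx.2.ne') ?_
  · exact continuousOn_finsetSum _ fun v _ => h v
  · exact continuousOn_finsetSum _ fun v _ => (h v).smul continuousOn_const

/-! ### Half-spaces and full subcomplexes -/

section HalfSpace

variable (l : E →ₗ[ℝ] ℝ) (r : ℝ)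

lemma mass_halfSpace_pos (hK : K.faces.Finite) {x : E} (hx : x ∈ K.space) (hl : r < l x) :
    0 < mass hK {v | r < l v} x := by
  obtain ⟨s, hs, h, hpos⟩ := exists_carrier hx
  obtain ⟨v, hv, hlv⟩ : ∃ v ∈ s, r < l v := by
    by_contra! hle
    have h1 : l x ≤ r := by
      rw [← h.sum_smul, map_sum]
      calc ∑ v ∈ s, l (K.baryCoord x v • v) ≤ ∑ v ∈ s, K.baryCoord x v * r :=
            Finset.sum_le_sum fun v hv => by
              rw [map_smul, smul_eq_mul]
              exact mul_le_mul_of_nonneg_left (hle v hv) (h.nonneg v)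
        _ = r := by rw [← Finset.sum_mul, h.sum_eq, one_mul]
    exact absurd hl h1.not_gt
  exact ((hpos v).1 hv).trans_le (baryCoord_le_mass hK hx hlv)

lemma fullSpace_halfSpace_subset :
    K.fullSpace {v | r < l v} ⊆ K.space ∩ {x | r < l x} := by
  rintro x ⟨hx, h0⟩
  obtain ⟨s, hs, h, hpos⟩ := exists_carrier hx
  refine ⟨hx, convexHull_min (fun v hv => ?_) (convex_halfSpace_gt l.isLinear r) h.mem_convexHull⟩
  by_contra hv'
  exact ((hpos v).1 hv).ne' (h0 v hv')

lemma segment_proj_halfSpace_subset (hK : K.faces.Finite) {x : E}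
    (hx : x ∈ K.space ∩ {x | r < l x}) :
    segment ℝ x (proj hK {v | r < l v} x) ⊆ K.space ∩ {x | r < l x} := by
  have hm := mass_halfSpace_pos l r hK hx.1 hx.2
  refine Set.subset_inter ?_ ?_
  · have := segment_proj_subset hK (Q := Set.univ) (P := {v | r < l v}) (x := x)
    rw [fullSpace_univ] at this
    exact this hx.1 hm
  · exact (convex_halfSpace_gt l.isLinear r).segment_subset hx.2
      (fullSpace_halfSpace_subset l r (proj_mem_fullSpace hK hx.1 hm)).2

variable [FiniteDimensional ℝ E]

open SingularChain in
/-- The part of a finite complex in an open half-space has the homology of the full subcomplex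
spanned by the vertices in that half-space. -/
lemma homologyInjective_halfSpace_iff (hK : K.faces.Finite) (p : ℕ) :
    HomologyInjective p (K.space ∩ {x | r < l x}) K.space ↔
      HomologyInjective p (K.fullSpace {v | r < l v}) K.space := by
  have hsub := fullSpace_halfSpace_subset (K := K) l r
  have hcont : ContinuousOn (proj hK {v | r < l v}) (K.space ∩ {x | r < l x}) :=
    (continuousOn_proj hK _).mono fun x hx => ⟨hx.1, mass_halfSpace_pos l r hK hx.1 hx.2⟩
  have hmem : ∀ x ∈ K.space ∩ {x | r < l x}, proj hK {v | r < l v} x ∈ K.fullSpace {v | r < l v} :=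
    fun x hx => proj_mem_fullSpace hK hx.1 (mass_halfSpace_pos l r hK hx.1 hx.2)
  constructor
  · refine HomologyInjective.trans hsub (homologyInjective_of_retraction p
      ⟨fun x => ⟨proj hK _ x.1, hmem x.1 x.2⟩, hcont.domRestrict.subtype_mk _⟩
      (fun x hx _ => proj_eq_self hK hx) hsub)
  · rintro h c hc hcyc ⟨b, hb, hbc⟩
    obtain ⟨c', hc', hcyc', b', hb', hbc'⟩ := exists_homologous_of_segment_subset hcont hmem
      (fun x hx => segment_proj_halfSpace_subset l r hK hx) hc hcyc
    obtain ⟨b₂, hb₂, hbc₂⟩ := h c' hc' hcyc' ⟨b + b', Submodule.add_mem _ hb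
      (chainsIn_mono _ Set.inter_subset_left hb'), by
        rw [map_add, hbc, hbc', ← add_assoc, SingularChain.add_self, zero_add]⟩
    refine ⟨b' + b₂, Submodule.add_mem _ hb' (chainsIn_mono _ hsub hb₂), ?_⟩
    rw [map_add, hbc', hbc₂, add_assoc, SingularChain.add_self, add_zero]

end HalfSpace

/-! ### Paths in simplicial complexes -/

lemma joinedIn_fullSpace_vertex {P : Set E} {x : E} (hx : x ∈ K.fullSpace P) :
    ∃ v ∈ K.vertices, v ∈ P ∧ JoinedIn (K.fullSpace P) x v := by
  classical
  obtain ⟨s, hs, h, hpos⟩ := exists_carrier hx.1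
  obtain ⟨v, hv⟩ := nonempty_of_mem_faces hs
  have hsP : ∀ u ∈ s, u ∈ P := fun u hu => by_contra fun hP => ((hpos u).1 hu).ne' (hx.2 u hP)
  refine ⟨v, K.down_closed hs (by simpa using hv) (Finset.singleton_nonempty v), hsP v hv, ?_⟩
  refine ((convex_convexHull ℝ (s : Set E)).isPathConnected ⟨x, h.mem_convexHull⟩).joinedIn x
    h.mem_convexHull v (subset_convexHull ℝ _ hv) |>.mono fun y hy => ?_
  refine ⟨convexHull_subset_space hs hy, fun u hu => ?_⟩
  exact (isWeight_baryCoord hs hy).eq_zero u fun hus => hu (hsP u hus)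

lemma joinedIn_fullSpace_of_edge [DecidableEq E] {P : Set E} {u v : E} (huv : {u, v} ∈ K.faces)
    (hu : u ∈ P) (hv : v ∈ P) : JoinedIn (K.fullSpace P) u v := by
  have hu' : u ∈ convexHull ℝ (({u, v} : Finset E) : Set E) := subset_convexHull ℝ _ (by simp)
  have hv' : v ∈ convexHull ℝ (({u, v} : Finset E) : Set E) := subset_convexHull ℝ _ (by simp)
  refine ((convex_convexHull ℝ _).isPathConnected ⟨u, hu'⟩).joinedIn u hu' v hv' |>.mono
    fun y hy => ⟨convexHull_subset_space huv hy, fun w hw => ?_⟩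
  refine (isWeight_baryCoord huv hy).eq_zero w fun h => hw ?_
  rcases Finset.mem_insert.1 h with rfl | h
  · exact hu
  · rwa [Finset.mem_singleton.1 h]

/-- The underlying space of a finite complex is path connected if it is connected. -/
lemma isPathConnected_space (hK : K.faces.Finite) (hc : IsConnected K.space) :
    IsPathConnected K.space := by
  obtain ⟨x, hx⟩ := hc.nonempty
  refine ⟨x, hx, fun {y} hy => ?_⟩
  -- The simplices that can be reached from `x` and the other ones form two closed sets.
  have hface : ∀ s ∈ K.faces, ∀ u ∈ convexHull ℝ (s : Set E), ∀ v ∈ convexHull ℝ (s : Set E),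
      JoinedIn K.space u v := fun s hs u hu v hv =>
    (((convex_convexHull ℝ (s : Set E)).isPathConnected ⟨u, hu⟩).joinedIn u hu v hv).mono
      (convexHull_subset_space hs)
  let A := {s ∈ K.faces | ∀ u ∈ convexHull ℝ (s : Set E), JoinedIn K.space x u}
  let B := {s ∈ K.faces | ∀ u ∈ convexHull ℝ (s : Set E), ¬ JoinedIn K.space x u}
  have hclosed : ∀ C ⊆ K.faces, IsClosed (⋃ s ∈ C, convexHull ℝ (s : Set E)) := fun C hC =>
    (hK.subset hC).isClosed_biUnion fun s _ => (s.finite_toSet.isCompact_convexHull ℝ).isClosed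
  by_contra hxy
  have hmem : ∀ u ∈ K.space, (JoinedIn K.space x u → u ∈ ⋃ s ∈ A, convexHull ℝ (s : Set E)) ∧
      (¬ JoinedIn K.space x u → u ∈ ⋃ s ∈ B, convexHull ℝ (s : Set E)) := by
    intro u hu
    obtain ⟨s, hs, hus⟩ := mem_space_iff.1 hu
    exact ⟨fun h => Set.mem_biUnion (x := s) ⟨hs, fun v hv => h.trans (hface s hs u hus v hv)⟩ hus,
      fun h => Set.mem_biUnion (x := s)
        ⟨hs, fun v hv hj => h (hj.trans (hface s hs v hv u hus))⟩ hus⟩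
  obtain ⟨z, hz, hzA, hzB⟩ := isPreconnected_closed_iff.1 hc.isPreconnected _ _
    (hclosed A fun s hs => hs.1) (hclosed B fun s hs => hs.1)
    (fun u hu => by
      by_cases h : JoinedIn K.space x u
      · exact Or.inl ((hmem u hu).1 h)
      · exact Or.inr ((hmem u hu).2 h))
    ⟨x, hx, (hmem x hx).1 (JoinedIn.refl hx)⟩ ⟨y, hy, (hmem y hy).2 hxy⟩
  obtain ⟨s, hs, hzs⟩ := Set.mem_iUnion₂.1 hzA
  obtain ⟨t, ht, hzt⟩ := Set.mem_iUnion₂.1 hzB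
  exact ht.2 z hzt (hs.2 z hzs)

end Geometry.SimplicialComplex

/-! ### The band inside the tetrahedron -/

/-- The four triangles of the band on the vertices `a, b, c, d, e, f`, numbered from `0` to `5`. -/
def bandTriangles : Finset (Finset (Fin 6)) := {{0, 1, 4}, {1, 4, 5}, {3, 4, 5}, {2, 3, 4}}

/-- The nonempty subsets of the triangles of the band. -/
def IsBandFace (T : Finset (Fin 6)) : Prop := T.Nonempty ∧ ∃ t ∈ bandTriangles, T ⊆ t

instance : DecidablePred IsBandFace := fun T =>
  inferInstanceAs (Decidable (T.Nonempty ∧ ∃ t ∈ bandTriangles, T ⊆ t))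

section BandPoint

variable {E : Type} [NormedAddCommGroup E] [NormedSpace ℝ E]

/-- The vertices `a, b, c, d, e, f` of the band. -/
noncomputable def bandPoint (a b c d : E) : Fin 6 → E :=
  ![a, b, c, d, (1 / 6 : ℝ) • ((2 : ℝ) • a + (1 : ℝ) • b + (2 : ℝ) • c + (1 : ℝ) • d),
    (1 / 6 : ℝ) • ((1 : ℝ) • a + (2 : ℝ) • b + (1 : ℝ) • c + (2 : ℝ) • d)]

variable {a b c d : E}

lemma sum_smul_bandPoint (w : Fin 6 → ℝ) : ∑ i, w i • bandPoint a b c d i =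
    (w 0 + (2 * w 4 + w 5) / 6) • a + (w 1 + (w 4 + 2 * w 5) / 6) • b +
      (w 2 + (2 * w 4 + w 5) / 6) • c + (w 3 + (w 4 + 2 * w 5) / 6) • d := by
  simp only [Fin.sum_univ_six, bandPoint, Matrix.cons_val]
  module

lemma bandCoord_eq_zero (h : AffineIndependent ℝ ![a, b, c, d]) {u : Fin 6 → ℝ}
    (h0 : ∑ i, u i = 0) (h1 : ∑ i, u i • bandPoint a b c d i = 0) :
    u 0 + (2 * u 4 + u 5) / 6 = 0 ∧ u 1 + (u 4 + 2 * u 5) / 6 = 0 ∧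
      u 2 + (2 * u 4 + u 5) / 6 = 0 ∧ u 3 + (u 4 + 2 * u 5) / 6 = 0 := by
  rw [sum_smul_bandPoint] at h1
  have := affineIndependent_iff.1 h Finset.univ ![u 0 + (2 * u 4 + u 5) / 6,
    u 1 + (u 4 + 2 * u 5) / 6, u 2 + (2 * u 4 + u 5) / 6, u 3 + (u 4 + 2 * u 5) / 6]
    (by
      rw [Fin.sum_univ_six] at h0
      simp only [Fin.sum_univ_four, Matrix.cons_val]
      linarith)
    (by
      simp only [Fin.sum_univ_four, Matrix.cons_val]
      exact h1)
  exact ⟨this 0 (Finset.mem_univ _), this 1 (Finset.mem_univ _), this 2 (Finset.mem_univ _),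
    this 3 (Finset.mem_univ _)⟩

lemma bandWeight_eq_zero (h : AffineIndependent ℝ ![a, b, c, d]) {u : Fin 6 → ℝ}
    (h02 : u 0 * u 2 = 0) (h13 : u 1 * u 3 = 0)
    (h0 : ∑ i, u i = 0) (h1 : ∑ i, u i • bandPoint a b c d i = 0) : u = 0 := by
  obtain ⟨e0, e1, e2, e3⟩ := bandCoord_eq_zero h h0 h1
  have u02 : u 0 = u 2 := by linarith
  have u13 : u 1 = u 3 := by linarith
  rw [← u02, mul_self_eq_zero] at h02
  rw [← u13, mul_self_eq_zero] at h13
  funext i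
  fin_cases i <;> simp only [Fin.reduceFinMk, Fin.zero_eta, Fin.mk_one, Pi.zero_apply] <;> linarith

/-- Two nonnegative numbers with product zero are determined by their difference. -/
lemma eq_and_eq_of_mul_eq_zero {x y x' y' : ℝ} (hx : 0 ≤ x) (hy : 0 ≤ y) (hx' : 0 ≤ x')
    (hy' : 0 ≤ y') (h : x * y = 0) (h' : x' * y' = 0) (hd : x - y = x' - y') :
    x = x' ∧ y = y' := by
  rcases mul_eq_zero.1 h with h | h <;> rcases mul_eq_zero.1 h' with h' | h' <;>
    constructor <;> linarith

/-- The triangles of the band meet only in common faces: with `α, β, γ, δ` the barycentric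
coordinates with respect to `a, b, c, d` of a point of the band, the weight of the point at `a` is
the positive part of `α - γ`, the weight at `c` its negative part, and similarly for `b`, `d` and
`β - δ`. -/
lemma bandWeight_unique (h : AffineIndependent ℝ ![a, b, c, d]) {w w' : Fin 6 → ℝ}
    (hw : ∀ i, 0 ≤ w i) (hw' : ∀ i, 0 ≤ w' i) (h02 : w 0 * w 2 = 0) (h13 : w 1 * w 3 = 0)
    (h02' : w' 0 * w' 2 = 0) (h13' : w' 1 * w' 3 = 0) (h1 : ∑ i, w i = ∑ i, w' i)
    (hp : ∑ i, w i • bandPoint a b c d i = ∑ i, w' i • bandPoint a b c d i) : w = w' := by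
  obtain ⟨e0, e1, e2, e3⟩ := bandCoord_eq_zero (u := fun i => w i - w' i) h
    (by rw [Finset.sum_sub_distrib, h1, sub_self])
    (by simp only [sub_smul]; rw [Finset.sum_sub_distrib, hp, sub_self])
  obtain ⟨e00, e22⟩ := eq_and_eq_of_mul_eq_zero (hw 0) (hw 2) (hw' 0) (hw' 2) h02 h02'
    (by linarith)
  obtain ⟨e11, e33⟩ := eq_and_eq_of_mul_eq_zero (hw 1) (hw 3) (hw' 1) (hw' 3) h13 h13'
    (by linarith)
  funext i
  fin_cases i <;> simp only [Fin.reduceFinMk, Fin.zero_eta, Fin.mk_one] <;> linarith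

lemma bandPoint_injective (h : AffineIndependent ℝ ![a, b, c, d]) :
    Function.Injective (bandPoint a b c d) := by
  have h0 : ∀ i j : Fin 6, 0 ≤ (Pi.single i 1 : Fin 6 → ℝ) j := fun i j => by
    rw [Pi.single_apply]; split_ifs <;> norm_num
  have h2 : ∀ i j k : Fin 6, j ≠ k →
      (Pi.single i 1 : Fin 6 → ℝ) j * (Pi.single i 1 : Fin 6 → ℝ) k = 0 := fun i j k hjk => by
    simp only [Pi.single_apply, mul_ite, mul_one, mul_zero]
    split_ifs with hk hj
    exacts [(hjk (hj.trans hk.symm)).elim, rfl, rfl]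
  intro i j hij
  have := bandWeight_unique h (h0 i) (h0 j) (h2 i 0 2 (by decide)) (h2 i 1 3 (by decide))
    (h2 j 0 2 (by decide)) (h2 j 1 3 (by decide)) (by simp) (by simp [Pi.single_apply, hij])
  by_contra hne
  have hi := congrFun this i
  rw [Pi.single_eq_same, Pi.single_eq_of_ne hne] at hi
  exact one_ne_zero hi

end BandPoint

lemma IsBandFace.mono {S T : Finset (Fin 6)} (hT : IsBandFace T) (hST : S ⊆ T)
    (hS : S.Nonempty) : IsBandFace S :=
  ⟨hS, hT.2.imp fun _ ht => ⟨ht.1, hST.trans ht.2⟩⟩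

lemma isBandFace_of_mem {T : Finset (Fin 6)} (hT : T ∈ bandTriangles) :
    IsBandFace T ∧ T.card = 3 := by
  revert T; decide

lemma IsBandFace.mem_of_card {T : Finset (Fin 6)} (hT : IsBandFace T) (h : T.card = 3) :
    T ∈ bandTriangles := by
  revert T; decide

lemma exists_corner_of_mem {T : Finset (Fin 6)} (hT : T ∈ bandTriangles) :
    ∃ i ∈ T, i ≠ 4 ∧ i ≠ 5 := by
  revert T; decide

lemma IsBandFace.card_filter_le {T : Finset (Fin 6)} (hT : IsBandFace T) (h : T.card = 2) :
    (bandTriangles.filter (T ⊆ ·)).card ≤ 2 := by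
  revert T; decide

lemma IsBandFace.zero_notMem_or {T : Finset (Fin 6)} (hT : IsBandFace T) :
    (0 ∉ T ∨ 2 ∉ T) ∧ (1 ∉ T ∨ 3 ∉ T) := by
  revert T; decide

set_option maxRecDepth 4000 in
lemma IsBandFace.not_left_and_right {T : Finset (Fin 6)} (hT : IsBandFace T)
    (h45 : ∃ i ∈ ({4, 5} : Finset (Fin 6)), i ∈ T) (h01 : ∃ i ∈ ({0, 1} : Finset (Fin 6)), i ∈ T) :
    ¬ ∃ i ∈ ({2, 3} : Finset (Fin 6)), i ∈ T := by
  revert T; decide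

lemma IsBandFace.subset_of_notMem {T : Finset (Fin 6)} (hT : IsBandFace T) (h4 : 4 ∉ T)
    (h5 : 5 ∉ T) : T ⊆ {0, 1} ∨ T ⊆ {2, 3} := by
  revert T; decide

namespace Geometry.SimplicialComplex

variable {E : Type} [NormedAddCommGroup E] [NormedSpace ℝ E]

open Classical in
/-- The hypotheses under which a band can be attached to `K` inside the tetrahedron `abcd`: `ab`
and `cd` are edges of `K`, and the open tetrahedron does not meet `K`. -/
structure HandleSite (K : SimplicialComplex ℝ E) (a b c d : E) : Prop where
  indep : AffineIndependent ℝ ![a, b, c, d]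
  left : {a, b} ∈ K.faces
  right : {c, d} ∈ K.faces
  notMem : ∀ α β γ δ : ℝ, 0 < α → 0 < β → 0 < γ → 0 < δ → α + β + γ + δ = 1 →
    α • a + β • b + γ • c + δ • d ∉ K.space

namespace HandleSite

variable {K : SimplicialComplex ℝ E} {a b c d : E} (h : K.HandleSite a b c d)

/-- The vertices of the band as an embedding. -/
noncomputable def emb : Fin 6 ↪ E := ⟨bandPoint a b c d, bandPoint_injective h.indep⟩

lemma emb_apply (i : Fin 6) : h.emb i = bandPoint a b c d i := rfl

lemma affineIndependent_face {T : Finset (Fin 6)} (hT : IsBandFace T) :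
    AffineIndependent ℝ fun i : T => h.emb i := by
  rw [affineIndependent_iff]
  intro s w h0 h1 i hi
  let u : Fin 6 → ℝ := fun j => if hj : j ∈ T then (if ⟨j, hj⟩ ∈ s then w ⟨j, hj⟩ else 0) else 0
  have hu : ∀ j : T, u j = if j ∈ s then w j else 0 := fun j => dif_pos j.2
  have hu0 : ∀ j, j ∉ T → u j = 0 := fun j hj => dif_neg hj
  have hsum : ∑ j, u j = 0 := by
    rw [← Finset.sum_subset (Finset.subset_univ T) fun j _ hj => hu0 j hj,
      ← Finset.sum_coe_sort T u, Finset.sum_congr rfl fun j _ => hu j, Finset.sum_ite_mem,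
      Finset.univ_inter, h0]
  have hsmul : ∑ j, u j • bandPoint a b c d j = 0 := by
    rw [← Finset.sum_subset (Finset.subset_univ T) fun j _ hj => by rw [hu0 j hj, zero_smul],
      ← Finset.sum_coe_sort T fun j => u j • bandPoint a b c d j,
      Finset.sum_congr rfl fun j _ => by rw [hu j, ite_smul, zero_smul], Finset.sum_ite_mem,
      Finset.univ_inter]
    exact h1
  obtain ⟨h02, h13⟩ := hT.zero_notMem_or
  have := congrFun (bandWeight_eq_zero h.indep (mul_eq_zero.2 (h02.imp (hu0 _) (hu0 _)))
    (mul_eq_zero.2 (h13.imp (hu0 _) (hu0 _))) hsum hsmul) i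
  rwa [hu i, if_pos hi] at this

lemma sum_of_isWeight {T : Finset (Fin 6)} {w : E → ℝ} {x : E} (hw : IsWeight (T.map h.emb) w x) :
    ∑ i, w (h.emb i) = 1 ∧ ∑ i, w (h.emb i) • bandPoint a b c d i = x := by
  have h0 : ∀ i ∈ Finset.univ, i ∉ T → w (h.emb i) = 0 := fun i _ hi =>
    hw.eq_zero _ (by simpa using hi)
  constructor
  · rw [← hw.sum_eq, Finset.sum_map]
    exact (Finset.sum_subset (Finset.subset_univ T) h0).symm
  · rw [← hw.sum_smul, Finset.sum_map]
    refine (Finset.sum_subset (Finset.subset_univ T) fun i hi hiT => ?_).symm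
    rw [h0 i hi hiT, zero_smul]

lemma mul_eq_zero_of_isWeight {T : Finset (Fin 6)} (hT : IsBandFace T) {w : E → ℝ} {x : E}
    (hw : IsWeight (T.map h.emb) w x) :
    w (h.emb 0) * w (h.emb 2) = 0 ∧ w (h.emb 1) * w (h.emb 3) = 0 := by
  have h0 : ∀ i, i ∉ T → w (h.emb i) = 0 := fun i hi => hw.eq_zero _ (by simpa using hi)
  obtain ⟨h02, h13⟩ := hT.zero_notMem_or
  exact ⟨mul_eq_zero.2 (h02.imp (h0 _) (h0 _)), mul_eq_zero.2 (h13.imp (h0 _) (h0 _))⟩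

lemma isWeight_unique {S T : Finset (Fin 6)} (hS : IsBandFace S) (hT : IsBandFace T)
    {w w' : E → ℝ} {x : E} (hw : IsWeight (S.map h.emb) w x) (hw' : IsWeight (T.map h.emb) w' x) :
    w = w' := by
  obtain ⟨h1, hx⟩ := h.sum_of_isWeight hw
  obtain ⟨h1', hx'⟩ := h.sum_of_isWeight hw'
  obtain ⟨h02, h13⟩ := h.mul_eq_zero_of_isWeight hS hw
  obtain ⟨h02', h13'⟩ := h.mul_eq_zero_of_isWeight hT hw'
  have := bandWeight_unique h.indep (w := fun i => w (h.emb i)) (w' := fun i => w' (h.emb i))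
    (fun i => hw.nonneg _) (fun i => hw'.nonneg _) h02 h13 h02' h13'
    (h1.trans h1'.symm) (hx.trans hx'.symm)
  funext v
  by_cases hv : ∃ i, h.emb i = v
  · obtain ⟨i, rfl⟩ := hv
    exact congrFun this i
  · rw [hw.eq_zero v, hw'.eq_zero v]
    all_goals
      intro hv'
      obtain ⟨i, -, hi⟩ := Finset.mem_map.1 hv'
      exact hv ⟨i, hi⟩

/-- The points of the band outside the segments `ab` and `cd` lie in the open tetrahedron. -/
lemma notMem_space_of_isWeight {T : Finset (Fin 6)} {w : E → ℝ} {x : E}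
    (hw : IsWeight (T.map h.emb) w x) (h45 : 0 < w (h.emb 4) ∨ 0 < w (h.emb 5)) : x ∉ K.space := by
  obtain ⟨h1, rfl⟩ := h.sum_of_isWeight hw
  rw [sum_smul_bandPoint (fun i => w (h.emb i))]
  rw [Fin.sum_univ_six] at h1
  have h0 := fun i => hw.nonneg (h.emb i)
  have e0 := h0 0
  have e1 := h0 1
  have e2 := h0 2
  have e3 := h0 3
  have e4 := h0 4
  have e5 := h0 5
  refine h.notMem _ _ _ _ ?_ ?_ ?_ ?_ ?_
  · rcases h45 with h | h <;> linarith
  · rcases h45 with h | h <;> linarith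
  · rcases h45 with h | h <;> linarith
  · rcases h45 with h | h <;> linarith
  · linarith

lemma map_mem_faces {T : Finset (Fin 6)} (hT : T.Nonempty) (h' : T ⊆ {0, 1} ∨ T ⊆ {2, 3}) :
    T.map h.emb ∈ K.faces := by
  classical
  rcases h' with h' | h'
  · refine K.down_closed h.left (fun v hv => ?_) (Finset.map_nonempty.2 hT)
    obtain ⟨i, hi, rfl⟩ := Finset.mem_map.1 hv
    rcases Finset.mem_insert.1 (h' hi) with rfl | hi
    · exact Finset.mem_insert_self _ _
    · rw [Finset.mem_singleton.1 hi]
      exact Finset.mem_insert_of_mem (Finset.mem_singleton_self _)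
  · refine K.down_closed h.right (fun v hv => ?_) (Finset.map_nonempty.2 hT)
    obtain ⟨i, hi, rfl⟩ := Finset.mem_map.1 hv
    rcases Finset.mem_insert.1 (h' hi) with rfl | hi
    · exact Finset.mem_insert_self _ _
    · rw [Finset.mem_singleton.1 hi]
      exact Finset.mem_insert_of_mem (Finset.mem_singleton_self _)

/-- A point of the band that lies on `K` lies in a face of the band that is a face of `K`. -/
lemma exists_face_of_mem_space {T : Finset (Fin 6)} (hT : IsBandFace T) {x : E}
    (hx : x ∈ convexHull ℝ (T.map h.emb : Set E)) (hxK : x ∈ K.space) :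
    ∃ S ⊆ T, S.map h.emb ∈ K.faces ∧ x ∈ convexHull ℝ (S.map h.emb : Set E) := by
  classical
  obtain ⟨w, hw⟩ := exists_isWeight hx
  have h4 : w (h.emb 4) = 0 := by
    by_contra hne
    exact h.notMem_space_of_isWeight hw (Or.inl (lt_of_le_of_ne (hw.nonneg _) (Ne.symm hne))) hxK
  have h5 : w (h.emb 5) = 0 := by
    by_contra hne
    exact h.notMem_space_of_isWeight hw (Or.inr (lt_of_le_of_ne (hw.nonneg _) (Ne.symm hne))) hxK
  let S := (T.erase 4).erase 5
  have hST : S ⊆ T := (Finset.erase_subset _ _).trans (Finset.erase_subset _ _)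
  have hwS : IsWeight (S.map h.emb) w x := by
    refine hw.of_subset (Finset.map_subset_map.2 hST) fun v hv => ?_
    by_cases hvT : v ∈ T.map h.emb
    · obtain ⟨i, hi, rfl⟩ := Finset.mem_map.1 hvT
      have : i = 4 ∨ i = 5 := by
        by_contra! hne
        exact hv (Finset.mem_map_of_mem _ (Finset.mem_erase.2 ⟨hne.2, Finset.mem_erase.2
          ⟨hne.1, hi⟩⟩))
      rcases this with rfl | rfl
      exacts [h4, h5]
    · exact hw.eq_zero v hvT
  have hS : S.Nonempty := by
    rw [Finset.nonempty_iff_ne_empty]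
    intro he
    have := hwS.sum_eq
    rw [he, Finset.map_empty, Finset.sum_empty] at this
    exact zero_ne_one this
  refine ⟨S, hST, h.map_mem_faces hS ((hT.mono hST hS).subset_of_notMem ?_ ?_), hwS.mem_convexHull⟩
  · simp [S]
  · simp [S]

/-- The complex `K` together with the band on the vertices `a, b, c, d, e, f`. -/
noncomputable def complex : SimplicialComplex ℝ E where
  faces := {s | s ∈ K.faces ∨ ∃ T, IsBandFace T ∧ T.map h.emb = s}
  isRelLowerSet_faces := by
    classical
    rintro s (hs | ⟨T, hT, rfl⟩)
    · exact ⟨nonempty_of_mem_faces hs, fun t hts ht => Or.inl (K.down_closed hs hts ht)⟩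
    · refine ⟨Finset.map_nonempty.2 hT.1, fun t hts ht => Or.inr ?_⟩
      obtain ⟨S, hS, rfl⟩ := Finset.subset_map_iff.1 hts
      exact ⟨S, hT.mono hS (Finset.map_nonempty.1 ht), rfl⟩
  indep := by
    rintro s (hs | ⟨T, hT, rfl⟩)
    · exact K.indep hs
    · have hcoe : ((T.map h.emb : Finset E) : Set E) = Set.range fun i : T => h.emb i := by
        ext v
        simp
      have := (h.affineIndependent_face hT).range
      rw [← hcoe] at this
      exact this
  inter_subset_convexHull := by
    classical
    have hKT : ∀ s ∈ K.faces, ∀ T, IsBandFace T →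
        convexHull ℝ (s : Set E) ∩ convexHull ℝ (T.map h.emb : Set E) ⊆
          convexHull ℝ (s ∩ T.map h.emb : Set E) := by
      rintro s hs T hT x ⟨hxs, hxT⟩
      obtain ⟨S, hST, hS, hxS⟩ := h.exists_face_of_mem_space hT hxT
        (convexHull_subset_space hs hxs)
      refine convexHull_mono (Set.inter_subset_inter_right _ ?_)
        (K.inter_subset_convexHull hs hS ⟨hxs, hxS⟩)
      exact Finset.coe_subset.2 (Finset.map_subset_map.2 hST)
    rintro s t (hs | ⟨S, hS, rfl⟩) (ht | ⟨T, hT, rfl⟩)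
    · exact K.inter_subset_convexHull hs ht
    · exact hKT s hs T hT
    · rw [Set.inter_comm, Set.inter_comm (S.map h.emb : Set E)]
      exact hKT t ht S hS
    · rintro x ⟨hxS, hxT⟩
      obtain ⟨w, hw⟩ := exists_isWeight hxS
      obtain ⟨w', hw'⟩ := exists_isWeight hxT
      obtain rfl := h.isWeight_unique hS hT hw hw'
      rw [← Finset.coe_inter]
      refine (hw.of_subset Finset.inter_subset_left fun v hv => ?_).mem_convexHull
      by_cases hvS : v ∈ S.map h.emb
      · exact hw'.eq_zero v fun hvT => hv (Finset.mem_inter.2 ⟨hvS, hvT⟩)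
      · exact hw.eq_zero v hvS

end HandleSite

end Geometry.SimplicialComplex

/-! ### The complex with the band attached -/

namespace Geometry.SimplicialComplex.HandleSite

section Complex

variable {E : Type} [NormedAddCommGroup E] [NormedSpace ℝ E]
  {K : SimplicialComplex ℝ E} {a b c d : E} (h : K.HandleSite a b c d)

lemma le_complex : K ≤ h.complex := fun _ hs => Or.inl hs

lemma band_mem_faces {T : Finset (Fin 6)} (hT : IsBandFace T) : T.map h.emb ∈ h.complex.faces :=
  Or.inr ⟨T, hT, rfl⟩

lemma finite_complex (hK : K.faces.Finite) : h.complex.faces.Finite := by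
  refine hK.union ((Set.toFinite {T | IsBandFace T}).image fun T => T.map h.emb) |>.subset ?_
  rintro s (hs | ⟨T, hT, rfl⟩)
  exacts [Or.inl hs, Or.inr ⟨T, hT, rfl⟩]

lemma segment_subset_space (h : K.HandleSite a b c d) :
    segment ℝ a b ⊆ K.space ∧ segment ℝ c d ⊆ K.space := by
  classical
  have h₀ := convexHull_subset_space h.left
  have h₁ := convexHull_subset_space h.right
  rw [Finset.coe_pair, convexHull_pair] at h₀ h₁
  exact ⟨h₀, h₁⟩

lemma emb_notMem_space {i : Fin 6} (hi : i = 4 ∨ i = 5) : h.emb i ∉ K.space := by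
  classical
  have hw : IsWeight (({i} : Finset (Fin 6)).map h.emb) (Pi.single (h.emb i) 1) (h.emb i) := by
    rw [Finset.map_singleton]
    exact isWeight_singleton _
  refine h.notMem_space_of_isWeight hw ?_
  rcases hi with rfl | rfl
  · exact Or.inl (by rw [Pi.single_eq_same]; exact one_pos)
  · exact Or.inr (by rw [Pi.single_eq_same]; exact one_pos)

lemma subset_of_map_mem_faces {T : Finset (Fin 6)} (hT : IsBandFace T)
    (hTK : T.map h.emb ∈ K.faces) : T ⊆ {0, 1} ∨ T ⊆ {2, 3} := by
  have hi : ∀ i, i = 4 ∨ i = 5 → i ∉ T := fun i hi hiT => h.emb_notMem_space hi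
    (K.subset_space hTK (Finset.mem_coe.2 (Finset.mem_map_of_mem _ hiT)))
  exact hT.subset_of_notMem (hi 4 (Or.inl rfl)) (hi 5 (Or.inr rfl))

lemma emb_mem_vertices {i : Fin 6} (hi : i ≠ 4 ∧ i ≠ 5) : h.emb i ∈ K.vertices := by
  have : ({i} : Finset (Fin 6)).map h.emb ∈ K.faces :=
    h.map_mem_faces (Finset.singleton_nonempty i) (by revert i; decide)
  rwa [Finset.map_singleton] at this

lemma vertices_complex : h.complex.vertices = K.vertices ∪ {h.emb 4, h.emb 5} := by
  ext v
  constructor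
  · rintro (hv | ⟨T, hT, hTv⟩)
    · exact Or.inl hv
    · obtain ⟨i, rfl⟩ : ∃ i, T = {i} :=
        Finset.card_eq_one.1 (by rw [← Finset.card_map h.emb, hTv, Finset.card_singleton])
      obtain rfl : h.emb i = v := by simpa using hTv
      by_cases hi : i ≠ 4 ∧ i ≠ 5
      · exact Or.inl (h.emb_mem_vertices hi)
      · obtain rfl | rfl : i = 4 ∨ i = 5 := by tauto
        exacts [Or.inr (Or.inl rfl), Or.inr (Or.inr rfl)]
  · rintro (hv | rfl | rfl)
    · exact Or.inl hv
    · exact Or.inr ⟨{4}, by decide, by simp⟩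
    · exact Or.inr ⟨{5}, by decide, by simp⟩

lemma emb_mem_convexHull (i : Fin 6) : h.emb i ∈ convexHull ℝ ({a, b, c, d} : Set E) := by
  classical
  have h0 : ∀ p ∈ ({a, b, c, d} : Set E), p ∈ convexHull ℝ ({a, b, c, d} : Set E) :=
    fun p hp => subset_convexHull ℝ _ hp
  have ha := h0 a (by simp)
  have hb := h0 b (by simp)
  have hc := h0 c (by simp)
  have hd := h0 d (by simp)
  have hcomb : ∀ α β γ δ : ℝ, 0 ≤ α → 0 ≤ β → 0 ≤ γ → 0 ≤ δ → α + β + γ + δ = 1 →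
      α • a + β • b + γ • c + δ • d ∈ convexHull ℝ ({a, b, c, d} : Set E) := by
    intro α β γ δ hα hβ hγ hδ h1
    have := (convex_convexHull ℝ ({a, b, c, d} : Set E)).sum_mem (t := Finset.univ)
      (w := ![α, β, γ, δ]) (z := ![a, b, c, d])
      (by intro i _; fin_cases i <;> simpa)
      (by simpa [Fin.sum_univ_four] using h1)
      (by intro i _; fin_cases i <;> assumption)
    simpa [Fin.sum_univ_four] using this
  fin_cases i
  · exact ha
  · exact hb
  · exact hc
  · exact hd
  · have := hcomb (2 / 6) (1 / 6) (2 / 6) (1 / 6) (by norm_num) (by norm_num) (by norm_num)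
      (by norm_num) (by norm_num)
    convert this using 1
    simp only [emb_apply, bandPoint, Fin.reduceFinMk, Matrix.cons_val]
    module
  · have := hcomb (1 / 6) (2 / 6) (1 / 6) (2 / 6) (by norm_num) (by norm_num) (by norm_num)
      (by norm_num) (by norm_num)
    convert this using 1
    simp only [emb_apply, bandPoint, Fin.reduceFinMk, Matrix.cons_val]
    module

lemma space_complex_subset : h.complex.space ⊆ K.space ∪ convexHull ℝ {a, b, c, d} := by
  intro x hx
  obtain ⟨s, hs | ⟨T, hT, rfl⟩, hxs⟩ := mem_space_iff.1 hx
  · exact Or.inl (convexHull_subset_space hs hxs)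
  · refine Or.inr (convexHull_min (fun v hv => ?_) (convex_convexHull ℝ _) hxs)
    obtain ⟨i, -, rfl⟩ := Finset.mem_map.1 (Finset.mem_coe.1 hv)
    exact h.emb_mem_convexHull i

lemma isConnected_complex (hc : IsConnected K.space) : IsConnected h.complex.space := by
  have hb : h.emb 1 ∈ K.space := K.subset_space h.left (by classical simp [emb_apply, bandPoint])
  refine ⟨⟨h.emb 1, space_mono h.le_complex hb⟩, isPreconnected_of_forall (h.emb 1) fun x hx => ?_⟩
  obtain ⟨s, hs | ⟨T, hT, rfl⟩, hxs⟩ := mem_space_iff.1 hx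
  · exact ⟨K.space, space_mono h.le_complex, hb, convexHull_subset_space hs hxs, hc.isPreconnected⟩
  · obtain ⟨-, t, ht, hTt⟩ := hT
    obtain ⟨i, hit, hi⟩ := exists_corner_of_mem ht
    refine ⟨K.space ∪ convexHull ℝ (t.map h.emb : Set E), Set.union_subset
      (space_mono h.le_complex)
      (convexHull_subset_space (h.band_mem_faces (isBandFace_of_mem ht).1)), Or.inl hb,
      Or.inr (convexHull_mono (Finset.coe_subset.2 (Finset.map_subset_map.2 hTt)) hxs), ?_⟩
    refine hc.isPreconnected.union' ⟨h.emb i, ?_, ?_⟩ (convex_convexHull ℝ _).isPreconnected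
    · exact K.subset_space (h.emb_mem_vertices hi) (by simp)
    · exact subset_convexHull ℝ _ (by simpa using hit)

end Complex

variable {n : ℕ} {K : SimplicialComplex ℝ (EuclideanSpace ℝ (Fin n))}
  {a b c d : EuclideanSpace ℝ (Fin n)} (h : K.HandleSite a b c d)

/-! ### Triangles and links -/

lemma trianglesContaining_complex (s : Finset (EuclideanSpace ℝ (Fin n))) :
    trianglesContaining h.complex s = trianglesContaining K s ∪
      {t | ∃ T ∈ bandTriangles, T.map h.emb = t ∧ s ⊆ t} := by
  ext t
  constructor
  · rintro ⟨ht | ⟨T, hT, rfl⟩, h3, hst⟩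
    · exact Or.inl ⟨ht, h3, hst⟩
    · exact Or.inr ⟨T, hT.mem_of_card (by rwa [Finset.card_map] at h3), rfl, hst⟩
  · rintro (ht | ⟨T, hT, rfl, hst⟩)
    · exact ⟨Or.inl ht.1, ht.2⟩
    · obtain ⟨hT', h3⟩ := isBandFace_of_mem hT
      exact ⟨Or.inr ⟨T, hT', rfl⟩, by rwa [Finset.card_map], hst⟩

lemma setOf_bandTriangles_map (S : Finset (Fin 6)) :
    {t | ∃ T ∈ bandTriangles, T.map h.emb = t ∧ S.map h.emb ⊆ t} =
      (fun T => T.map h.emb) '' (bandTriangles.filter (S ⊆ ·) : Set (Finset (Fin 6))) := by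
  ext t
  constructor
  · rintro ⟨T, hT, rfl, hST⟩
    exact ⟨T, by simpa using ⟨hT, Finset.map_subset_map.1 hST⟩, rfl⟩
  · rintro ⟨T, hT, rfl⟩
    have hT' : T ∈ bandTriangles ∧ S ⊆ T := by simpa using hT
    exact ⟨T, hT'.1, rfl, Finset.map_subset_map.2 hT'.2⟩

lemma ncard_bandTriangles (S : Finset (Fin 6)) :
    {t | ∃ T ∈ bandTriangles, T.map h.emb = t ∧ S.map h.emb ⊆ t}.ncard =
      (bandTriangles.filter (S ⊆ ·)).card := by
  rw [setOf_bandTriangles_map, Set.ncard_image_of_injective _ (Finset.map_injective _),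
    Set.ncard_coe_finset]

/-- An edge of `K` that lies in a triangle of the band is `ab` or `cd`. -/
lemma exists_eq_map_of_edge {s : Finset (EuclideanSpace ℝ (Fin n))} (hs : s ∈ K.faces)
    (hs2 : s.card = 2) {T : Finset (Fin 6)} (hT : T ∈ bandTriangles) (hsT : s ⊆ T.map h.emb) :
    s = ({0, 1} : Finset (Fin 6)).map h.emb ∨ s = ({2, 3} : Finset (Fin 6)).map h.emb := by
  classical
  obtain ⟨S, hST, rfl⟩ := Finset.subset_map_iff.1 hsT
  have hS : S ⊆ {0, 1} ∨ S ⊆ {2, 3} :=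
    h.subset_of_map_mem_faces ⟨Finset.map_nonempty.1 (nonempty_of_mem_faces hs), T, hT, hST⟩ hs
  rw [Finset.card_map] at hs2
  rcases hS with hS | hS
  · exact Or.inl (by rw [Finset.eq_of_subset_of_card_le hS (by rw [hs2]; decide)])
  · exact Or.inr (by rw [Finset.eq_of_subset_of_card_le hS (by rw [hs2]; decide)])

lemma trianglesContaining_eq_of_edge {s : Finset (EuclideanSpace ℝ (Fin n))} (hs : s ∈ K.faces)
    (hs2 : s.card = 2) (h01 : s ≠ ({0, 1} : Finset (Fin 6)).map h.emb)
    (h23 : s ≠ ({2, 3} : Finset (Fin 6)).map h.emb) :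
    trianglesContaining h.complex s = trianglesContaining K s := by
  rw [trianglesContaining_complex, Set.union_eq_left]
  rintro t ⟨T, hT, rfl, hst⟩
  rcases h.exists_eq_map_of_edge hs hs2 hT hst with h' | h'
  exacts [(h01 h').elim, (h23 h').elim]

lemma trianglesContaining_eq_of_notMem {s : Finset (EuclideanSpace ℝ (Fin n))} (hs : s ∉ K.faces)
    (hne : s.Nonempty) : trianglesContaining h.complex s =
      {t | ∃ T ∈ bandTriangles, T.map h.emb = t ∧ s ⊆ t} := by
  rw [trianglesContaining_complex, Set.union_eq_right]
  rintro t ⟨ht, -, hst⟩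
  exact (hs (K.down_closed ht hst hne)).elim

lemma ncard_trianglesContaining_complex (hK : IsPolyhedralSurface K)
    (hab : IsBoundaryEdge K (({0, 1} : Finset (Fin 6)).map h.emb))
    (hcd : IsBoundaryEdge K (({2, 3} : Finset (Fin 6)).map h.emb))
    {s : Finset (EuclideanSpace ℝ (Fin n))} (hs : s ∈ h.complex.faces) (hs2 : s.card = 2) :
    (trianglesContaining h.complex s).ncard ≤ 2 := by
  have hbd : ∀ S : Finset (Fin 6), IsBoundaryEdge K (S.map h.emb) →
      (bandTriangles.filter (S ⊆ ·)).card ≤ 1 →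
      (trianglesContaining h.complex (S.map h.emb)).ncard ≤ 2 := by
    intro S hS hc
    rw [trianglesContaining_complex]
    refine (Set.ncard_union_le _ _).trans ?_
    rw [h.ncard_bandTriangles]
    obtain ⟨t, ht, huniq⟩ := hS.2.2
    have : trianglesContaining K (S.map h.emb) = {t} :=
      Set.eq_singleton_iff_unique_mem.2 ⟨ht, huniq⟩
    rw [this, Set.ncard_singleton]
    omega
  by_cases h01 : s = ({0, 1} : Finset (Fin 6)).map h.emb
  · subst h01
    exact hbd _ hab (by decide)
  by_cases h23 : s = ({2, 3} : Finset (Fin 6)).map h.emb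
  · subst h23
    exact hbd _ hcd (by decide)
  by_cases hsK : s ∈ K.faces
  · rw [h.trianglesContaining_eq_of_edge hsK hs2 h01 h23]
    exact hK.edge s hsK hs2
  · rw [h.trianglesContaining_eq_of_notMem hsK (Finset.card_pos.1 (by omega))]
    obtain ⟨T, hT, rfl⟩ := hs.resolve_left hsK
    rw [h.ncard_bandTriangles]
    exact hT.card_filter_le (by rwa [Finset.card_map] at hs2)

/-- In the link of a vertex of the band, the neighbours in the band have distance at most two from
a fixed neighbour. -/
lemma exists_bandLink_base (i : Fin 6) : ∃ j : Fin 6, j ≠ i ∧ IsBandFace {i, j} ∧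
    ((i ≠ 4 ∧ i ≠ 5) → ({i, j} : Finset (Fin 6)) ⊆ {0, 1} ∨ ({i, j} : Finset (Fin 6)) ⊆ {2, 3}) ∧
    ∀ k : Fin 6, k ≠ i → IsBandFace {i, k} → ∃ m : Fin 6, m ≠ i ∧ IsBandFace {i, m} ∧
      (m = j ∨ IsBandFace {i, j, m}) ∧ (k = m ∨ IsBandFace {i, m, k}) := by
  revert i
  decide

open Classical in
lemma link_complex (hK : IsPolyhedralSurface K) {v : EuclideanSpace ℝ (Fin n)}
    (hv : v ∈ h.complex.vertices) : (linkGraph h.complex v).Connected := by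
  -- The link in `K` maps to the link in the new complex.
  have hold : ∀ v : EuclideanSpace ℝ (Fin n), v ∈ K.vertices →
      ∀ (w w' : EuclideanSpace ℝ (Fin n)) (hw : w ≠ v ∧ {v, w} ∈ K.faces)
        (hw' : w' ≠ v ∧ {v, w'} ∈ K.faces),
        (linkGraph h.complex v).Reachable ⟨w, hw.1, Or.inl hw.2⟩ ⟨w', hw'.1, Or.inl hw'.2⟩ := by
    intro v hv w w' hw hw'
    let φ : linkGraph K v →g linkGraph h.complex v :=
      ⟨fun w => ⟨w.1, w.2.1, Or.inl w.2.2⟩,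
        fun h' => ⟨fun he => h'.1 (Subtype.ext (congrArg (fun w => w.1) he)), Or.inl h'.2⟩⟩
    exact ((hK.link v hv).preconnected ⟨w, hw⟩ ⟨w', hw'⟩).map φ
  have hmap : ∀ i j : Fin 6, ({i, j} : Finset (Fin 6)).map h.emb = {h.emb i, h.emb j} :=
    fun i j => by rw [Finset.map_insert, Finset.map_singleton]
  rw [SimpleGraph.connected_iff_exists_forall_reachable]
  by_cases hvi : ∃ i, h.emb i = v
  · obtain ⟨i, rfl⟩ := hvi
    obtain ⟨j, hji, hj, hjK, hjm⟩ := exists_bandLink_base i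
    have hvert : ∀ m : Fin 6, m ≠ i → IsBandFace {i, m} →
        h.emb m ≠ h.emb i ∧ {h.emb i, h.emb m} ∈ h.complex.faces := fun m hm hmf =>
      ⟨fun he => hm (h.emb.injective he), by rw [← hmap]; exact h.band_mem_faces hmf⟩
    -- Neighbours that span a triangle of the band are joined in the link.
    have hadj : ∀ (k m : Fin 6) (hk : k ≠ i) (hm : m ≠ i) (hkf : IsBandFace {i, k})
        (hmf : IsBandFace {i, m}), k = m ∨ IsBandFace {i, k, m} →
        (linkGraph h.complex (h.emb i)).Reachable ⟨h.emb k, hvert k hk hkf⟩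
          ⟨h.emb m, hvert m hm hmf⟩ := by
      intro k m hk hm hkf hmf hkm
      by_cases hkm' : k = m
      · subst hkm'
        exact SimpleGraph.Reachable.refl _
      · refine SimpleGraph.Adj.reachable
          ⟨fun he => hkm' (h.emb.injective (Subtype.ext_iff.1 he)), ?_⟩
        have := h.band_mem_faces (hkm.resolve_left hkm')
        rwa [Finset.map_insert, Finset.map_insert, Finset.map_singleton] at this
    refine ⟨⟨h.emb j, hvert j hji hj⟩, ?_⟩
    rintro ⟨w, hwi, hw⟩
    obtain hwK | ⟨T, hT, hTw⟩ := id hw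
    · have hiK : i ≠ 4 ∧ i ≠ 5 := by
        by_contra hne
        exact h.emb_notMem_space (i := i) (by tauto) (K.subset_space hwK (by simp))
      have hijK : {h.emb i, h.emb j} ∈ K.faces := by
        rw [← hmap]
        exact h.map_mem_faces hj.1 (hjK hiK)
      exact hold _ (h.emb_mem_vertices hiK) _ _ ⟨(hvert j hji hj).1, hijK⟩ ⟨hwi, hwK⟩
    · obtain ⟨k, hkT, rfl⟩ : ∃ k ∈ T, h.emb k = w := by
        have : w ∈ T.map h.emb := by rw [hTw]; simp
        simpa using this
      have hki : k ≠ i := fun he => hwi (by rw [he])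
      rw [← hmap, Finset.map_inj] at hTw
      subst hTw
      obtain ⟨m, hmi, hm, hmj, hkm⟩ := hjm k hki hT
      refine (hadj j m hji hmi hj hm (hmj.imp_left Eq.symm)).trans
        (hadj m k hmi hki hm hT (hkm.imp_left Eq.symm))
  · have hvT : ∀ T : Finset (Fin 6), v ∉ T.map h.emb := fun T hT => by
      obtain ⟨i, -, hi⟩ := Finset.mem_map.1 hT
      exact hvi ⟨i, hi⟩
    have hvK : v ∈ K.vertices := by
      rcases hv with hv | ⟨T, -, hT⟩
      · exact hv
      · exact (hvT T (by rw [hT]; simp)).elim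
    obtain ⟨⟨w₀, hw₀⟩⟩ := (hK.link v hvK).nonempty
    refine ⟨⟨w₀, hw₀.1, Or.inl hw₀.2⟩, ?_⟩
    rintro ⟨w, hwi, hwK | ⟨T, hT, hTw⟩⟩
    · exact hold v hvK _ _ hw₀ ⟨hwi, hwK⟩
    · exact (hvT T (by rw [hTw]; simp)).elim

lemma isPolyhedralSurface_complex (hK : IsPolyhedralSurface K)
    (hab : IsBoundaryEdge K (({0, 1} : Finset (Fin 6)).map h.emb))
    (hcd : IsBoundaryEdge K (({2, 3} : Finset (Fin 6)).map h.emb)) :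
    IsPolyhedralSurface h.complex where
  finite := h.finite_complex hK.finite
  connected := h.isConnected_complex hK.connected
  pure := by
    rintro s (hs | ⟨T, ⟨-, t, ht, hTt⟩, rfl⟩)
    · obtain ⟨t, ht, h'⟩ := hK.pure s hs
      exact ⟨t, Or.inl ht, h'⟩
    · obtain ⟨ht', h3⟩ := isBandFace_of_mem ht
      exact ⟨t.map h.emb, h.band_mem_faces ht', by rwa [Finset.card_map],
        Finset.map_subset_map.2 hTt⟩
  edge _ hs hs2 := h.ncard_trianglesContaining_complex hK hab hcd hs hs2
  link _ hv := h.link_complex hK hv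

/-! ### The boundary -/

/-- The edges `ae`, `bf`, `ce`, `df` of the band are boundary edges. -/
lemma isBoundaryEdge_band {S : Finset (Fin 6)}
    (hS : S ∈ ({{0, 4}, {1, 5}, {2, 4}, {3, 5}} : Finset (Finset (Fin 6)))) :
    IsBoundaryEdge h.complex (S.map h.emb) := by
  obtain ⟨hSf, h2, hfour, h1⟩ : IsBandFace S ∧ S.card = 2 ∧ (4 ∈ S ∨ 5 ∈ S) ∧
      (bandTriangles.filter (S ⊆ ·)).card = 1 := by
    revert S; decide
  obtain ⟨t, ht⟩ := Finset.card_eq_one.1 h1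
  refine ⟨h.band_mem_faces hSf, by rwa [Finset.card_map], t.map h.emb, ?_⟩
  have hSK : S.map h.emb ∉ K.faces := fun hK => by
    rcases hfour with h4 | h5
    · exact h.emb_notMem_space (Or.inl rfl)
        (K.subset_space hK (Finset.mem_coe.2 (Finset.mem_map_of_mem _ h4)))
    · exact h.emb_notMem_space (Or.inr rfl)
        (K.subset_space hK (Finset.mem_coe.2 (Finset.mem_map_of_mem _ h5)))
  rw [h.trianglesContaining_eq_of_notMem hSK (Finset.map_nonempty.2 hSf.1),
    h.setOf_bandTriangles_map, ht]
  simp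

lemma vertices_complex_subset_surfaceBoundary (hbd : K.vertices ⊆ surfaceBoundary K) :
    h.complex.vertices ⊆ surfaceBoundary h.complex := by
  have hband : ∀ i, h.emb i ∈ surfaceBoundary h.complex := by
    intro i
    obtain ⟨S, hS, hiS⟩ : ∃ S ∈ ({{0, 4}, {1, 5}, {2, 4}, {3, 5}} : Finset (Finset (Fin 6))),
        i ∈ S := by revert i; decide
    exact Set.mem_biUnion (h.isBoundaryEdge_band hS)
      (subset_convexHull ℝ _ (Finset.mem_coe.2 (Finset.mem_map_of_mem _ hiS)))
  rw [vertices_complex]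
  rintro v (hv | rfl | rfl)
  · by_cases hvi : ∃ i, h.emb i = v
    · obtain ⟨i, rfl⟩ := hvi
      exact hband i
    · obtain ⟨s, hs, hvs⟩ := Set.mem_iUnion₂.1 (hbd hv)
      have hvmem : v ∈ s := by
        classical
        obtain ⟨u, hu⟩ := exists_isWeight hvs
        have := IsWeight.baryCoord_eq hs.1 hu
        by_contra hne
        have h0 := hu.eq_zero v hne
        rw [← this, baryCoord_vertex hv, Pi.single_eq_same] at h0
        exact one_ne_zero h0
      have hne : ∀ T : Finset (Fin 6), s ≠ T.map h.emb := by
        rintro T rfl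
        obtain ⟨i, -, hi⟩ := Finset.mem_map.1 hvmem
        exact hvi ⟨i, hi⟩
      refine Set.mem_biUnion (x := s) ⟨Or.inl hs.1, hs.2.1, ?_⟩ hvs
      rw [h.trianglesContaining_eq_of_edge hs.1 hs.2.1 (hne _) (hne _)]
      exact hs.2.2
  · exact hband 4
  · exact hband 5

end Geometry.SimplicialComplex.HandleSite

/-! ### A parametrization of the band -/

/-- The barycentric weights on `a, b, c, d, e, f` of the point of the band with coordinates `x, y`,
where `x` runs over `[-1, 1]` and `y` over `[0, 1]`; the edges `ab` and `cd` are at `x = -1` and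
`x = 1`, and `e`, `f` have the coordinates `(0, 0)` and `(0, 1)`. The weights are affine on the
four triangles into which the rectangle is divided by the lines `x = 0` and `y = |x|`. -/
noncomputable def bandWeights (x y : ℝ) : Fin 6 → ℝ :=
  ![max 0 (max (-x) 0 - y), min y (max (-x) 0), max 0 (max x 0 - y), min y (max x 0),
    1 - max |x| y, max 0 (y - |x|)]

lemma bandWeights_of_nonneg_of_le {x y : ℝ} (hx : 0 ≤ x) (hy : 0 ≤ y) (hyx : y ≤ x) :
    bandWeights x y = ![0, 0, x - y, y, 1 - x, 0] := by
  simp [bandWeights, abs_of_nonneg hx, hx, hy, hyx]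

lemma bandWeights_of_nonneg_of_ge {x y : ℝ} (hx : 0 ≤ x) (hyx : x ≤ y) :
    bandWeights x y = ![0, 0, 0, x, 1 - y, y - x] := by
  simp [bandWeights, abs_of_nonneg hx, hx, hx.trans hyx, hyx]

lemma bandWeights_of_nonpos_of_le {x y : ℝ} (hx : x ≤ 0) (hy : 0 ≤ y) (hyx : y ≤ -x) :
    bandWeights x y = ![-x - y, y, 0, 0, 1 + x, 0] := by
  simp [bandWeights, abs_of_nonpos hx, hx, hy, hyx]
  linarith

lemma bandWeights_of_nonpos_of_ge {x y : ℝ} (hx : x ≤ 0) (hyx : -x ≤ y) :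
    bandWeights x y = ![0, -x, 0, 0, 1 - y, y + x] := by
  have : 0 ≤ y := by linarith
  simp [bandWeights, abs_of_nonpos hx, hx, this, hyx]
  linarith

lemma bandWeights_spec {x y : ℝ} (hx : -1 ≤ x) (hx' : x ≤ 1) (hy : 0 ≤ y) (hy' : y ≤ 1) :
    (∀ i, 0 ≤ bandWeights x y i) ∧ (∑ i, bandWeights x y i = 1) ∧
      (∃ T ∈ bandTriangles, ∀ i, i ∉ T → bandWeights x y i = 0) ∧
      bandWeights x y 2 + bandWeights x y 3 - bandWeights x y 0 - bandWeights x y 1 = x ∧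
      bandWeights x y 1 + bandWeights x y 3 + bandWeights x y 5 = y := by
  rcases le_total 0 x with h | h
  · rcases le_total y x with h' | h'
    · rw [bandWeights_of_nonneg_of_le h hy h']
      refine ⟨fun i => ?_, ?_, ⟨{2, 3, 4}, by decide, fun i hi => ?_⟩, ?_, ?_⟩
      · fin_cases i <;> simp <;> linarith
      · simp only [Fin.sum_univ_six, Matrix.cons_val]
        ring
      · fin_cases i <;> simp at hi ⊢
      · simp
      · simp
    · rw [bandWeights_of_nonneg_of_ge h h']
      refine ⟨fun i => ?_, ?_, ⟨{3, 4, 5}, by decide, fun i hi => ?_⟩, ?_, ?_⟩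
      · fin_cases i <;> simp <;> linarith
      · simp only [Fin.sum_univ_six, Matrix.cons_val]
        ring
      · fin_cases i <;> simp at hi ⊢
      · simp
      · simp
  · rcases le_total y (-x) with h' | h'
    · rw [bandWeights_of_nonpos_of_le h hy h']
      refine ⟨fun i => ?_, ?_, ⟨{0, 1, 4}, by decide, fun i hi => ?_⟩, ?_, ?_⟩
      · fin_cases i <;> simp <;> linarith
      · simp only [Fin.sum_univ_six, Matrix.cons_val]
        ring
      · fin_cases i <;> simp at hi ⊢
      · simp
      · simp
    · rw [bandWeights_of_nonpos_of_ge h h']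
      refine ⟨fun i => ?_, ?_, ⟨{1, 4, 5}, by decide, fun i hi => ?_⟩, ?_, ?_⟩
      · fin_cases i <;> simp <;> linarith
      · simp only [Fin.sum_univ_six, Matrix.cons_val]
        ring
      · fin_cases i <;> simp at hi ⊢
      · simp
      · simp

lemma bandWeights_eq {w : Fin 6 → ℝ} (h0 : ∀ i, 0 ≤ w i) (h1 : ∑ i, w i = 1) {T : Finset (Fin 6)}
    (hT : T ∈ bandTriangles) (hw : ∀ i, i ∉ T → w i = 0) :
    bandWeights (w 2 + w 3 - w 0 - w 1) (w 1 + w 3 + w 5) = w := by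
  rw [Fin.sum_univ_six] at h1
  have e0 := h0 0
  have e1 := h0 1
  have e2 := h0 2
  have e3 := h0 3
  have e4 := h0 4
  have e5 := h0 5
  have hw0 := hw 0
  have hw1 := hw 1
  have hw2 := hw 2
  have hw3 := hw 3
  have hw4 := hw 4
  have hw5 := hw 5
  simp only [bandTriangles, Finset.mem_insert, Finset.mem_singleton] at hT
  rcases hT with rfl | rfl | rfl | rfl
  · simp at hw2 hw3 hw5
    rw [bandWeights_of_nonpos_of_le (by linarith) (by linarith) (by linarith)]
    funext i
    fin_cases i <;> simp <;> linarith
  · simp at hw0 hw2 hw3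
    rw [bandWeights_of_nonpos_of_ge (by linarith) (by linarith)]
    funext i
    fin_cases i <;> simp <;> linarith
  · simp at hw0 hw1 hw2
    rw [bandWeights_of_nonneg_of_ge (by linarith) (by linarith)]
    funext i
    fin_cases i <;> simp <;> linarith
  · simp at hw0 hw1 hw5
    rw [bandWeights_of_nonneg_of_le (by linarith) (by linarith) (by linarith)]
    funext i
    fin_cases i <;> simp <;> linarith

lemma continuous_bandWeights (i : Fin 6) :
    Continuous fun p : ℝ × ℝ => bandWeights p.1 p.2 i := by
  fin_cases i <;> simp only [bandWeights, Fin.reduceFinMk, Fin.zero_eta, Fin.mk_one,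
    Matrix.cons_val] <;> fun_prop

/-- If `e` and `f` have weight zero, then the point lies on `ab` or `cd`. -/
lemma abs_eq_one_of_bandWeights {x y : ℝ} (h4 : bandWeights x y 4 = 0)
    (h5 : bandWeights x y 5 = 0) : x = -1 ∨ x = 1 := by
  simp only [bandWeights, Matrix.cons_val] at h4 h5
  have h' : y ≤ |x| := by
    have := le_max_right 0 (y - |x|)
    linarith
  rw [max_eq_left h'] at h4
  have : |x| = 1 := by linarith
  rcases eq_or_eq_neg_of_abs_eq this with h | h
  exacts [Or.inr h, Or.inl h]

/-- The parameter of a segment parametrization along the segment. -/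
lemma IsSegmentParam.exists_param {n : ℕ} {γ : unitInterval → EuclideanSpace ℝ (Fin n)}
    {a b : EuclideanSpace ℝ (Fin n)} (hγ : IsSegmentParam γ a b) (hab : a ≠ b) :
    ∃ τ : unitInterval → ℝ, Continuous τ ∧ StrictMono τ ∧ τ 0 = 0 ∧ τ 1 = 1 ∧
      ∀ t, γ t = (1 - τ t) • a + τ t • b := by
  have hd : dist a b ≠ 0 := dist_ne_zero.2 hab
  have hτ : ∀ t, γ t = (1 - dist a (γ t) / dist a b) • a + (dist a (γ t) / dist a b) • b := by
    intro t
    have ht : γ t ∈ segment ℝ a b := hγ.range_eq ▸ Set.mem_range_self t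
    obtain ⟨s, hs, hst⟩ := (segment_eq_image ℝ a b).subset ht
    have hst : (1 - s) • a + s • b = γ t := hst
    have hdist : dist a (γ t) = s * dist a b := by
      rw [← hst, dist_eq_norm, dist_eq_norm, show a - ((1 - s) • a + s • b) = s • (a - b) by module,
        norm_smul, Real.norm_of_nonneg hs.1]
    rw [hdist, mul_div_cancel_right₀ _ hd, hst]
  have hcont : Continuous fun t => dist a (γ t) / dist a b :=
    (continuous_const.dist hγ.continuous).div_const _
  have h0 : dist a (γ 0) / dist a b = 0 := by rw [hγ.source, dist_self, zero_div]
  have h1 : dist a (γ 1) / dist a b = 1 := by rw [hγ.target, div_self hd]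
  refine ⟨fun t => dist a (γ t) / dist a b, hcont, ?_, h0, h1, hτ⟩
  refine hcont.strictMono_of_inj_boundedOrder ?_ fun s t hst => hγ.injective ?_
  · change dist a (γ 0) / dist a b ≤ dist a (γ 1) / dist a b
    rw [h0, h1]
    exact zero_le_one
  · have hst : dist a (γ s) / dist a b = dist a (γ t) / dist a b := hst
    rw [hτ s, hτ t, hst]

/-- Two maps from the unit interval to a path connected space are homotopic. -/
lemma homotopic_of_unitInterval {X : Type*} [TopologicalSpace X] [PathConnectedSpace X]
    (f g : C(unitInterval, X)) : f.Homotopic g := by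
  have : ContractibleSpace unitInterval :=
    (convex_Icc (0 : ℝ) 1).contractibleSpace ⟨0, by simp⟩
  obtain ⟨x, hx⟩ := (id_nullhomotopic unitInterval).comp_right f
  obtain ⟨y, hy⟩ := (id_nullhomotopic unitInterval).comp_right g
  have : Nonempty X := ⟨x⟩
  exact (hx.trans (ContinuousMap.homotopic_const_iff.2 (PathConnectedSpace.joined x y))).trans
    hy.symm

namespace Geometry.SimplicialComplex.HandleSite

variable {n : ℕ} {K : SimplicialComplex ℝ (EuclideanSpace ℝ (Fin n))}
  {a b c d : EuclideanSpace ℝ (Fin n)} (h : K.HandleSite a b c d)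

lemma isWeight_of_forall {T : Finset (Fin 6)} {w : Fin 6 → ℝ} (h0 : ∀ i, 0 ≤ w i)
    (h1 : ∑ i, w i = 1) (hT : ∀ i, i ∉ T → w i = 0) :
    IsWeight (T.map h.emb) (Function.extend h.emb w 0) (∑ i, w i • h.emb i) where
  nonneg v := by
    by_cases hv : ∃ i, h.emb i = v
    · obtain ⟨i, rfl⟩ := hv
      rw [h.emb.injective.extend_apply]
      exact h0 i
    · rw [Function.extend_apply' _ _ _ hv]
      rfl
  eq_zero v hv := by
    by_cases hv' : ∃ i, h.emb i = v
    · obtain ⟨i, rfl⟩ := hv'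
      rw [h.emb.injective.extend_apply]
      exact hT i fun hi => hv (Finset.mem_map_of_mem _ hi)
    · rw [Function.extend_apply' _ _ _ hv']
      rfl
  sum_eq := by
    simp only [Finset.sum_map, h.emb.injective.extend_apply]
    rw [← h1]
    exact Finset.sum_subset (Finset.subset_univ T) fun i _ hi => hT i hi
  sum_smul := by
    simp only [Finset.sum_map, h.emb.injective.extend_apply]
    exact Finset.sum_subset (Finset.subset_univ T) fun i _ hi => by rw [hT i hi, zero_smul]

lemma exists_isWeight_bandWeights {x y : ℝ} (hx : -1 ≤ x) (hx' : x ≤ 1) (hy : 0 ≤ y)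
    (hy' : y ≤ 1) : ∃ T ∈ bandTriangles, IsWeight (T.map h.emb)
      (Function.extend h.emb (bandWeights x y) 0) (∑ i, bandWeights x y i • h.emb i) := by
  obtain ⟨h0, h1, ⟨T, hT, hz⟩, -⟩ := bandWeights_spec hx hx' hy hy'
  exact ⟨T, hT, h.isWeight_of_forall h0 h1 hz⟩

/-- A map of the square onto the band that restricts to the parametrizations `γ₀` and `γ₁` of the
edges `ab` and `cd` on two opposite sides. -/
lemma exists_band_param {γ₀ γ₁ : unitInterval → EuclideanSpace ℝ (Fin n)}
    (hγ₀ : IsSegmentParam γ₀ a b) (hγ₁ : IsSegmentParam γ₁ c d) :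
    ∃ β : unitInterval × unitInterval → EuclideanSpace ℝ (Fin n), Continuous β ∧
      Function.Injective β ∧ (∀ t, β (0, t) = γ₀ t) ∧ (∀ t, β (1, t) = γ₁ t) ∧
      (∀ p, β p ∈ h.complex.space) ∧ (∀ p, β p ∈ K.space → p.1 = 0 ∨ p.1 = 1) ∧
      h.complex.space ⊆ K.space ∪ Set.range β := by
  have hab : a ≠ b := fun he => by
    have := h.emb.injective (a₁ := 0) (a₂ := 1) he
    exact absurd this (by decide)
  have hcd : c ≠ d := fun he => by
    have := h.emb.injective (a₁ := 2) (a₂ := 3) he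
    exact absurd this (by decide)
  obtain ⟨τ₀, hτ₀, hm₀, h00, h01, he₀⟩ := hγ₀.exists_param hab
  obtain ⟨τ₁, hτ₁, hm₁, h10, h11, he₁⟩ := hγ₁.exists_param hcd
  -- The coordinates `x`, `y` of the image of `(s, t)`. For fixed `s`, the second coordinate is an
  -- increasing function of `t`, a mean of the parameters on the two sides and of `t` itself.
  let x : unitInterval → ℝ := fun s => 2 * s - 1
  let y : unitInterval × unitInterval → ℝ := fun p =>
    max (-x p.1) 0 * τ₀ p.2 + max (x p.1) 0 * τ₁ p.2 + (1 - |x p.1|) * p.2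
  have hx0 : ∀ s, -1 ≤ x s := fun s => by have := s.2.1; simp only [x]; linarith
  have hx1 : ∀ s, x s ≤ 1 := fun s => by have := s.2.2; simp only [x]; linarith
  have habs : ∀ s, max (-x s) 0 + max (x s) 0 = |x s| := fun s => by
    rcases le_total 0 (x s) with hs | hs
    · rw [abs_of_nonneg hs, max_eq_left hs, max_eq_right (by linarith), zero_add]
    · rw [abs_of_nonpos hs, max_eq_right hs, max_eq_left (by linarith), add_zero]
  have habs1 : ∀ s, |x s| ≤ 1 := fun s => abs_le.2 ⟨hx0 s, hx1 s⟩
  have hymono : ∀ s, StrictMono fun t => y (s, t) := by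
    intro s t t' htt'
    have e0 := hm₀ htt'
    have e1 := hm₁ htt'
    have e2 : (t : ℝ) < t' := htt'
    have p0 := le_max_right (-x s) 0
    have p1 := le_max_right (x s) 0
    have p2 := sub_nonneg.2 (habs1 s)
    have ps := habs s
    have i0 := mul_le_mul_of_nonneg_left e0.le p0
    have i1 := mul_le_mul_of_nonneg_left e1.le p1
    have i2 := mul_le_mul_of_nonneg_left e2.le p2
    change max (-x s) 0 * τ₀ t + max (x s) 0 * τ₁ t + (1 - |x s|) * t <
      max (-x s) 0 * τ₀ t' + max (x s) 0 * τ₁ t' + (1 - |x s|) * t'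
    rcases p0.lt_or_eq with q0 | q0
    · have := mul_lt_mul_of_pos_left e0 q0
      linarith
    rcases p1.lt_or_eq with q1 | q1
    · have := mul_lt_mul_of_pos_left e1 q1
      linarith
    have q2 : 0 < 1 - |x s| := by linarith
    have := mul_lt_mul_of_pos_left e2 q2
    linarith
  have hys0 : ∀ s, y (s, 0) = 0 := fun s => by simp [y, h00, h10]
  have hys1 : ∀ s, y (s, 1) = 1 := fun s => by
    have := habs s
    simp only [y, h01, h11, mul_one, Set.Icc.coe_one]
    linarith
  have hy0 : ∀ p, 0 ≤ y p := fun p => by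
    rw [← hys0 p.1]
    exact (hymono p.1).monotone unitInterval.nonneg'
  have hy1 : ∀ p, y p ≤ 1 := fun p => by
    rw [← hys1 p.1]
    exact (hymono p.1).monotone unitInterval.le_one'
  have hxc : Continuous x := by fun_prop
  have hyc : Continuous y := by fun_prop
  have hval : ∀ (s t : unitInterval), ∀ X Y : ℝ, x s = X → y (s, t) = Y →
      bandWeights (x s) (y (s, t)) = bandWeights X Y := by
    rintro s t _ _ rfl rfl
    rfl
  refine ⟨fun p => ∑ i, bandWeights (x p.1) (y p) i • h.emb i, ?_, ?_, ?_, ?_, ?_, ?_, ?_⟩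
  · refine continuous_finsetSum _ fun i _ => ?_
    exact ((continuous_bandWeights i).comp ((hxc.comp continuous_fst).prodMk hyc)).smul
      continuous_const
  · intro p q hpq
    obtain ⟨S, hS, hwS⟩ := h.exists_isWeight_bandWeights (hx0 p.1) (hx1 p.1) (hy0 p) (hy1 p)
    obtain ⟨T, hT, hwT⟩ := h.exists_isWeight_bandWeights (hx0 q.1) (hx1 q.1) (hy0 q) (hy1 q)
    have hpq : ∑ i, bandWeights (x p.1) (y p) i • h.emb i =
      ∑ i, bandWeights (x q.1) (y q) i • h.emb i := hpq
    rw [hpq] at hwS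
    have he := h.isWeight_unique (isBandFace_of_mem hS).1 (isBandFace_of_mem hT).1 hwS hwT
    have he' : bandWeights (x p.1) (y p) = bandWeights (x q.1) (y q) := by
      funext i
      have := congrFun he (h.emb i)
      rwa [h.emb.injective.extend_apply, h.emb.injective.extend_apply] at this
    obtain ⟨-, -, -, ep1, ep2⟩ := bandWeights_spec (hx0 p.1) (hx1 p.1) (hy0 p) (hy1 p)
    obtain ⟨-, -, -, eq1, eq2⟩ := bandWeights_spec (hx0 q.1) (hx1 q.1) (hy0 q) (hy1 q)
    rw [he', eq1] at ep1
    rw [he', eq2] at ep2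
    have hs : p.1 = q.1 := Subtype.ext (by simp only [x] at ep1; linarith)
    obtain ⟨s, t⟩ := p
    obtain ⟨s', t'⟩ := q
    obtain rfl : s = s' := hs
    exact Prod.ext rfl ((hymono s).injective ep2.symm)
  · intro t
    have hx : x 0 = -1 := by simp [x]
    have hy : y (0, t) = τ₀ t := by simp [y, hx]
    have ht : 0 ≤ τ₀ t := by rw [← hy]; exact hy0 _
    have ht' : τ₀ t ≤ 1 := by rw [← hy]; exact hy1 _
    simp only [hx, hy, bandWeights_of_nonpos_of_le (x := -1) (by norm_num) ht (by linarith)]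
    rw [he₀]
    simp [Fin.sum_univ_six, emb_apply, bandPoint]
  · intro t
    have hx : x 1 = 1 := by norm_num [x]
    have hy : y (1, t) = τ₁ t := by simp [y, hx]
    have ht : 0 ≤ τ₁ t := by rw [← hy]; exact hy0 _
    have ht' : τ₁ t ≤ 1 := by rw [← hy]; exact hy1 _
    simp only [hx, hy, bandWeights_of_nonneg_of_le (x := 1) (by norm_num) ht (by linarith)]
    rw [he₁]
    simp [Fin.sum_univ_six, emb_apply, bandPoint]
  · intro p
    obtain ⟨T, hT, hw⟩ := h.exists_isWeight_bandWeights (hx0 p.1) (hx1 p.1) (hy0 p) (hy1 p)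
    exact convexHull_subset_space (h.band_mem_faces (isBandFace_of_mem hT).1) hw.mem_convexHull
  · intro p hp
    obtain ⟨T, hT, hw⟩ := h.exists_isWeight_bandWeights (hx0 p.1) (hx1 p.1) (hy0 p) (hy1 p)
    have hz : ∀ i, i = 4 ∨ i = 5 → bandWeights (x p.1) (y p) i = 0 := by
      intro i hi
      by_contra hne
      have hpos : 0 < Function.extend h.emb (bandWeights (x p.1) (y p)) 0 (h.emb i) := by
        refine lt_of_le_of_ne (hw.nonneg _) fun he => hne ?_
        rw [he, h.emb.injective.extend_apply]
      refine h.notMem_space_of_isWeight hw ?_ hp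
      rcases hi with rfl | rfl
      exacts [Or.inl hpos, Or.inr hpos]
    refine (abs_eq_one_of_bandWeights (hz 4 (Or.inl rfl))
      (hz 5 (Or.inr rfl))).imp (fun hp => ?_) fun hp => ?_
    · exact Subtype.ext (by simp only [x] at hp; simp only [Set.Icc.coe_zero]; linarith)
    · exact Subtype.ext (by simp only [x] at hp; simp only [Set.Icc.coe_one]; linarith)
  · intro z hz
    obtain ⟨s, hs | ⟨T, ⟨-, t, ht, hTt⟩, rfl⟩, hzs⟩ := mem_space_iff.1 hz
    · exact Or.inl (convexHull_subset_space hs hzs)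
    · right
      obtain ⟨w, hw⟩ := exists_isWeight hzs
      replace hw := hw.mono (Finset.map_subset_map.2 hTt)
      obtain ⟨h1, hp⟩ := h.sum_of_isWeight hw
      have hz0 : ∀ i, i ∉ t → w (h.emb i) = 0 := fun i hi => hw.eq_zero _ (by simpa using hi)
      have h0 : ∀ i, 0 ≤ w (h.emb i) := fun i => hw.nonneg _
      have hbw := bandWeights_eq h0 h1 ht hz0
      rw [Fin.sum_univ_six] at h1
      have g0 := h0 0
      have g1 := h0 1
      have g2 := h0 2
      have g3 := h0 3
      have g4 := h0 4
      have g5 := h0 5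
      let s : unitInterval :=
        ⟨(w (h.emb 2) + w (h.emb 3) - w (h.emb 0) - w (h.emb 1) + 1) / 2,
          by linarith, by linarith⟩
      obtain ⟨t, ht⟩ : w (h.emb 1) + w (h.emb 3) + w (h.emb 5) ∈ Set.range fun t => y (s, t) := by
        refine intermediate_value_univ 0 1 (hyc.comp (Continuous.prodMk_right s)) ⟨?_, ?_⟩
        · change y (s, 0) ≤ _
          rw [hys0]; linarith
        · change _ ≤ y (s, 1)
          rw [hys1]; linarith
      refine ⟨(s, t), ?_⟩
      have hxs : x s = w (h.emb 2) + w (h.emb 3) - w (h.emb 0) - w (h.emb 1) := by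
        simp only [x, s]; ring
      have ht : y (s, t) = w (h.emb 1) + w (h.emb 3) + w (h.emb 5) := ht
      change ∑ i, bandWeights (x s) (y (s, t)) i • h.emb i = z
      rw [hxs, ht, hbw, ← hp]
      rfl

/-! ### The homeomorphism and the retraction -/

/-- The surface with a handle attached is homeomorphic to the complex with the band attached. -/
lemma exists_homeomorph (hK : K.faces.Finite) {γ₀ γ₁ : unitInterval → EuclideanSpace ℝ (Fin n)}
    (hγ₀ : IsSegmentParam γ₀ a b) (hγ₁ : IsSegmentParam γ₁ c d) :
    ∃ Φ : HandleAttachment K.space γ₀ γ₁ ≃ₜ h.complex.space,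
      ∀ x : K.space, (Φ (Quot.mk _ (Sum.inl x)) : EuclideanSpace ℝ (Fin n)) = x := by
  obtain ⟨β, hβ, hinj, hβ₀, hβ₁, hmem, hside, hsurj⟩ := h.exists_band_param hγ₀ hγ₁
  let F : K.space ⊕ (unitInterval × unitInterval) → h.complex.space :=
    Sum.elim (Set.inclusion (space_mono h.le_complex)) fun p => ⟨β p, hmem p⟩
  have hF : Continuous F :=
    (continuous_inclusion _).sumElim (hβ.subtype_mk _)
  have hrel : ∀ p q, HandleRel K.space γ₀ γ₁ p q → F p = F q := by
    rintro (x | p) (y | q) hpq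
    · exact hpq.elim
    · refine Subtype.ext ?_
      rcases hpq with ⟨hq, hx⟩ | ⟨hq, hx⟩
      · change x.1 = β q
        rw [hx, ← hβ₀, ← hq]
      · change x.1 = β q
        rw [hx, ← hβ₁, ← hq]
    · exact hpq.elim
    · exact hpq.elim
  let φ : HandleAttachment K.space γ₀ γ₁ → h.complex.space := Quot.lift F hrel
  -- A point of the band on `K` lies on one of the two sides that are glued to `K`.
  have hglue : ∀ (x : K.space) (p : unitInterval × unitInterval), x.1 = β p →
      (Quot.mk (HandleRel K.space γ₀ γ₁) (Sum.inl x)) = Quot.mk _ (Sum.inr p) := by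
    rintro x ⟨s, t⟩ hx
    refine Quot.sound ?_
    rcases hside (s, t) (hx ▸ x.2) with hs | hs
    · obtain rfl : s = 0 := hs
      exact Or.inl ⟨rfl, hx.trans (hβ₀ t)⟩
    · obtain rfl : s = 1 := hs
      exact Or.inr ⟨rfl, hx.trans (hβ₁ t)⟩
  have hbij : Function.Bijective φ := by
    constructor
    · rintro ⟨x | p⟩ ⟨y | q⟩ hpq
      · have : x = y := Subtype.ext (congrArg (fun z => z.1) hpq)
        rw [this]
      · exact hglue x q (Subtype.ext_iff.1 hpq)
      · exact (hglue y p (Subtype.ext_iff.1 hpq).symm).symm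
      · have : p = q := hinj (Subtype.ext_iff.1 hpq)
        rw [this]
    · rintro ⟨z, hz⟩
      rcases hsurj hz with hzK | ⟨p, rfl⟩
      · exact ⟨Quot.mk _ (Sum.inl ⟨z, hzK⟩), rfl⟩
      · exact ⟨Quot.mk _ (Sum.inr p), rfl⟩
  have : CompactSpace K.space := isCompact_iff_compactSpace.1 (isCompact_space hK)
  have hφ : Continuous (Equiv.ofBijective φ hbij) := continuous_quot_lift _ hF
  exact ⟨hφ.homeoOfEquivCompactToT2, fun x => rfl⟩

/-- The space of `K` is a retract of the new complex: the band is mapped to `K` by a homotopy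
between the parametrizations of `ab` and `cd`. -/
lemma homologyInjective_space_complex (hK : K.faces.Finite) (hc : IsConnected K.space)
    {γ₀ γ₁ : unitInterval → EuclideanSpace ℝ (Fin n)}
    (hγ₀ : IsSegmentParam γ₀ a b) (hγ₁ : IsSegmentParam γ₁ c d) (p : ℕ) :
    SingularChain.HomologyInjective p K.space h.complex.space := by
  obtain ⟨Φ, hΦ⟩ := h.exists_homeomorph hK hγ₀ hγ₁
  have : PathConnectedSpace K.space :=
    isPathConnected_iff_pathConnectedSpace.1 (isPathConnected_space hK hc)
  have h₀ : ∀ t, γ₀ t ∈ K.space := fun t => h.segment_subset_space.1 (by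
    rw [← hγ₀.range_eq]
    exact Set.mem_range_self t)
  have h₁ : ∀ t, γ₁ t ∈ K.space := fun t => h.segment_subset_space.2 (by
    rw [← hγ₁.range_eq]
    exact Set.mem_range_self t)
  obtain ⟨H⟩ := homotopic_of_unitInterval (X := K.space)
    ⟨fun t => ⟨γ₀ t, h₀ t⟩, hγ₀.continuous.subtype_mk _⟩
    ⟨fun t => ⟨γ₁ t, h₁ t⟩, hγ₁.continuous.subtype_mk _⟩
  have hrel : ∀ p q, HandleRel K.space γ₀ γ₁ p q → Sum.elim id H p = Sum.elim id H q := by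
    rintro (x | p) (y | ⟨s, t⟩) hpq
    · exact hpq.elim
    · rcases hpq with ⟨hs, hx⟩ | ⟨hs, hx⟩
      · obtain rfl : s = 0 := hs
        exact Subtype.ext (hx.trans (congrArg Subtype.val (H.apply_zero t)).symm)
      · obtain rfl : s = 1 := hs
        exact Subtype.ext (hx.trans (congrArg Subtype.val (H.apply_one t)).symm)
    · exact hpq.elim
    · exact hpq.elim
  let ρ : HandleAttachment K.space γ₀ γ₁ → K.space := Quot.lift (Sum.elim id H) hrel
  have hρ : Continuous ρ := continuous_quot_lift _ (continuous_id.sumElim H.continuous)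
  refine SingularChain.homologyInjective_of_retraction p ⟨fun z => ρ (Φ.symm z),
    hρ.comp Φ.symm.continuous⟩ (fun x hx hZ => ?_) (space_mono h.le_complex)
  have : Φ.symm ⟨x, hZ⟩ = Quot.mk _ (Sum.inl ⟨x, hx⟩) :=
    Φ.symm_apply_eq.2 (Subtype.ext (hΦ ⟨x, hx⟩).symm)
  change (ρ (Φ.symm ⟨x, hZ⟩)).1 = x
  rw [this]
  rfl

end Geometry.SimplicialComplex.HandleSite

/-! ### Half-spaces and the band -/

namespace Geometry.SimplicialComplex

variable {E : Type} [NormedAddCommGroup E] [NormedSpace ℝ E]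

/-- The weights of the barycenter of a nonempty finite set are positive. -/
lemma exists_isWeight_pos {s : Finset E} (hs : s.Nonempty) :
    ∃ w x, IsWeight s w x ∧ ∀ v ∈ s, 0 < w v := by
  classical
  have hc : 0 < (s.card : ℝ) := Nat.cast_pos.2 hs.card_pos
  refine ⟨fun v => if v ∈ s then (s.card : ℝ)⁻¹ else 0, ∑ v ∈ s, (s.card : ℝ)⁻¹ • v,
    ⟨fun v => ?_, fun v hv => if_neg hv, ?_, ?_⟩, fun v hv => ?_⟩
  · split_ifs
    exacts [(inv_pos.2 hc).le, le_rfl]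
  · rw [Finset.sum_congr rfl fun v hv => if_pos hv, Finset.sum_const, nsmul_eq_mul,
      mul_inv_cancel₀ hc.ne']
  · exact Finset.sum_congr rfl fun v hv => by rw [if_pos hv]
  · change 0 < if v ∈ s then (s.card : ℝ)⁻¹ else 0
    rw [if_pos hv]
    exact inv_pos.2 hc

namespace HandleSite

variable {K : SimplicialComplex ℝ E} {a b c d : E} (h : K.HandleSite a b c d)

/-- The points of the complex that have positive total weight on each of the sets of vertices of
the band in `G`. -/
def bandPart (G : Finset (Finset (Fin 6))) : Set E :=
  {x | x ∈ h.complex.space ∧ ∀ g ∈ G, 0 < ∑ i ∈ g, h.complex.baryCoord x (h.emb i)}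

/-- Points with positive weight on `e` or `f` are carried by a face of the band. -/
lemma exists_band_carrier {x : E} (hx : x ∈ h.complex.space)
    (hm : 0 < ∑ i ∈ {4, 5}, h.complex.baryCoord x (h.emb i)) :
    ∃ T, IsBandFace T ∧ IsWeight (T.map h.emb) (h.complex.baryCoord x) x ∧
      ∀ i, i ∈ T ↔ 0 < h.complex.baryCoord x (h.emb i) := by
  obtain ⟨s, hs, hw, hpos⟩ := exists_carrier hx
  obtain ⟨i, hi, hi0⟩ : ∃ i ∈ ({4, 5} : Finset (Fin 6)), 0 < h.complex.baryCoord x (h.emb i) :=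
    Finset.exists_lt_of_sum_lt (by rwa [Finset.sum_const_zero])
  rcases hs with hs | ⟨T, hT, rfl⟩
  · exact (h.emb_notMem_space (by simpa using hi) (K.subset_space hs ((hpos _).2 hi0))).elim
  · exact ⟨T, hT, hw, fun i => by rw [← hpos, Finset.mem_map' h.emb]⟩

lemma exists_band_carrier_of_mem {G : Finset (Finset (Fin 6))} (hG : {4, 5} ∈ G) {x : E}
    (hx : x ∈ h.bandPart G) :
    ∃ T, IsBandFace T ∧ (∀ g ∈ G, ∃ i ∈ g, i ∈ T) ∧
      IsWeight (T.map h.emb) (h.complex.baryCoord x) x ∧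
      ∀ i, i ∈ T ↔ 0 < h.complex.baryCoord x (h.emb i) := by
  obtain ⟨T, hT, hw, hpos⟩ := h.exists_band_carrier hx.1 (hx.2 _ hG)
  refine ⟨T, hT, fun g hg => ?_, hw, hpos⟩
  obtain ⟨i, hi, hi0⟩ : ∃ i ∈ g, 0 < h.complex.baryCoord x (h.emb i) :=
    Finset.exists_lt_of_sum_lt (by rw [Finset.sum_const_zero]; exact hx.2 g hg)
  exact ⟨i, hi, (hpos i).2 hi0⟩

/-- A part of the band is star-shaped about the barycenter of `S` if `S` together with any face
that carries a point of this part is a face. -/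
lemma acyclic_of_center (W : Set E) {G : Finset (Finset (Fin 6))} (hG : {4, 5} ∈ G)
    {S : Finset (Fin 6)} (hS : IsBandFace S) (hSG : ∀ g ∈ G, ∃ i ∈ g, i ∈ S)
    (hSW : ∀ i ∈ S, h.emb i ∈ W)
    (hST : ∀ T, IsBandFace T → (∀ g ∈ G, ∃ i ∈ g, i ∈ T) → (∀ i ∈ T, h.emb i ∈ W) →
      IsBandFace (S ∪ T)) :
    SingularChain.Acyclic (h.complex.fullSpace W ∩ h.bandPart G) := by
  obtain ⟨w, z, hw, hwpos⟩ := exists_isWeight_pos (Finset.map_nonempty (f := h.emb).2 hS.1)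
  have hz := hw.baryCoord_eq (h.band_mem_faces hS)
  have hzmem : z ∈ h.complex.fullSpace W ∩ h.bandPart G := by
    have hzs := convexHull_subset_space (h.band_mem_faces hS) hw.mem_convexHull
    refine ⟨⟨hzs, fun v hv => ?_⟩, hzs, fun g hg => ?_⟩
    · rw [hz]
      refine hw.eq_zero v fun hvS => hv ?_
      obtain ⟨i, hi, rfl⟩ := Finset.mem_map.1 hvS
      exact hSW i hi
    · rw [hz]
      obtain ⟨i, hi, hiS⟩ := hSG g hg
      exact Finset.sum_pos' (fun i _ => hw.nonneg _)
        ⟨i, hi, hwpos _ (Finset.mem_map_of_mem _ hiS)⟩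
  refine SingularChain.acyclic_of_starConvex hzmem (starConvex_iff_segment_subset.2 ?_)
  rintro x ⟨hxW, hxG⟩
  obtain ⟨T, hT, hTG, hwT, hpos⟩ := h.exists_band_carrier_of_mem hG hxG
  have hTW : ∀ i ∈ T, h.emb i ∈ W := fun i hi => by
    by_contra hne
    exact ((hpos i).1 hi).ne' (hxW.2 _ hne)
  have hface := h.band_mem_faces (hST T hT hTG hTW)
  have hzf :=
    (hw.mono (Finset.map_subset_map.2 (Finset.subset_union_left (s₂ := T)))).mem_convexHull
  have hxf :=
    (hwT.mono (Finset.map_subset_map.2 (Finset.subset_union_right (s₁ := S)))).mem_convexHull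
  rw [segment_eq_image]
  rintro _ ⟨t, ht, rfl⟩
  have hcoord : ∀ v, h.complex.baryCoord ((1 - t) • z + t • x) v =
      (1 - t) * h.complex.baryCoord z v + t * h.complex.baryCoord x v :=
    baryCoord_lineMap hface hzf hxf ht
  have hmem : (1 - t) • z + t • x ∈ h.complex.space := convexHull_subset_space hface
    ((convex_convexHull ℝ _) hzf hxf (sub_nonneg.2 ht.2) ht.1 (by ring))
  refine ⟨⟨hmem, fun v hv => ?_⟩, hmem, fun g hg => ?_⟩
  · change h.complex.baryCoord ((1 - t) • z + t • x) v = 0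
    rw [hcoord, hzmem.1.2 v hv, hxW.2 v hv, mul_zero, mul_zero, add_zero]
  · change 0 < ∑ i ∈ g, h.complex.baryCoord ((1 - t) • z + t • x) (h.emb i)
    simp only [hcoord, Finset.sum_add_distrib, ← Finset.mul_sum]
    exact (convex_Ioi (0 : ℝ)) (hzmem.2.2 g hg) (hxG.2 g hg) (sub_nonneg.2 ht.2) ht.1 (by ring)

/-- A part of the band in a full subcomplex is acyclic if every face that meets it spans a face with
`S` and, unless it contains the vertex `i` of `S`, contains `σ i`: then it is star-shaped about the
barycenter of `S`, or, if some vertex `i` of `S` is missing in `W`, about the barycenter of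
`σ i`. -/
lemma acyclic_bandPart (W : Set E) {G : Finset (Finset (Fin 6))} (hG : {4, 5} ∈ G)
    {S : Finset (Fin 6)} (σ : Fin 6 → Finset (Fin 6)) (hS : IsBandFace S)
    (hSG : ∀ g ∈ G, ∃ i ∈ g, i ∈ S)
    (hσ : ∀ i ∈ S, IsBandFace (σ i) ∧ ∀ g ∈ G, ∃ j ∈ g, j ∈ σ i)
    (hST : ∀ T, IsBandFace T → (∀ g ∈ G, ∃ i ∈ g, i ∈ T) →
      IsBandFace (S ∪ T) ∧ ∀ i ∈ S, i ∉ T → σ i ⊆ T) :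
    SingularChain.Acyclic (h.complex.fullSpace W ∩ h.bandPart G) := by
  by_cases hSW : ∀ i ∈ S, h.emb i ∈ W
  · exact h.acyclic_of_center W hG hS hSG hSW fun T hT hTG _ => (hST T hT hTG).1
  push Not at hSW
  obtain ⟨i, hi, hiW⟩ := hSW
  have hσT : ∀ T, IsBandFace T → (∀ g ∈ G, ∃ i ∈ g, i ∈ T) → (∀ i ∈ T, h.emb i ∈ W) →
      σ i ⊆ T := fun T hT hTG hTW => (hST T hT hTG).2 i hi fun hiT => hiW (hTW i hiT)
  by_cases hσW : ∀ j ∈ σ i, h.emb j ∈ W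
  · refine h.acyclic_of_center W hG (hσ i hi).1 (hσ i hi).2 hσW fun T hT hTG hTW => ?_
    rwa [Finset.union_eq_right.2 (hσT T hT hTG hTW)]
  · have : h.complex.fullSpace W ∩ h.bandPart G = ∅ := by
      refine Set.eq_empty_of_forall_notMem ?_
      rintro x ⟨hxW, hxG⟩
      obtain ⟨T, hT, hTG, -, hpos⟩ := h.exists_band_carrier_of_mem hG hxG
      have hTW : ∀ j ∈ T, h.emb j ∈ W := fun j hj => by
        by_contra hne
        exact ((hpos j).1 hj).ne' (hxW.2 _ hne)
      exact hσW fun j hj => hTW j (hσT T hT hTG hTW hj)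
    rw [this]
    exact SingularChain.acyclic_empty

set_option maxRecDepth 4000 in
/-- The end of the band at `ab` is star-shaped about the midpoint of `be`; if `b` is not in `W` then
`ae`, and if `e` is not in `W` then `bf` replaces `be`. -/
lemma acyclic_left (W : Set E) :
    SingularChain.Acyclic (h.complex.fullSpace W ∩ h.bandPart {{4, 5}, {0, 1}}) :=
  h.acyclic_bandPart W (S := {1, 4}) (by decide) (fun i => if i = 1 then {0, 4} else {1, 5})
    (by decide) (by decide) (by decide) (by decide)

set_option maxRecDepth 4000 in
lemma acyclic_right (W : Set E) :
    SingularChain.Acyclic (h.complex.fullSpace W ∩ h.bandPart {{4, 5}, {2, 3}}) :=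
  h.acyclic_bandPart W (S := {3, 4}) (by decide) (fun i => if i = 3 then {2, 4} else {3, 5})
    (by decide) (by decide) (by decide) (by decide)

set_option maxRecDepth 4000 in
/-- The open band is star-shaped about `e`, or about `f` if `e` is not in `W`. -/
lemma acyclic_middle (W : Set E) :
    SingularChain.Acyclic (h.complex.fullSpace W ∩ h.bandPart {{4, 5}}) :=
  h.acyclic_bandPart W (S := {4}) (by decide) (fun _ => {5})
    (by decide) (by decide) (by decide) (by decide)

lemma mem_space_of_baryCoord_eq_zero {x : E} (hx : x ∈ h.complex.space)
    (h4 : h.complex.baryCoord x (h.emb 4) = 0) (h5 : h.complex.baryCoord x (h.emb 5) = 0) :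
    x ∈ K.space := by
  obtain ⟨s, hs | ⟨T, hT, rfl⟩, hw, hpos⟩ := exists_carrier hx
  · exact convexHull_subset_space hs hw.mem_convexHull
  · refine convexHull_subset_space (h.map_mem_faces hT.1 (hT.subset_of_notMem ?_ ?_))
      hw.mem_convexHull
    · exact fun h4T => ((hpos _).1 (Finset.mem_map_of_mem _ h4T)).ne' h4
    · exact fun h5T => ((hpos _).1 (Finset.mem_map_of_mem _ h5T)).ne' h5

lemma sum_baryCoord_eq_one {x : E} (hx : x ∈ h.complex.space)
    (hm : 0 < ∑ i ∈ {4, 5}, h.complex.baryCoord x (h.emb i)) :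
    ∑ i ∈ {4, 5}, h.complex.baryCoord x (h.emb i) + ∑ i ∈ {0, 1}, h.complex.baryCoord x (h.emb i) +
      ∑ i ∈ {2, 3}, h.complex.baryCoord x (h.emb i) = 1 := by
  obtain ⟨T, -, hw, -⟩ := h.exists_band_carrier hx hm
  have := (h.sum_of_isWeight hw).1
  rw [← this, Fin.sum_univ_six, Finset.sum_pair (by decide), Finset.sum_pair (by decide),
    Finset.sum_pair (by decide)]
  ring

lemma fullSpace_subset_fullSpace_complex (W : Set E) : K.fullSpace W ⊆ h.complex.fullSpace W :=
  fun x hx => ⟨space_mono h.le_complex hx.1, fun v hv => by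
    rw [baryCoord_eq_of_le h.le_complex hx.1]
    exact hx.2 v hv⟩

/-- The radial projection away from `e` and `f` is defined where their total weight is less than
`1`. -/
lemma mass_pos (hK : h.complex.faces.Finite) {x : E} (hx : x ∈ h.complex.space)
    (hm : ∑ i ∈ {4, 5}, h.complex.baryCoord x (h.emb i) < 1) :
    0 < mass hK {v | v ≠ h.emb 4 ∧ v ≠ h.emb 5} x := by
  obtain ⟨s, hs, hw, hpos⟩ := exists_carrier hx
  obtain ⟨v, hvs, hv⟩ : ∃ v ∈ s, v ≠ h.emb 4 ∧ v ≠ h.emb 5 := by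
    by_contra! hne
    have hsub : s ⊆ ({4, 5} : Finset (Fin 6)).map h.emb := fun v hv => by
      by_cases h4 : v = h.emb 4
      · exact h4 ▸ Finset.mem_map_of_mem _ (by decide)
      · exact hne v hv h4 ▸ Finset.mem_map_of_mem _ (by decide)
    have := (hw.mono hsub).sum_eq
    rw [Finset.sum_map] at this
    exact hm.ne this
  exact ((hpos v).1 hvs).trans_le (baryCoord_le_mass hK hx hv)

section FiniteDimensional

variable [FiniteDimensional ℝ E]

lemma continuousOn_sum_baryCoord (hK : h.complex.faces.Finite) (g : Finset (Fin 6)) :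
    ContinuousOn (fun x => ∑ i ∈ g, h.complex.baryCoord x (h.emb i)) h.complex.space :=
  continuousOn_finsetSum _ fun _ _ => continuousOn_baryCoord hK _

lemma exists_isOpen_bandPart (hK : h.complex.faces.Finite) (G : Finset (Finset (Fin 6))) :
    ∃ O, IsOpen O ∧ h.complex.space ∩ h.bandPart G = h.complex.space ∩ O := by
  have := fun g => continuousOn_iff'.1 (h.continuousOn_sum_baryCoord hK g) (Set.Ioi 0) isOpen_Ioi
  choose O hO hOg using this
  refine ⟨⋂ g ∈ G, O g, isOpen_biInter_finset fun g _ => hO g, ?_⟩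
  ext x
  refine and_congr_right fun hx => ?_
  have hg : ∀ g, 0 < ∑ i ∈ g, h.complex.baryCoord x (h.emb i) ↔ x ∈ O g := fun g =>
    ⟨fun h' => ((hOg g).le ⟨h', hx⟩).1, fun h' => ((hOg g).ge ⟨h', hx⟩).1⟩
  simp only [bandPart, Set.mem_ofPred_eq, hg, Set.mem_iInter, hx, true_and]

/-- Attaching the band preserves the injectivity in positive degrees of the homology of full
subcomplexes. -/
lemma homologyInjective_succ_complex (hK : K.faces.Finite) (W : Set E) (n : ℕ)
    (hX : SingularChain.HomologyInjective (n + 1) K.space h.complex.space)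
    (hA : SingularChain.HomologyInjective (n + 1) (K.fullSpace W) K.space) :
    SingularChain.HomologyInjective (n + 1) (h.complex.fullSpace W) h.complex.space := by
  have hK' := h.finite_complex hK
  have hU : ∃ O, IsOpen O ∧ h.complex.space ∩
      {x | ∑ i ∈ {4, 5}, h.complex.baryCoord x (h.emb i) < 1} = h.complex.space ∩ O := by
    obtain ⟨O, hO, h'⟩ := continuousOn_iff'.1 (h.continuousOn_sum_baryCoord hK' {4, 5})
      (Set.Iio 1) isOpen_Iio
    exact ⟨O, hO, by rw [Set.inter_comm, Set.inter_comm _ O]; exact h'⟩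
  refine SingularChain.homologyInjective_of_band (h.fullSpace_subset_fullSpace_complex W)
    (fullSpace_subset_space W) hU (h.exists_isOpen_bandPart hK' {{4, 5}}) ?_
    (h.exists_isOpen_bandPart hK' {{4, 5}, {0, 1}}) (h.exists_isOpen_bandPart hK' {{4, 5}, {2, 3}})
    ?_ ?_ (h.acyclic_left W) (h.acyclic_right W) (h.acyclic_middle W) n ?_ hX
    (fullSpace_subset_space W) hA
  · intro x hx
    rcases lt_or_ge 0 (∑ i ∈ {4, 5}, h.complex.baryCoord x (h.emb i)) with hm | hm
    · exact Or.inr ⟨hx, by simpa using hm⟩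
    · exact Or.inl (hm.trans_lt one_pos)
  · rw [Set.disjoint_left]
    intro x hL hR
    obtain ⟨T, hT, hTG, -, hpos⟩ := h.exists_band_carrier_of_mem (by decide) hL
    obtain ⟨i, hi, hi0⟩ : ∃ i ∈ ({2, 3} : Finset (Fin 6)), 0 < h.complex.baryCoord x (h.emb i) :=
      Finset.exists_lt_of_sum_lt (by rw [Finset.sum_const_zero]; exact hR.2 _ (by decide))
    have hTR : ∃ i ∈ ({2, 3} : Finset (Fin 6)), i ∈ T := ⟨i, hi, (hpos i).2 hi0⟩
    exact hT.not_left_and_right (hTG _ (by decide)) (hTG _ (by decide)) hTR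
  · ext x
    constructor
    · rintro ⟨⟨hx, hxU⟩, -, hxV⟩
      have hm := hxV {4, 5} (by decide)
      have hpair : ∀ g : Finset (Fin 6), 0 < ∑ i ∈ {4, 5}, h.complex.baryCoord x (h.emb i) →
          0 < ∑ i ∈ g, h.complex.baryCoord x (h.emb i) →
          ∀ g' ∈ ({{4, 5}, g} : Finset (Finset (Fin 6))),
            0 < ∑ i ∈ g', h.complex.baryCoord x (h.emb i) := by
        intro g h₁ h₂ g' hg'
        rcases Finset.mem_insert.1 hg' with rfl | hg'
        exacts [h₁, Finset.mem_singleton.1 hg' ▸ h₂]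
      refine ⟨hx, ?_⟩
      rcases lt_or_ge 0 (∑ i ∈ {0, 1}, h.complex.baryCoord x (h.emb i)) with hl | hl
      · exact Or.inl ⟨hx, hpair _ hm hl⟩
      · refine Or.inr ⟨hx, hpair _ hm ?_⟩
        have h1 := h.sum_baryCoord_eq_one hx hm
        have hxU : ∑ i ∈ {4, 5}, h.complex.baryCoord x (h.emb i) < 1 := hxU
        linarith
    · rintro ⟨hx, hxLR⟩
      obtain ⟨g, hg, hm⟩ : ∃ g ∈ ({{0, 1}, {2, 3}} : Finset (Finset (Fin 6))),
          0 < ∑ i ∈ {4, 5}, h.complex.baryCoord x (h.emb i) ∧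
          0 < ∑ i ∈ g, h.complex.baryCoord x (h.emb i) := by
        rcases hxLR with hx | hx
        · exact ⟨{0, 1}, by decide, hx.2 _ (by decide), hx.2 _ (by decide)⟩
        · exact ⟨{2, 3}, by decide, hx.2 _ (by decide), hx.2 _ (by decide)⟩
      have h1 := h.sum_baryCoord_eq_one hx hm.1
      have h0 : ∀ g : Finset (Fin 6), 0 ≤ ∑ i ∈ g, h.complex.baryCoord x (h.emb i) := fun g =>
        Finset.sum_nonneg fun i _ => baryCoord_nonneg hx _
      refine ⟨⟨hx, ?_⟩, hx, by simpa using hm.1⟩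
      change ∑ i ∈ {4, 5}, h.complex.baryCoord x (h.emb i) < 1
      have h01 := h0 {0, 1}
      have h23 := h0 {2, 3}
      rcases Finset.mem_insert.1 hg with rfl | hg
      · linarith
      · rw [Finset.mem_singleton.1 hg] at hm
        linarith
  · intro c hc hcyc
    refine SingularChain.exists_homologous_of_segment_subset
      (f := proj hK' {v | v ≠ h.emb 4 ∧ v ≠ h.emb 5}) ?_ ?_ ?_ hc hcyc
    · exact (continuousOn_proj hK' _).mono fun x hx => ⟨hx.1.1, h.mass_pos hK' hx.1.1 hx.2⟩
    · rintro x ⟨hxW, hxU⟩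
      have hm := h.mass_pos hK' hxW.1 hxU
      obtain ⟨hp, hp0⟩ := proj_mem_fullSpace hK' hxW.1 hm
      have hpK := h.mem_space_of_baryCoord_eq_zero hp (hp0 _ fun h' => h'.1 rfl)
        (hp0 _ fun h' => h'.2 rfl)
      refine ⟨hpK, fun v hv => ?_⟩
      rw [← baryCoord_eq_of_le h.le_complex hpK]
      exact baryCoord_proj_eq_zero hK' hxW.1 hm (hxW.2 v hv)
    · exact fun x hx => segment_proj_subset hK' hx.1 (h.mass_pos hK' hx.1.1 hx.2)

end FiniteDimensional

/-- In degree zero, it suffices that each of the two new vertices is joined inside any open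
half-space that contains it to a vertex of `K`. -/
lemma homologyInjective_zero_complex (hK : K.faces.Finite) (hc : IsConnected K.space)
    (l : E →ₗ[ℝ] ℝ) (r : ℝ)
    (hA : SingularChain.HomologyInjective 0 (K.fullSpace {v | r < l v}) K.space) :
    SingularChain.HomologyInjective 0 (h.complex.fullSpace {v | r < l v}) h.complex.space := by
  classical
  have hedge : ∀ i j : Fin 6, IsBandFace {i, j} → r < l (h.emb i) → r < l (h.emb j) →
      JoinedIn (h.complex.fullSpace {v | r < l v}) (h.emb i) (h.emb j) := by
    intro i j hij hi hj
    refine joinedIn_fullSpace_of_edge ?_ hi hj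
    have := h.band_mem_faces hij
    rwa [Finset.map_insert, Finset.map_singleton] at this
  have he : l (h.emb 4) = (1 / 6) * (2 * l (h.emb 0) + l (h.emb 1) + 2 * l (h.emb 2) +
      l (h.emb 3)) := by
    simp only [emb_apply, bandPoint, Matrix.cons_val, map_smul, map_add, smul_eq_mul]
    ring
  -- `f` is a mean of its neighbours `e`, `b` and `d`.
  have hf : l (h.emb 5) = 1 / 2 * l (h.emb 4) + 1 / 4 * (l (h.emb 1) + l (h.emb 3)) := by
    rw [he]
    simp only [emb_apply, bandPoint, Matrix.cons_val, map_smul, map_add, smul_eq_mul]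
    ring
  have hvert : ∀ i : Fin 6, r < l (h.emb i) → ∃ v ∈ K.vertices, r < l v ∧
      JoinedIn (h.complex.fullSpace {v | r < l v}) (h.emb i) v := by
    have hold : ∀ i : Fin 6, i ≠ 4 ∧ i ≠ 5 → ∀ j, IsBandFace {j, i} → r < l (h.emb j) →
        r < l (h.emb i) → ∃ v ∈ K.vertices, r < l v ∧
          JoinedIn (h.complex.fullSpace {v | r < l v}) (h.emb j) v := fun i hi j hji hj hli =>
      ⟨h.emb i, h.emb_mem_vertices hi, hli, hedge j i hji hj hli⟩
    have h4 : r < l (h.emb 4) → ∃ v ∈ K.vertices, r < l v ∧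
        JoinedIn (h.complex.fullSpace {v | r < l v}) (h.emb 4) v := by
      intro hr
      by_cases h0 : r < l (h.emb 0)
      · exact hold 0 (by decide) 4 (by decide) hr h0
      by_cases h1 : r < l (h.emb 1)
      · exact hold 1 (by decide) 4 (by decide) hr h1
      by_cases h2 : r < l (h.emb 2)
      · exact hold 2 (by decide) 4 (by decide) hr h2
      by_cases h3 : r < l (h.emb 3)
      · exact hold 3 (by decide) 4 (by decide) hr h3
      linarith
    have hself : ∀ i : Fin 6, IsBandFace {i, i} := by decide
    intro i hr
    by_cases hi : i ≠ 4 ∧ i ≠ 5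
    · exact ⟨h.emb i, h.emb_mem_vertices hi, hr, hedge i i (hself i) hr hr⟩
    obtain rfl | rfl : i = 4 ∨ i = 5 := by tauto
    · exact h4 hr
    · by_cases h1 : r < l (h.emb 1)
      · exact hold 1 (by decide) 5 (by decide) hr h1
      by_cases h3 : r < l (h.emb 3)
      · exact hold 3 (by decide) 5 (by decide) hr h3
      obtain ⟨v, hv, hlv, hj⟩ := h4 (by linarith)
      exact ⟨v, hv, hlv, (hedge 5 4 (by decide) hr (by linarith)).trans hj⟩
  have hall : ∀ x ∈ h.complex.fullSpace {v | r < l v}, ∃ v ∈ K.vertices, r < l v ∧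
      JoinedIn (h.complex.fullSpace {v | r < l v}) x v := by
    intro x hx
    obtain ⟨v, hv, hlv, hj⟩ := joinedIn_fullSpace_vertex hx
    rw [vertices_complex] at hv
    rcases hv with hv | rfl | rfl
    · exact ⟨v, hv, hlv, hj⟩
    · obtain ⟨u, hu, hlu, hj'⟩ := hvert 4 hlv
      exact ⟨u, hu, hlu, hj.trans hj'⟩
    · obtain ⟨u, hu, hlu, hj'⟩ := hvert 5 hlv
      exact ⟨u, hu, hlu, hj.trans hj'⟩
  have hmem : ∀ v ∈ K.vertices, r < l v → v ∈ K.fullSpace {v | r < l v} := fun v hv hlv =>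
    ⟨K.subset_space hv (by simp), fun u hu => by
      rw [baryCoord_vertex hv, Pi.single_eq_of_ne]
      rintro rfl
      exact hu hlv⟩
  refine SingularChain.homologyInjective_zero_of_joinedIn fun x hx y hy => ?_
  obtain ⟨u, hu, hlu, hxu⟩ := hall x hx
  obtain ⟨v, hv, hlv, hyv⟩ := hall y hy
  have huv := SingularChain.joinedIn_of_homologyInjective_zero (fullSpace_subset_space _)
    (isPathConnected_space hK hc) hA (hmem u hu hlu) (hmem v hv hlv)
  exact (hxu.trans (huv.mono (h.fullSpace_subset_fullSpace_complex _))).trans hyv.symm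

end HandleSite

end Geometry.SimplicialComplex

open Classical in
theorem mainTheorem4 {n : ℕ} (K : SimplicialComplex ℝ (EuclideanSpace ℝ (Fin n)))
    (hK : IsPolyhedralSurface K)
    (a b c d : EuclideanSpace ℝ (Fin n))
    (habcd : AffineIndependent ℝ ![a, b, c, d])
    (hab : IsBoundaryEdge K {a, b}) (hcd : IsBoundaryEdge K {c, d})
    (hint : Disjoint (Affine.Simplex.mk ![a, b, c, d] habcd).interior K.space)
    (γ₀ γ₁ : unitInterval → EuclideanSpace ℝ (Fin n))
    (hγ₀ : IsSegmentParam γ₀ a b) (hγ₁ : IsSegmentParam γ₁ c d) :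
    ∃ K' : SimplicialComplex ℝ (EuclideanSpace ℝ (Fin n)),
      IsPolyhedralSurface K' ∧
      K ≤ K' ∧
      K'.vertices = K.vertices ∪
        {(1 / 6 : ℝ) • ((2 : ℝ) • a + (1 : ℝ) • b + (2 : ℝ) • c + (1 : ℝ) • d),
          (1 / 6 : ℝ) • ((1 : ℝ) • a + (2 : ℝ) • b + (1 : ℝ) • c + (2 : ℝ) • d)} ∧
      K'.space ⊆ K.space ∪ convexHull ℝ {a, b, c, d} ∧
      (∃ Φ : HandleAttachment K.space γ₀ γ₁ ≃ₜ K'.space,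
        ∀ x : K.space, (Φ (Quot.mk _ (Sum.inl x)) : EuclideanSpace ℝ (Fin n)) = x) ∧
      (IsPTight 0 K.space → IsPTight 0 K'.space) ∧
      (IsTight K.space → IsTight K'.space) ∧
      (K.vertices ⊆ surfaceBoundary K → K'.vertices ⊆ surfaceBoundary K') := by
  classical
  let h : K.HandleSite a b c d :=
    { indep := habcd
      left := by convert hab.1
      right := by convert hcd.1
      notMem := by
        intro α β γ δ hα hβ hγ hδ h1 hmem
        refine Set.disjoint_left.1 hint ?_ hmem
        have hsum : ∑ i, ![α, β, γ, δ] i = 1 := by simpa [Fin.sum_univ_four] using h1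
        have := (Affine.Simplex.affineCombination_mem_interior_iff
          (s := Affine.Simplex.mk ![a, b, c, d] habcd) hsum).2 (by
            intro i
            fin_cases i <;> constructor <;> simp <;> linarith)
        rw [Finset.univ.affineCombination_eq_linear_combination _ _ hsum] at this
        simpa [Fin.sum_univ_four] using this }
  have hS₀ : IsBoundaryEdge K (({0, 1} : Finset (Fin 6)).map h.emb) := by
    convert hab
    rw [Finset.map_insert, Finset.map_singleton]
    rfl
  have hS₁ : IsBoundaryEdge K (({2, 3} : Finset (Fin 6)).map h.emb) := by
    convert hcd
    rw [Finset.map_insert, Finset.map_singleton]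
    rfl
  have hfin := h.finite_complex hK.finite
  have hzero : IsPTight 0 K.space → IsPTight 0 h.complex.space := by
    intro hT l hl r
    have := (homologyMod2Inclusion_injective_iff _).1 (hT l hl r)
    rw [SimplicialComplex.homologyInjective_halfSpace_iff l r hK.finite] at this
    rw [homologyMod2Inclusion_injective_iff,
      SimplicialComplex.homologyInjective_halfSpace_iff l r hfin]
    exact h.homologyInjective_zero_complex hK.finite hK.connected l r this
  refine ⟨h.complex, h.isPolyhedralSurface_complex hK hS₀ hS₁, h.le_complex, h.vertices_complex,
    h.space_complex_subset, h.exists_homeomorph hK.finite hγ₀ hγ₁, hzero, fun hT p => ?_,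
    h.vertices_complex_subset_surfaceBoundary⟩
  cases p with
  | zero => exact hzero (hT 0)
  | succ p =>
    intro l hl r
    have := (homologyMod2Inclusion_injective_iff _).1 (hT (p + 1) l hl r)
    rw [SimplicialComplex.homologyInjective_halfSpace_iff l r hK.finite] at this
    rw [homologyMod2Inclusion_injective_iff,
      SimplicialComplex.homologyInjective_halfSpace_iff l r hfin]
    exact h.homologyInjective_succ_complex hK.finite _ p
      (h.homologyInjective_space_complex hK.finite hK.connected hγ₀ hγ₁ (p + 1)) this
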